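/- A \emph{graph} is a finite undirected multigraph $G=(V,E)$ with $V\neq\emptyset$; loops and multiple edges are allowed, $G$ need not be connected, and the degree of a vertex is the number of non-loops at it plus twice the number of loops at it. A \emph{closed orientable surface} $S$ is a compact connected orientable surface without boundary, and it is considered with a finite triangulation. An \emph{embedding} of $G$ in $S$ sends distinct vertices to distinct points and each edge to a simple arc in $S$ (a simple closed curve if the edge is a loop) joining the images of its ends, such that no image of a vertex lies in the interior of an arc and different arcs do not meet at an interior point of either. The image $M\subset S$ of the embedding is required to be a $1$-dimensional subcomplex of some such triangulation of $S$. A set $M\subset S$ is \emph{separating} if $S\setminus M$ is not connected, and \emph{minimal separating} if moreover no proper subset of $M$ is separating. Call $G$ a \emph{minimal separating graph} if there are a closed orientable surface $S$ (of some genus $g\ge 0$) and an embedding of $G$ in $S$ whose image is a minimal separating set of $S$. \textbf{Theorem.} A graph $G$ is a minimal separating graph if and only if every vertex of $G$ has positive even degree. -/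

import Mathlib

namespace MinSep

/-! ### Separating sets of a topological space -/

/-- `M` separates `S` if its complement is not connected (it is the union of two disjoint nonempty
relatively open subsets). -/
def Separates {S : Type*} [TopologicalSpace S] (M : Set S) : Prop :=
  ¬ IsPreconnected Mᶜ

/-- `M` separates `S` and no proper subset of `M` does. -/
def IsMinimalSeparatingSet {S : Type*} [TopologicalSpace S] (M : Set S) : Prop :=
  Separates M ∧ ∀ N : Set S, N ⊂ M → ¬ Separates N

/-! ### Graphs -/

/-- The degree of a vertex of a multigraph: the number of non-loops at `v` plus twice the number of
loops at `v`. -/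
noncomputable def degree {α β : Type*} (G : Graph α β) (v : α) : ℕ :=
  {e | G.IsNonloopAt e v}.ncard + 2 * {e | G.IsLoopAt e v}.ncard

/-- An embedding of a multigraph in a topological space `S`: distinct vertices go to distinct
points, and every edge goes to a simple arc (a simple closed curve if the edge is a loop), given by
a parametrization on `[0,1]`, that joins the images of the ends of the edge, has no image of
a vertex in its interior, and does not meet another arc at an interior point of either.
The values of `vert` and `arc` outside the vertex set and the edge set are irrelevant. -/
structure GraphEmbedding {α β : Type*} (G : Graph α β) (S : Type*) [TopologicalSpace S] where
  vert : α → S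
  arc : β → unitInterval → S
  vert_injOn : Set.InjOn vert G.vertexSet
  arc_continuous : ∀ e ∈ G.edgeSet, Continuous (arc e)
  arc_ends : ∀ e x y, G.IsLink e x y →
    (arc e 0 = vert x ∧ arc e 1 = vert y) ∨ (arc e 0 = vert y ∧ arc e 1 = vert x)
  arc_simple : ∀ e ∈ G.edgeSet, ∀ s t, arc e s = arc e t →
    s = t ∨ (s = 0 ∧ t = 1) ∨ (s = 1 ∧ t = 0)
  vert_ne_arc : ∀ e ∈ G.edgeSet, ∀ v ∈ G.vertexSet, ∀ t ∈ Set.Ioo (0 : unitInterval) 1,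
    vert v ≠ arc e t
  arc_ne_arc : ∀ e ∈ G.edgeSet, ∀ f ∈ G.edgeSet, e ≠ f →
    ∀ s ∈ Set.Ioo (0 : unitInterval) 1, ∀ t, arc e s ≠ arc f t

/-- The image of a graph embedding. -/
def GraphEmbedding.image {α β : Type*} {G : Graph α β} {S : Type*} [TopologicalSpace S]
    (φ : GraphEmbedding G S) : Set S :=
  φ.vert '' G.vertexSet ∪ ⋃ e ∈ G.edgeSet, Set.range (φ.arc e)

/-! ### Triangulated closed orientable surfaces -/

section Surfaces

variable {E : Type*} [AddCommGroup E] [Module ℝ E]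

open scoped Classical in
/-- The link of the vertex `v` in `K`, as a graph: its vertices are the neighbours `w` of `v`, and
`a`, `b` are adjacent in it if `v`, `a`, `b` span a triangle of `K`. -/
def linkGraph (K : Geometry.SimplicialComplex ℝ E) (v : E) :
    SimpleGraph {w : E // w ≠ v ∧ ({v, w} : Finset E) ∈ K.faces} where
  Adj a b := a ≠ b ∧ ({v, a.1, b.1} : Finset E) ∈ K.faces
  symm := ⟨fun a b h => ⟨h.1.symm, by
    have : ({v, b.1, a.1} : Finset E) = {v, a.1, b.1} := by
      rw [Finset.pair_comm]
    rw [this]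
    exact h.2⟩⟩
  loopless := ⟨fun _ h => h.1 rfl⟩

/-- `K` triangulates a connected closed surface: it is a finite simplicial complex of dimension at
most two with connected underlying space, in which the link of every vertex is a cycle
(a connected 2-regular finite graph). -/
structure IsClosedSurface [TopologicalSpace E] (K : Geometry.SimplicialComplex ℝ E) : Prop where
  finite : K.faces.Finite
  connected : IsConnected K.space
  card_le_three : ∀ s ∈ K.faces, s.card ≤ 3
  link_connected : ∀ v ∈ K.vertices, (linkGraph K v).Connected
  link_two_regular : ∀ v ∈ K.vertices, ∀ w, ((linkGraph K v).neighborSet w).ncard = 2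

open scoped Classical in
/-- `a`, `b`, `c` are the three vertices of a triangle of `K`. -/
def IsTriangle (K : Geometry.SimplicialComplex ℝ E) (a b c : E) : Prop :=
  a ≠ b ∧ b ≠ c ∧ a ≠ c ∧ ({a, b, c} : Finset E) ∈ K.faces

/-- The triangles of `K` can be oriented coherently. Here `pos a b c` says that `(a, b, c)` is
a positive order of the vertices of a triangle; exactly one of the two cyclic orders of each
triangle is positive, and two triangles with a common edge induce opposite directions on it. -/
def IsOrientable (K : Geometry.SimplicialComplex ℝ E) : Prop :=
  ∃ pos : E → E → E → Prop, ∀ a b c, IsTriangle K a b c →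
    (pos a b c ↔ pos b c a) ∧ (pos a b c ↔ ¬ pos b a c) ∧
    ∀ d, d ≠ c → IsTriangle K a b d → (pos a b c ↔ pos b a d)

/-- A subset of the underlying space of `K` is the underlying set of a subcomplex of `K` of
dimension at most one. (Closing `L` under faces does not change the union.) -/
def IsOneSubcomplex (K : Geometry.SimplicialComplex ℝ E) (M : Set K.space) : Prop :=
  ∃ L : Set (Finset E), L ⊆ K.faces ∧ (∀ s ∈ L, s.card ≤ 2) ∧
    (Subtype.val '' M : Set E) = ⋃ s ∈ L, convexHull ℝ (s : Set E)

end Surfaces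

/-- `G` has an embedding in some connected closed orientable surface `S`, as a finite
1-dimensional subcomplex of a triangulation of `S`, whose image is a minimal separating set
of `S`. -/
def IsMinimalSeparatingGraph {α β : Type*} (G : Graph α β) : Prop :=
  ∃ (n : ℕ) (K : Geometry.SimplicialComplex ℝ (EuclideanSpace ℝ (Fin n))),
    IsClosedSurface K ∧ IsOrientable K ∧
    ∃ φ : GraphEmbedding G K.space, IsOneSubcomplex K φ.image ∧ IsMinimalSeparatingSet φ.image

end MinSep

/-! Necessity. Let `M` be a minimal separating closed set. Every point of `M` is a limit of both
sides, since otherwise removing a neighbourhood of a bad point from `M` would leave a smaller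
separating set (`IsMinimalSeparatingSet.exists_open`). If `M` is a subcomplex, the triangles around
a vertex `p` of the triangulation form a cycle, each lies on one side, and the side changes exactly
at the edges of `M` at `p`. So their number is even (`even_card_edges`), and it is not zero, for
otherwise everything around `p` would be on one side (`exists_edge`). The given arcs need not be
edges of the triangulation, so the two descriptions of `M` near a point are compared as stars: the
number of legs of a star depends only on `M` (`IsStar.card_eq`), and the embedding provides a star
with as many legs as the degree.

Sufficiency. Pair the edge ends at each vertex by a fixed-point-free involution. This involution and
the one exchanging the two ends of each edge have a common proper two-colouring
(`exists_two_coloring`): an orientation of the graph in which heads are paired with tails at every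
vertex. Hence there is a permutation `ρ` of the edges such that `ρ e` starts where `e` ends. Let `κ`
permute cyclically the edges with a given head. Lay a strip along each side of each edge. At the
head of `e`, the strip continues along `ρ e` on one side of the graph and along `ρ (κ e)` on the
other. Turning around a vertex then follows `ρ⁻¹ (ρ κ) = κ`, a single cycle, so each vertex of the
graph becomes one point of the surface. The outer borders of the strips are glued by a cyclic
permutation of all edges, which makes each side connected. Two connected open sides with the graph
in both closures make it minimal separating (`isMinimalSeparatingSet_of_closure`).

The surface is glued from triangles with sides coloured by `Fin 3`, by one involution for each
colour, and orientable because all gluings reverse a sign. Its barycentric subdivision is a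
simplicial complex even where the triangles meet in more than a side. -/

namespace MinSep

/-! ### Barycentric coordinates and carriers -/

section Coordinates

variable {E : Type*} [NormedAddCommGroup E] [NormedSpace ℝ E]
  {K : Geometry.SimplicialComplex ℝ E}

/-- `s` is the smallest face containing `x` and `w` are the barycentric coordinates of `x`. -/
structure IsCoord (K : Geometry.SimplicialComplex ℝ E) (x : E) (s : Finset E) (w : E → ℝ) :
    Prop where
  face : s ∈ K.faces
  pos : ∀ v ∈ s, 0 < w v
  zero : ∀ v ∉ s, w v = 0
  sum : ∑ v ∈ s, w v = 1
  comb : ∑ v ∈ s, w v • v = x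

theorem eq_on_face {s : Finset E} (hs : s ∈ K.faces) {w w' : E → ℝ}
    (h : ∑ v ∈ s, w v = ∑ v ∈ s, w' v) (h' : ∑ v ∈ s, w v • v = ∑ v ∈ s, w' v • v) :
    ∀ v ∈ s, w v = w' v := by
  intro v hv
  have := affineIndependent_iff.1 (K.indep hs) Finset.univ (fun v => w v - w' v) ?_ ?_ ⟨v, hv⟩
    (Finset.mem_univ _)
  · exact sub_eq_zero.1 this
  · rw [Finset.sum_coe_sort s (fun v => w v - w' v), Finset.sum_sub_distrib, h, sub_self]
  · rw [Finset.sum_coe_sort s (fun v => (w v - w' v) • v)]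
    simp only [sub_smul, Finset.sum_sub_distrib, h', sub_self]

open scoped Classical in
theorem isCoord_filter {t : Finset E} (ht : t ∈ K.faces) {w : E → ℝ} (h0 : ∀ v ∈ t, 0 ≤ w v)
    (hz : ∀ v ∉ t, w v = 0) (hs : ∑ v ∈ t, w v = 1) {x : E} (hc : ∑ v ∈ t, w v • v = x) :
    IsCoord K x {v ∈ t | w v ≠ 0} w where
  face := by
    refine K.down_closed ht (Finset.filter_subset _ _) ?_
    by_contra h
    rw [Finset.not_nonempty_iff_eq_empty, Finset.filter_eq_empty_iff] at h
    rw [Finset.sum_eq_zero fun v hv => by simpa using h hv] at hs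
    exact zero_ne_one hs
  pos v hv := by
    rw [Finset.mem_filter] at hv
    exact lt_of_le_of_ne (h0 v hv.1) hv.2.symm
  zero v hv := by
    by_contra h
    exact hv (Finset.mem_filter.2 ⟨by_contra fun h' => h (hz v h'), h⟩)
  sum := by rw [Finset.sum_filter_ne_zero, hs]
  comb := by
    rw [← hc]
    refine Finset.sum_subset (Finset.filter_subset _ _) fun v hv hv' => ?_
    have : w v = 0 := by
      by_contra h
      exact hv' (Finset.mem_filter.2 ⟨hv, h⟩)
    rw [this, zero_smul]

theorem exists_weights {s : Finset E} {x : E} (hx : x ∈ convexHull ℝ (s : Set E)) :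
    ∃ w : E → ℝ, (∀ v ∈ s, 0 ≤ w v) ∧ (∀ v ∉ s, w v = 0) ∧ ∑ v ∈ s, w v = 1 ∧
      ∑ v ∈ s, w v • v = x := by
  classical
  obtain ⟨w, h0, h1, h2⟩ := Finset.mem_convexHull'.1 hx
  refine ⟨fun v => if v ∈ s then w v else 0, fun v hv => ?_, fun v hv => ?_, ?_, ?_⟩
  · simpa [hv] using h0 v hv
  · simp [hv]
  · rw [← h1]
    exact Finset.sum_congr rfl fun v hv => by simp [hv]
  · rw [← h2]
    exact Finset.sum_congr rfl fun v hv => by simp [hv]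

theorem exists_isCoord {x : E} (hx : x ∈ K.space) : ∃ s w, IsCoord K x s w := by
  obtain ⟨s, hs, hx⟩ := Geometry.SimplicialComplex.mem_space_iff.1 hx
  obtain ⟨w, h0, hz, h1, h2⟩ := exists_weights hx
  exact ⟨_, w, isCoord_filter hs h0 hz h1 h2⟩

theorem IsCoord.mem_convexHull {x : E} {s t : Finset E} {w : E → ℝ} (h : IsCoord K x s w)
    (hst : s ⊆ t) : x ∈ convexHull ℝ (t : Set E) :=
  convexHull_mono (Finset.coe_subset.2 hst)
    (Finset.mem_convexHull'.2 ⟨w, fun v hv => (h.pos v hv).le, h.sum, h.comb⟩)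

/-- Faces meet along common vertices, so `x` is also a combination of `s ∩ t`. Uniqueness of
coordinates on `s` forbids a positive weight outside `t`. -/
theorem IsCoord.subset_of_mem {x : E} {s t : Finset E} {w : E → ℝ} (h : IsCoord K x s w)
    (ht : t ∈ K.faces) (hx : x ∈ convexHull ℝ (t : Set E)) : s ⊆ t := by
  classical
  have hx' := K.inter_subset_convexHull h.face ht ⟨h.mem_convexHull subset_rfl, hx⟩
  rw [← Finset.coe_inter] at hx'
  obtain ⟨w', -, hz, h1, h2⟩ := exists_weights hx'
  have hsub : s ∩ t ⊆ s := Finset.inter_subset_left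
  have := eq_on_face h.face (w := w) (w' := w') ?_ ?_
  · intro v hv
    by_contra hvt
    have h3 := h.pos v hv
    rw [this v hv, hz v (by simp [hvt])] at h3
    exact lt_irrefl _ h3
  · rw [h.sum, ← h1]
    exact Finset.sum_subset hsub fun v _ hv => hz v hv
  · rw [h.comb, ← h2]
    exact Finset.sum_subset hsub fun v _ hv => by rw [hz v hv, zero_smul]

theorem IsCoord.unique {x : E} {s s' : Finset E} {w w' : E → ℝ} (h : IsCoord K x s w)
    (h' : IsCoord K x s' w') : s = s' ∧ w = w' := by
  have hs : s = s' := (h.subset_of_mem h'.face (h'.mem_convexHull subset_rfl)).antisymm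
    (h'.subset_of_mem h.face (h.mem_convexHull subset_rfl))
  subst hs
  refine ⟨rfl, funext fun v => ?_⟩
  by_cases hv : v ∈ s
  · exact eq_on_face h.face (h.sum.trans h'.sum.symm) (h.comb.trans h'.comb.symm) v hv
  · rw [h.zero v hv, h'.zero v hv]

/-- The smallest face containing a point of the underlying space. -/
noncomputable def carrier (x : K.space) : Finset E := (exists_isCoord x.2).choose

/-- The barycentric coordinates of a point of the underlying space. -/
noncomputable def coord (x : K.space) : E → ℝ := (exists_isCoord x.2).choose_spec.choose

theorem isCoord (x : K.space) : IsCoord K x (carrier x) (coord x) :=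
  (exists_isCoord x.2).choose_spec.choose_spec

theorem carrier_mem_faces (x : K.space) : carrier x ∈ K.faces := (isCoord x).face

theorem carrier_nonempty (x : K.space) : (carrier x).Nonempty :=
  K.nonempty_of_mem_faces (carrier_mem_faces x)

theorem coord_nonneg (x : K.space) (v : E) : 0 ≤ coord x v := by
  by_cases hv : v ∈ carrier x
  · exact ((isCoord x).pos v hv).le
  · exact ((isCoord x).zero v hv).ge

theorem mem_carrier {x : K.space} {v : E} : v ∈ carrier x ↔ 0 < coord x v := by
  refine ⟨(isCoord x).pos v, fun h => ?_⟩
  by_contra hv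
  exact h.ne' ((isCoord x).zero v hv)

theorem coord_eq_zero {x : K.space} {v : E} (h : v ∉ carrier x) : coord x v = 0 :=
  (isCoord x).zero v h

theorem sum_coord {x : K.space} {t : Finset E} (ht : carrier x ⊆ t) : ∑ v ∈ t, coord x v = 1 := by
  rw [← (isCoord x).sum]
  exact (Finset.sum_subset ht fun v _ hv => coord_eq_zero hv).symm

theorem sum_coord_smul {x : K.space} {t : Finset E} (ht : carrier x ⊆ t) :
    ∑ v ∈ t, coord x v • v = x.1 := by
  refine Eq.trans ?_ (isCoord x).comb
  exact (Finset.sum_subset ht fun v _ hv => by rw [coord_eq_zero hv, zero_smul]).symm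

theorem coord_le_one (x : K.space) (v : E) : coord x v ≤ 1 := by
  by_cases hv : v ∈ carrier x
  · rw [← sum_coord (x := x) subset_rfl]
    exact Finset.single_le_sum (fun v _ => coord_nonneg x v) hv
  · rw [coord_eq_zero hv]
    exact zero_le_one

theorem coord_injective {x y : K.space} (h : coord x = coord y) : x = y := by
  have hc : carrier x = carrier y := by
    ext v
    rw [mem_carrier, mem_carrier, h]
  refine Subtype.ext ?_
  rw [← sum_coord_smul (x := x) subset_rfl, ← sum_coord_smul (x := y) subset_rfl, h, hc]

theorem mem_convexHull_iff_carrier_subset {x : K.space} {t : Finset E} (ht : t ∈ K.faces) :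
    x.1 ∈ convexHull ℝ (t : Set E) ↔ carrier x ⊆ t :=
  ⟨(isCoord x).subset_of_mem ht, (isCoord x).mem_convexHull⟩

theorem coord_eq {x : K.space} {t : Finset E} (ht : t ∈ K.faces) {w : E → ℝ}
    (h0 : ∀ v ∈ t, 0 ≤ w v) (hz : ∀ v ∉ t, w v = 0) (hs : ∑ v ∈ t, w v = 1)
    (hc : ∑ v ∈ t, w v • v = x.1) : coord x = w := by
  classical
  exact ((isCoord x).unique (isCoord_filter ht h0 hz hs hc)).2

/-- A point is outside the star exactly when it lies in some closed face not containing `s`, and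
there are finitely many of those, all compact. -/
theorem isOpen_star (hK : K.faces.Finite) (s : Finset E) :
    IsOpen {x : K.space | s ⊆ carrier x} := by
  have : {x : K.space | s ⊆ carrier x}ᶜ =
      ⋃ t ∈ {t ∈ K.faces | ¬ s ⊆ t}, Subtype.val ⁻¹' convexHull ℝ (t : Set E) := by
    ext x
    simp only [Set.mem_compl_iff, Set.mem_ofPred_eq, Set.mem_iUnion, Set.mem_preimage, exists_prop]
    constructor
    · intro h
      exact ⟨carrier x, ⟨carrier_mem_faces x, h⟩, (isCoord x).mem_convexHull subset_rfl⟩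
    · rintro ⟨t, ⟨ht, hst⟩, hx⟩ h
      exact hst (h.trans ((mem_convexHull_iff_carrier_subset ht).1 hx))
  rw [← isClosed_compl_iff, this]
  refine (hK.subset fun t ht => ht.1).isClosed_biUnion fun t _ => ?_
  exact ((t.finite_toSet.isCompact_convexHull ℝ).isClosed).preimage continuous_subtype_val

section Segment

variable {x y : K.space} {r : Finset E}

theorem segment_mem_space (hr : r ∈ K.faces) (hx : carrier x ⊆ r) (hy : carrier y ⊆ r)
    (t : unitInterval) : (1 - t : ℝ) • x.1 + (t : ℝ) • y.1 ∈ K.space :=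
  Geometry.SimplicialComplex.convexHull_subset_space hr
    (convex_convexHull ℝ _ ((isCoord x).mem_convexHull hx) ((isCoord y).mem_convexHull hy)
      (sub_nonneg.2 t.2.2) t.2.1 (by ring))

/-- The segment between two points of a face. -/
def segmentMap (hr : r ∈ K.faces) (hx : carrier x ⊆ r) (hy : carrier y ⊆ r) :
    unitInterval → K.space :=
  fun t => ⟨(1 - t : ℝ) • x.1 + (t : ℝ) • y.1, segment_mem_space hr hx hy t⟩

theorem segmentMap_continuous (hr : r ∈ K.faces) (hx : carrier x ⊆ r) (hy : carrier y ⊆ r) :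
    Continuous (segmentMap hr hx hy) :=
  Continuous.subtype_mk (by fun_prop) _

theorem segmentMap_zero (hr : r ∈ K.faces) (hx : carrier x ⊆ r) (hy : carrier y ⊆ r) :
    segmentMap hr hx hy 0 = x := Subtype.ext (by simp [segmentMap])

theorem segmentMap_one (hr : r ∈ K.faces) (hx : carrier x ⊆ r) (hy : carrier y ⊆ r) :
    segmentMap hr hx hy 1 = y := Subtype.ext (by simp [segmentMap])

theorem coord_segmentMap (hr : r ∈ K.faces) (hx : carrier x ⊆ r) (hy : carrier y ⊆ r)
    (t : unitInterval) (v : E) :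
    coord (segmentMap hr hx hy t) v = (1 - t : ℝ) * coord x v + t * coord y v := by
  have h1 : 0 ≤ (1 - t : ℝ) := sub_nonneg.2 t.2.2
  have := coord_eq (x := segmentMap hr hx hy t) hr
    (w := fun v => (1 - t : ℝ) * coord x v + t * coord y v)
    (fun v _ => add_nonneg (mul_nonneg h1 (coord_nonneg x v))
      (mul_nonneg t.2.1 (coord_nonneg y v)))
    (fun v hv => by rw [coord_eq_zero (fun h => hv (hx h)), coord_eq_zero (fun h => hv (hy h))]; ring)
    (by rw [Finset.sum_add_distrib, ← Finset.mul_sum, ← Finset.mul_sum, sum_coord hx, sum_coord hy]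
        ring)
    (by simp only [add_smul, mul_smul, Finset.sum_add_distrib, ← Finset.smul_sum, sum_coord_smul hx,
          sum_coord_smul hy, segmentMap])
  rw [this]

open scoped Classical in
theorem carrier_segmentMap (hr : r ∈ K.faces) (hx : carrier x ⊆ r) (hy : carrier y ⊆ r)
    {t : unitInterval} (h0 : t ≠ 0) (h1 : t ≠ 1) :
    carrier (segmentMap hr hx hy t) = carrier x ∪ carrier y := by
  have h0' : 0 < (t : ℝ) := unitInterval.pos_iff_ne_zero.2 h0
  have h1' : 0 < (1 - t : ℝ) := sub_pos.2 (unitInterval.lt_one_iff_ne_one.2 h1)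
  ext v
  rw [Finset.mem_union, mem_carrier, coord_segmentMap]
  have hxv := coord_nonneg x v
  have hyv := coord_nonneg y v
  constructor
  · intro h
    by_contra! hv
    rw [coord_eq_zero hv.1, coord_eq_zero hv.2] at h
    simp at h
  · rintro (h | h) <;> rw [mem_carrier] at h <;> positivity

open scoped Classical in
-- All interior points of a segment in a face have the same carrier, the union of those of its ends.
-- Path-connectedness of sets defined by carriers is reduced to this.
theorem joinedIn_of_carrier {U : Set K.space} (hr : r ∈ K.faces) (hx : carrier x ⊆ r)
    (hy : carrier y ⊆ r) (hxU : x ∈ U) (hyU : y ∈ U)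
    (hU : ∀ z : K.space, carrier z = carrier x ∪ carrier y → z ∈ U) : JoinedIn U x y := by
  refine ⟨⟨⟨segmentMap hr hx hy, segmentMap_continuous hr hx hy⟩, segmentMap_zero hr hx hy,
    segmentMap_one hr hx hy⟩, fun t => ?_⟩
  change segmentMap hr hx hy t ∈ U
  by_cases h0 : t = 0
  · rwa [h0, segmentMap_zero]
  by_cases h1 : t = 1
  · rwa [h1, segmentMap_one]
  exact hU _ (carrier_segmentMap hr hx hy h0 h1)

end Segment

/-- A vertex as a point of the underlying space. -/
def vertexPoint {v : E} (hv : {v} ∈ K.faces) : K.space :=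
  ⟨v, Geometry.SimplicialComplex.vertices_subset_space hv⟩

theorem carrier_vertexPoint {v : E} (hv : {v} ∈ K.faces) : carrier (vertexPoint hv) = {v} := by
  have : carrier (vertexPoint hv) ⊆ {v} :=
    (mem_convexHull_iff_carrier_subset hv).1 (subset_convexHull ℝ _ (by simp [vertexPoint]))
  exact (Finset.subset_singleton_iff.1 this).resolve_left (carrier_nonempty _).ne_empty

open scoped Classical in
theorem coord_vertexPoint {v : E} (hv : {v} ∈ K.faces) :
    coord (vertexPoint hv) = fun w => if w = v then 1 else 0 :=
  coord_eq hv (fun w _ => by split_ifs <;> norm_num) (fun w hw => by simpa using hw) (by simp)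
    (by simp [vertexPoint])

open scoped Classical in
theorem exists_carrier_eq {s : Finset E} (hs : s ∈ K.faces) : ∃ x : K.space, carrier x = s := by
  have hne : (s.card : ℝ) ≠ 0 :=
    Nat.cast_ne_zero.2 (Finset.card_ne_zero.2 (K.nonempty_of_mem_faces hs))
  let w : E → ℝ := fun v => if v ∈ s then (s.card : ℝ)⁻¹ else 0
  have h0 : ∀ v ∈ s, 0 ≤ w v := fun v hv => by simp [w, hv]
  have h1 : ∑ v ∈ s, w v = 1 := by
    rw [Finset.sum_congr rfl (fun v hv => if_pos hv)]
    simp [hne]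
  have hx : ∑ v ∈ s, w v • v ∈ K.space :=
    Geometry.SimplicialComplex.convexHull_subset_space hs
      (Finset.mem_convexHull'.2 ⟨w, h0, h1, rfl⟩)
  have hc := coord_eq (x := ⟨_, hx⟩) hs h0 (fun v hv => if_neg hv) h1 rfl
  refine ⟨⟨_, hx⟩, Finset.ext fun v => ?_⟩
  rw [mem_carrier, hc]
  simp only [w]
  split_ifs with h
  · exact iff_of_true (by positivity) h
  · simp [h]

end Coordinates

/-! ### Minimal separating sets -/

section Topology

variable {S : Type*} [TopologicalSpace S] {M : Set S}

/-- In a minimal separating closed set, every point is a limit of both sides. -/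
theorem IsMinimalSeparatingSet.exists_open (hM : IsMinimalSeparatingSet M) (hc : IsClosed M) :
    ∃ u v : Set S, IsOpen u ∧ IsOpen v ∧ u ∪ v = Mᶜ ∧ Disjoint u v ∧
      ∀ O, IsOpen O → (O ∩ M).Nonempty → (O ∩ u).Nonempty ∧ (O ∩ v).Nonempty := by
  have key : ∀ u v : Set S, IsOpen u → IsOpen v → u ∪ v = Mᶜ → Disjoint u v → u.Nonempty →
      v.Nonempty → ∀ O, IsOpen O → (O ∩ M).Nonempty → (O ∩ v).Nonempty := by
    intro u v hu hv huv hd hun hvn O hO hOM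
    by_contra hOv
    have hOv' : Disjoint O v := Set.disjoint_iff_inter_eq_empty.2
      (Set.not_nonempty_iff_eq_empty.1 hOv)
    -- If `O` misses `v`, it can be added to the side `u`, and the smaller set `M \ O` still
    -- separates.
    refine hM.2 (M \ O) ⟨Set.sdiff_subset, fun h => ?_⟩ fun hpre => ?_
    · obtain ⟨x, hxO, hxM⟩ := hOM
      exact (h hxM).2 hxO
    · have hcompl : (M \ O)ᶜ = (u ∪ O) ∪ v := by
        rw [Set.sdiff_eq, Set.compl_inter, compl_compl, ← huv]
        ext x; simp only [Set.mem_union]; tauto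
      rw [hcompl] at hpre
      obtain ⟨x, -, hx1, hx2⟩ := hpre (u ∪ O) v (hu.union hO) hv subset_rfl
        (hun.mono fun x hx => ⟨Or.inl (Or.inl hx), Or.inl hx⟩)
        (hvn.mono fun x hx => ⟨Or.inr hx, hx⟩)
      rcases hx1 with hx1 | hx1
      · exact Set.disjoint_left.1 hd hx1 hx2
      · exact Set.disjoint_left.1 hOv' hx1 hx2
  have hs := hM.1
  simp only [Separates, IsPreconnected, not_forall] at hs
  obtain ⟨u, v, hu, hv, huv, hun, hvn, hne⟩ := hs
  have hd : Disjoint (Mᶜ ∩ u) (Mᶜ ∩ v) := by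
    rw [Set.disjoint_left]
    exact fun x hx hx' => hne ⟨x, hx.1, hx.2, hx'.2⟩
  have hU : Mᶜ ∩ u ∪ Mᶜ ∩ v = Mᶜ := by
    rw [← Set.inter_union_distrib_left, Set.inter_eq_left.2 huv]
  have h1 := hc.isOpen_compl.inter hu
  have h2 := hc.isOpen_compl.inter hv
  exact ⟨Mᶜ ∩ u, Mᶜ ∩ v, h1, h2, hU, hd, fun O hO hOM =>
    ⟨key _ _ h2 h1 (by rw [Set.union_comm, hU]) hd.symm hvn hun O hO hOM,
      key _ _ h1 h2 hU hd hun hvn O hO hOM⟩⟩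

/-- A set between a connected set and its closure is connected. So both sides stay connected when
the points of `M \ N` are added to them, and then they have a common point. -/
theorem isMinimalSeparatingSet_of_closure {u v : Set S} (hu : IsOpen u) (hv : IsOpen v)
    (huv : u ∪ v = Mᶜ) (hd : Disjoint u v) (hun : u.Nonempty) (hvn : v.Nonempty)
    (hup : IsPreconnected u) (hvp : IsPreconnected v) (hMu : M ⊆ closure u) (hMv : M ⊆ closure v) :
    IsMinimalSeparatingSet M := by
  refine ⟨fun h => ?_, fun N hN h => h ?_⟩
  · rw [← huv] at h
    obtain ⟨x, -, hx, hx'⟩ := h u v hu hv subset_rfl (hun.mono fun x hx => ⟨Or.inl hx, hx⟩)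
      (hvn.mono fun x hx => ⟨Or.inr hx, hx⟩)
    exact Set.disjoint_left.1 hd hx hx'
  · obtain ⟨x, hxM, hxN⟩ := Set.exists_of_ssubset hN
    have h1 : IsPreconnected (u ∪ (M \ N)) :=
      hup.subset_closure Set.subset_union_left
        (Set.union_subset subset_closure (Set.sdiff_subset.trans hMu))
    have h2 : IsPreconnected (v ∪ (M \ N)) :=
      hvp.subset_closure Set.subset_union_left
        (Set.union_subset subset_closure (Set.sdiff_subset.trans hMv))
    have h3 : Nᶜ = (u ∪ (M \ N)) ∪ (v ∪ (M \ N)) := by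
      rw [← Set.union_union_distrib_right, huv]
      ext y
      have : y ∈ N → y ∈ M := fun h => hN.1 h
      simp only [Set.mem_compl_iff, Set.mem_union, Set.mem_sdiff]
      tauto
    rw [h3]
    exact h1.union x (Or.inr ⟨hxM, hxN⟩) (Or.inr ⟨hxM, hxN⟩) h2

end Topology

end MinSep

namespace MinSep

/-! ### Stars, and invariance of the number of legs -/

section Star

variable {S : Type*} [TopologicalSpace S] {M : Set S} {x : S}

/-- The arcs `γ i` emanate from `x`, are disjoint apart from `x`, and cover `M` near `x`. -/
structure IsStar (M : Set S) (x : S) {ι : Type*} (γ : ι → unitInterval → S) : Prop where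
  continuous : ∀ i, Continuous (γ i)
  zero : ∀ i, γ i 0 = x
  ne : ∀ i t, t ≠ 0 → γ i t ≠ x
  eq : ∀ i j s t, s ≠ 0 → γ i s = γ j t → i = j
  mem : ∀ i t, γ i t ∈ M
  cover : ∃ O, IsOpen O ∧ x ∈ O ∧ ∀ y ∈ O ∩ M, y = x ∨ ∃ i t, γ i t = y

/-- The initial interval `(0, ε)`. -/
theorem isPreconnected_initial (ε : unitInterval) : IsPreconnected (Set.Ioo 0 ε) :=
  isPreconnected_Ioo

variable [T2Space S] {ι κ : Type*} [Finite κ] {γ : ι → unitInterval → S}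
  {δ : κ → unitInterval → S}

/-- Near `x`, the leg `γ i` is covered by the finitely many closed legs `δ j`, which are disjoint
away from `x`. The image of an initial open interval is connected and avoids `x`, hence lies in one
of them. -/
theorem IsStar.exists_leg (hγ : IsStar M x γ) (hδ : IsStar M x δ) (i : ι) :
    ∃ j, ∃ ε > (0 : unitInterval), ∀ t ∈ Set.Ioo 0 ε, γ i t ∈ Set.range (δ j) := by
  obtain ⟨O, hO, hxO, hcov⟩ := hδ.cover
  have hnhds : (γ i) ⁻¹' O ∈ nhds (0 : unitInterval) :=
    ((hγ.continuous i).continuousAt).preimage_mem_nhds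
      (by rw [hγ.zero]; exact hO.mem_nhds hxO)
  obtain ⟨ε, hε, hεO⟩ := exists_Ico_subset_of_mem_nhds hnhds ⟨1, zero_lt_one⟩
  have hmem : ∀ t ∈ Set.Ioo 0 ε, ∃ j, γ i t ∈ Set.range (δ j) := by
    intro t ht
    rcases hcov (γ i t) ⟨hεO ⟨ht.1.le, ht.2⟩, hγ.mem i t⟩ with h | ⟨j, s, hs⟩
    · exact absurd h (hγ.ne i t ht.1.ne')
    · exact ⟨j, s, hs⟩
  obtain ⟨t₀, ht₀⟩ := exists_between hε
  obtain ⟨j, hj⟩ := hmem t₀ ht₀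
  have hclosed : ∀ j, IsClosed (γ i ⁻¹' Set.range (δ j)) := fun j =>
    (isCompact_range (hδ.continuous j)).isClosed.preimage (hγ.continuous i)
  refine ⟨j, ε, hε, fun t ht => ?_⟩
  have := isPreconnected_closed_iff.1 (isPreconnected_initial ε)
    (γ i ⁻¹' Set.range (δ j)) (⋃ k ∈ {k | k ≠ j}, γ i ⁻¹' Set.range (δ k)) (hclosed j)
    ((Set.toFinite _).isClosed_biUnion fun k _ => hclosed k) (fun s hs => ?_) ⟨t₀, ht₀, hj⟩
  · by_contra hnot
    obtain ⟨k, hk⟩ := hmem t ht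
    have hkj : k ≠ j := by
      rintro rfl
      exact hnot hk
    obtain ⟨s, hs, ⟨a, ha⟩, hs2⟩ := this ⟨t, ht, Set.mem_biUnion (show k ∈ {k | k ≠ j} from hkj) hk⟩
    simp only [Set.mem_iUnion] at hs2
    obtain ⟨l, hl, b, hb⟩ := hs2
    refine hl (hδ.eq l j b a ?_ (hb.trans ha.symm))
    rintro rfl
    rw [hδ.zero] at hb
    exact hγ.ne i s hs.1.ne' hb.symm
  · obtain ⟨k, hk⟩ := hmem s hs
    by_cases hkj : k = j
    · exact Or.inl (hkj ▸ hk)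
    · exact Or.inr (Set.mem_biUnion (show k ∈ {k | k ≠ j} from hkj) hk)

/-- Each leg is sent to the leg of the other star that contains its germ at `x`; the same assignment
in the other direction is a left inverse. -/
theorem IsStar.card_le [Finite ι] (hγ : IsStar M x γ) (hδ : IsStar M x δ) :
    Nat.card ι ≤ Nat.card κ := by
  choose f ε hε hf using hγ.exists_leg hδ
  choose g η hη hg using hδ.exists_leg hγ
  refine Nat.card_le_card_of_injective f (Function.LeftInverse.injective (g := g) fun i => ?_)
  -- The far part of the leg `δ (f i)` is compact and misses `x`, so points of `γ i` close to `x`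
  -- lie on its initial part, which is covered by `γ (g (f i))`.
  have hcomp : IsClosed (δ (f i) '' Set.Ici (η (f i))) :=
    (isClosed_Ici.isCompact.image (hδ.continuous _)).isClosed
  have hnot : x ∉ δ (f i) '' Set.Ici (η (f i)) := by
    rintro ⟨t, ht, hx⟩
    exact hδ.ne _ t ((hη _).trans_le ht).ne' hx
  have hnhds : (γ i) ⁻¹' (δ (f i) '' Set.Ici (η (f i)))ᶜ ∈ nhds (0 : unitInterval) :=
    ((hγ.continuous i).continuousAt).preimage_mem_nhds
      (by rw [hγ.zero]; exact hcomp.isOpen_compl.mem_nhds hnot)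
  obtain ⟨θ, hθ, hθO⟩ := exists_Ico_subset_of_mem_nhds hnhds ⟨1, zero_lt_one⟩
  obtain ⟨t, ht0, ht⟩ := exists_between (lt_min hθ (hε i))
  obtain ⟨s, hs⟩ := hf i t ⟨ht0, ht.trans_le (min_le_right _ _)⟩
  have hs1 : s < η (f i) := by
    by_contra h
    exact hθO ⟨ht0.le, ht.trans_le (min_le_left _ _)⟩ ⟨s, not_lt.1 h, hs⟩
  have hs0 : 0 < s := by
    rw [unitInterval.pos_iff_ne_zero]
    rintro rfl
    rw [hδ.zero] at hs
    exact hγ.ne i t ht0.ne' hs.symm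
  obtain ⟨b, hb⟩ := hg (f i) s ⟨hs0, hs1⟩
  refine (hγ.eq i _ t b ht0.ne' ?_).symm
  rw [hb, hs]

theorem IsStar.card_eq [Finite ι] (hγ : IsStar M x γ) (hδ : IsStar M x δ) :
    Nat.card ι = Nat.card κ :=
  (hγ.card_le hδ).antisymm (hδ.card_le hγ)

end Star

/-! ### The star of an embedded graph at a vertex -/

section Embedding

variable {α β : Type*} {G : Graph α β} {S : Type*} [TopologicalSpace S]

/-- The ends of edges at `v`, where `true` stands for the end of the parameter interval. -/
def EndsAt (φ : GraphEmbedding G S) (v : α) : Set (β × Bool) :=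
  {d | d.1 ∈ G.edgeSet ∧ φ.arc d.1 (if d.2 then 1 else 0) = φ.vert v}

/-- The degree counts the ends of edges at `v`, where `P e false` and `P e true` say that the first
and the second end of `e` is at `v`. -/
theorem card_ends_eq_degree (hE : G.edgeSet.Finite) {v : α} {P : β → Bool → Prop}
    (key : ∀ e x y, G.IsLink e x y → ((P e false ↔ v = x) ∧ (P e true ↔ v = y)) ∨
      ((P e false ↔ v = y) ∧ (P e true ↔ v = x))) :
    Nat.card {d : β × Bool | d.1 ∈ G.edgeSet ∧ P d.1 d.2} = degree G v := by
  classical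
  have hA : {e | e ∈ G.edgeSet ∧ P e false}.Finite := hE.subset fun e h => h.1
  have hB : {e | e ∈ G.edgeSet ∧ P e true}.Finite := hE.subset fun e h => h.1
  set A := {e | e ∈ G.edgeSet ∧ P e false}
  set B := {e | e ∈ G.edgeSet ∧ P e true}
  have hloop : {e | G.IsLoopAt e v} = A ∩ B := by
    ext e
    constructor
    · intro (h : G.IsLink e v v)
      have := key e v v h
      exact ⟨⟨h.edge_mem, by tauto⟩, ⟨h.edge_mem, by tauto⟩⟩
    · rintro ⟨⟨he, h0⟩, -, h1⟩
      obtain ⟨x, y, h⟩ := G.exists_isLink_of_mem_edgeSet he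
      have := key e x y h
      obtain ⟨rfl, rfl⟩ : v = x ∧ v = y := by tauto
      exact h
  have hnon : {e | G.IsNonloopAt e v} = (A ∪ B) \ (A ∩ B) := by
    ext e
    rw [← hloop, Set.mem_sdiff]
    change G.IsNonloopAt e v ↔ e ∈ A ∪ B ∧ ¬ G.IsLoopAt e v
    rw [Graph.isNonloopAt_iff_inc_not_isLoopAt]
    refine and_congr_left fun _ => ⟨?_, ?_⟩
    · rintro ⟨y, h⟩
      rcases key e v y h with h' | h'
      · exact Or.inl ⟨h.edge_mem, h'.1.2 rfl⟩
      · exact Or.inr ⟨h.edge_mem, h'.2.2 rfl⟩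
    · rintro (⟨he, h0⟩ | ⟨he, h0⟩) <;> obtain ⟨x, y, h⟩ := G.exists_isLink_of_mem_edgeSet he <;>
        have := key e x y h
      · obtain rfl | rfl : v = x ∨ v = y := by tauto
        exacts [⟨_, h⟩, ⟨_, h.symm⟩]
      · obtain rfl | rfl : v = x ∨ v = y := by tauto
        exacts [⟨_, h⟩, ⟨_, h.symm⟩]
  have hends : {d : β × Bool | d.1 ∈ G.edgeSet ∧ P d.1 d.2} =
      (fun e => (e, false)) '' A ∪ (fun e => (e, true)) '' B := by
    ext ⟨e, b⟩
    cases b <;> simp [A, B]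
  have hinj : ∀ b : Bool, Function.Injective fun e : β => (e, b) := fun b e e' h =>
    congrArg Prod.fst h
  -- Loops are the intersection of `A` and `B` and non-loops their symmetric difference, so the
  -- degree is the sum of the two cardinalities.
  rw [degree, hloop, hnon, Nat.card_coe_set_eq, hends,
    Set.ncard_union_eq _ (hA.image _) (hB.image _), Set.ncard_image_of_injective _ (hinj _),
    Set.ncard_image_of_injective _ (hinj _)]
  · have h1 := Set.ncard_sdiff_add_ncard_of_subset
      (Set.inter_subset_left.trans Set.subset_union_left : A ∩ B ⊆ A ∪ B) (hA.union hB)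
    have h2 := Set.ncard_union_add_ncard_inter A B hA hB
    omega
  · rw [Set.disjoint_left]
    rintro _ ⟨e, -, rfl⟩ ⟨e', -, h⟩
    simp at h

theorem card_endsAt (φ : GraphEmbedding G S) (hE : G.edgeSet.Finite) {v : α}
    (hv : v ∈ G.vertexSet) : Nat.card (EndsAt φ v) = degree G v := by
  refine card_ends_eq_degree hE (P := fun e b => φ.arc e (if b then 1 else 0) = φ.vert v) ?_
  intro e x y h
  have hx := φ.vert_injOn.eq_iff h.left_mem hv
  have hy := φ.vert_injOn.eq_iff h.right_mem hv
  rcases φ.arc_ends e x y h with ⟨h0, h1⟩ | ⟨h0, h1⟩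
  · left; simp only [h0, h1, hx, hy, if_true, Bool.false_eq_true, if_false]
    exact ⟨eq_comm, eq_comm⟩
  · right; simp only [h0, h1, hx, hy, if_true, Bool.false_eq_true, if_false]
    exact ⟨eq_comm, eq_comm⟩

/-- The parameter of the point at a third of the way `t` from an end of an edge. -/
noncomputable def legParam (b : Bool) (t : unitInterval) : unitInterval :=
  if b then unitInterval.symm ⟨t / 3, by have := t.2.1; have := t.2.2; constructor <;> linarith⟩
  else ⟨t / 3, by have := t.2.1; have := t.2.2; constructor <;> linarith⟩

theorem legParam_true (t : unitInterval) : (legParam true t : ℝ) = 1 - t / 3 := by simp [legParam]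

theorem legParam_false (t : unitInterval) : (legParam false t : ℝ) = t / 3 := by simp [legParam]

theorem legParam_zero (b : Bool) : legParam b 0 = if b then 1 else 0 := by
  cases b <;> apply Subtype.ext
  · rw [legParam_false]; simp
  · rw [legParam_true]; simp

theorem legParam_continuous (b : Bool) : Continuous (legParam b) := by
  cases b
  · exact Continuous.subtype_mk (f := fun t : unitInterval => (t : ℝ) / 3) (by fun_prop) _
  · exact unitInterval.continuous_symm.comp
      (Continuous.subtype_mk (f := fun t : unitInterval => (t : ℝ) / 3) (by fun_prop) _)

theorem legParam_mem (b : Bool) {t : unitInterval} (ht : t ≠ 0) :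
    legParam b t ∈ Set.Ioo (0 : unitInterval) 1 := by
  have h0 : 0 < (t : ℝ) := unitInterval.pos_iff_ne_zero.2 ht
  have h1 := t.2.2
  cases b
  · constructor <;> rw [← Subtype.coe_lt_coe, legParam_false] <;> push_cast <;> linarith
  · constructor <;> rw [← Subtype.coe_lt_coe, legParam_true] <;> push_cast <;> linarith

theorem isStar_endsAt [T2Space S] (φ : GraphEmbedding G S) (hV : G.vertexSet.Finite)
    (hE : G.edgeSet.Finite) {v : α} (hv : v ∈ G.vertexSet) :
    IsStar φ.image (φ.vert v) fun (d : EndsAt φ v) t => φ.arc d.1.1 (legParam d.1.2 t) where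
  continuous d := (φ.arc_continuous _ d.2.1).comp (legParam_continuous _)
  zero d := by rw [legParam_zero]; exact d.2.2
  ne d t ht := (φ.vert_ne_arc _ d.2.1 v hv _ (legParam_mem _ ht)).symm
  eq := by
    rintro ⟨⟨e, b⟩, he⟩ ⟨⟨f, c⟩, hf⟩ s t hs h
    have hef : e = f := by
      by_contra hef
      exact φ.arc_ne_arc e he.1 f hf.1 hef _ (legParam_mem b hs) _ h
    subst hef
    have hm := legParam_mem b hs
    rcases φ.arc_simple e he.1 _ _ h with h' | h' | h'
    · have h2 := congrArg Subtype.val h'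
      have hs1 := s.2.1
      have hs2 := s.2.2
      have ht1 := t.2.1
      have ht2 := t.2.2
      -- The two legs on one edge end at parameters 1/3 and 2/3 and so cannot meet; half-edges
      -- would.
      cases b <;> cases c <;> first | rfl | exfalso <;>
        simp only [legParam_true, legParam_false] at h2 <;> linarith
    · exact absurd h'.1 hm.1.ne'
    · exact absurd h'.1 hm.2.ne
  mem d t := Or.inr (Set.mem_biUnion d.2.1 ⟨_, rfl⟩)
  cover := by
    let T : Set (β × Bool) := {d | d.1 ∈ G.edgeSet ∧ d ∉ EndsAt φ v}
    have hT : T.Finite := (hE.prod (Set.finite_univ (α := Bool))).subset fun d hd =>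
      ⟨hd.1, Set.mem_univ _⟩
    let mid : Set unitInterval := {t | 1 / 3 ≤ (t : ℝ) ∧ (t : ℝ) ≤ 2 / 3}
    have hmid : IsCompact mid := by
      have : IsClosed mid := by
        apply IsClosed.and <;> exact isClosed_le (by fun_prop) (by fun_prop)
      exact this.isCompact
    -- `Z` is closed, misses the point of `v`, and contains all other points of the image that are
    -- not on the legs at `v`: the other vertices, the middle thirds, and the outer thirds at ends
    -- elsewhere.
    let Z : Set S := φ.vert '' (G.vertexSet \ {v}) ∪ (⋃ e ∈ G.edgeSet, φ.arc e '' mid) ∪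
      ⋃ d ∈ T, Set.range fun t => φ.arc d.1 (legParam d.2 t)
    have hZ : IsClosed Z := by
      refine ((hV.subset Set.sdiff_subset).image _).isClosed.union ?_ |>.union ?_
      · exact hE.isClosed_biUnion fun e he => (hmid.image (φ.arc_continuous e he)).isClosed
      · exact hT.isClosed_biUnion fun d hd => (isCompact_range
          ((φ.arc_continuous _ hd.1).comp (legParam_continuous _))).isClosed
    refine ⟨Zᶜ, hZ.isOpen_compl, ?_, ?_⟩
    · rintro ((⟨w, hw, h⟩ | h) | h)
      · exact hw.2 (φ.vert_injOn hw.1 hv h)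
      · simp only [Set.mem_iUnion] at h
        obtain ⟨e, he, t, ht, h⟩ := h
        refine φ.vert_ne_arc e he v hv t ⟨?_, ?_⟩ h.symm
        · rw [← Subtype.coe_lt_coe]; push_cast; linarith [ht.1]
        · rw [← Subtype.coe_lt_coe]; push_cast; linarith [ht.2]
      · simp only [Set.mem_iUnion] at h
        obtain ⟨d, hd, t, h⟩ := h
        by_cases ht : t = 0
        · refine hd.2 ⟨hd.1, ?_⟩
          simpa only [ht, legParam_zero] using h
        · exact φ.vert_ne_arc _ hd.1 v hv _ (legParam_mem d.2 ht) h.symm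
    · rintro y ⟨hyZ, ⟨w, hw, rfl⟩ | hy⟩
      · left
        by_contra hne
        exact hyZ (Or.inl (Or.inl ⟨w, ⟨hw, fun h => hne (h ▸ rfl)⟩, rfl⟩))
      · right
        simp only [Set.mem_iUnion] at hy
        obtain ⟨e, he, t, rfl⟩ := hy
        have hleg : ∃ b s, legParam b s = t := by
          by_contra! hno
          refine hyZ (Or.inl (Or.inr (Set.mem_biUnion he ⟨t, ⟨?_, ?_⟩, rfl⟩)))
          · by_contra! ht
            refine hno false ⟨3 * t, by linarith [t.2.1], by linarith⟩ (Subtype.ext ?_)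
            rw [legParam_false]; ring
          · by_contra! ht
            refine hno true ⟨3 * (1 - t), by linarith [t.2.2], by linarith⟩ (Subtype.ext ?_)
            rw [legParam_true]; ring
        obtain ⟨b, s, rfl⟩ := hleg
        have hend : (e, b) ∈ EndsAt φ v := by
          by_contra h
          exact hyZ (Or.inr (Set.mem_biUnion (show (e, b) ∈ T from ⟨he, h⟩) ⟨s, rfl⟩))
        exact ⟨⟨_, hend⟩, s, rfl⟩

end Embedding

end MinSep

namespace MinSep

/-! ### The two sides of a one-dimensional subcomplex -/

section Subcomplex

variable {E : Type*} [NormedAddCommGroup E] [NormedSpace ℝ E]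
  {K : Geometry.SimplicialComplex ℝ E} {M : Set K.space} {L : Set (Finset E)}

/-- `L` is a subcomplex of `K` of dimension at most one with underlying set `M`. -/
structure IsFacesOf (L : Set (Finset E)) (M : Set K.space) : Prop where
  subset : L ⊆ K.faces
  card_le_two : ∀ s ∈ L, s.card ≤ 2
  down : ∀ s ∈ L, ∀ t ⊆ s, t.Nonempty → t ∈ L
  mem_iff : ∀ x, x ∈ M ↔ carrier x ∈ L

/-- After closing under nonempty subsets, which keeps the union, membership in `M` depends only on
the carrier. -/
theorem IsOneSubcomplex.exists_isFacesOf (h : IsOneSubcomplex K M) :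
    ∃ L : Set (Finset E), IsFacesOf L M := by
  obtain ⟨L, hLK, hL2, hM⟩ := h
  refine ⟨{s | s.Nonempty ∧ ∃ t ∈ L, s ⊆ t}, ?_, ?_, ?_, ?_⟩
  · rintro s ⟨hs, t, ht, hst⟩
    exact K.down_closed (hLK ht) hst hs
  · rintro s ⟨hs, t, ht, hst⟩
    exact (Finset.card_le_card hst).trans (hL2 t ht)
  · rintro s ⟨hs, t, ht, hst⟩ r hr hne
    exact ⟨hne, t, ht, hr.trans hst⟩
  · intro x
    have : x ∈ M ↔ x.1 ∈ Subtype.val '' M := by simp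
    rw [this, hM]
    simp only [Set.mem_iUnion, exists_prop]
    constructor
    · rintro ⟨t, ht, hx⟩
      exact ⟨carrier_nonempty x, t, ht, (mem_convexHull_iff_carrier_subset (hLK ht)).1 hx⟩
    · rintro ⟨-, t, ht, hx⟩
      exact ⟨t, ht, (mem_convexHull_iff_carrier_subset (hLK ht)).2 hx⟩

theorem IsFacesOf.isClosed (h : IsFacesOf L M) (hK : K.faces.Finite) : IsClosed M := by
  have : Mᶜ = ⋃ s ∈ {s ∈ K.faces | s ∉ L}, {x : K.space | s ⊆ carrier x} := by
    ext x
    simp only [Set.mem_compl_iff, Set.mem_iUnion, exists_prop, h.mem_iff]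
    constructor
    · exact fun hx => ⟨carrier x, ⟨carrier_mem_faces x, hx⟩, (subset_rfl : carrier x ⊆ carrier x)⟩
    · rintro ⟨s, ⟨hs, hsL⟩, hsx⟩ hx
      exact hsL (h.down _ hx s hsx (K.nonempty_of_mem_faces hs))
  rw [← isOpen_compl_iff, this]
  exact isOpen_biUnion fun s _ => isOpen_star hK s

/-- The open star of a face. -/
def openStar (K : Geometry.SimplicialComplex ℝ E) (s : Finset E) : Set K.space :=
  {x | s ⊆ carrier x}

theorem openStar_mono {s t : Finset E} (h : s ⊆ t) : openStar K t ⊆ openStar K s :=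
  fun _ hx => h.trans hx

theorem openStar_nonempty {s : Finset E} (hs : s ∈ K.faces) : (openStar K s).Nonempty := by
  obtain ⟨x, hx⟩ := exists_carrier_eq hs
  exact ⟨x, hx.ge⟩

open scoped Classical in
-- The open star is star-shaped about a point with carrier `s`.
theorem isPreconnected_openStar {s : Finset E} (hs : s ∈ K.faces) :
    IsPreconnected (openStar K s) := by
  obtain ⟨x, hx⟩ := exists_carrier_eq hs
  have hx' : x ∈ openStar K s := hx.ge
  have : IsPathConnected (openStar K s) := by
    refine ⟨x, hx', fun {y} (hy : s ⊆ carrier y) => ?_⟩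
    refine joinedIn_of_carrier (carrier_mem_faces y) (hx.trans_subset hy) subset_rfl hx' hy ?_
    intro z hz
    change s ⊆ carrier z
    rw [hz]
    exact hy.trans Finset.subset_union_right
  exact this.isConnected.isPreconnected

/-- `u` and `v` are the two sides of `M`. -/
structure IsSides (M u v : Set K.space) : Prop where
  union : u ∪ v = Mᶜ
  disjoint : Disjoint u v
  isOpen_left : IsOpen u
  isOpen_right : IsOpen v
  meets : ∀ O, IsOpen O → (O ∩ M).Nonempty → (O ∩ u).Nonempty ∧ (O ∩ v).Nonempty

variable {u v : Set K.space}

theorem IsSides.symm (h : IsSides M u v) : IsSides M v u where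
  union := by rw [Set.union_comm, h.union]
  disjoint := h.disjoint.symm
  isOpen_left := h.isOpen_right
  isOpen_right := h.isOpen_left
  meets O hO hOM := (h.meets O hO hOM).symm

/-- As `L` is closed under faces, the open star of a face outside `L` misses `M`; being connected,
it cannot meet both sides. -/
theorem IsSides.openStar_subset (h : IsSides M u v) (hL : IsFacesOf L M) {s : Finset E}
    (hs : s ∈ K.faces) (hsL : s ∉ L) : openStar K s ⊆ u ∨ openStar K s ⊆ v := by
  refine (isPreconnected_openStar hs).subset_or_subset h.isOpen_left h.isOpen_right h.disjoint ?_
  rw [h.union]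
  intro x hx hxM
  exact hsL (hL.down _ ((hL.mem_iff x).1 hxM) s hx (K.nonempty_of_mem_faces hs))

theorem IsSides.not_subset_right (h : IsSides M u v) {s : Finset E} (hs : s ∈ K.faces)
    (hu : openStar K s ⊆ u) : ¬ openStar K s ⊆ v := by
  intro hv
  obtain ⟨x, hx⟩ := openStar_nonempty hs
  exact Set.disjoint_left.1 h.disjoint (hu hx) (hv hx)

theorem IsSides.openStar_subset_of_le (h : IsSides M u v) (hL : IsFacesOf L M) {s t : Finset E}
    (hs : s ∈ K.faces) (hsL : s ∉ L) (ht : t ∈ K.faces) (hst : s ⊆ t) :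
    openStar K t ⊆ u ↔ openStar K s ⊆ u := by
  refine ⟨fun h' => ?_, (openStar_mono hst).trans⟩
  refine (h.openStar_subset hL hs hsL).resolve_right fun hv => ?_
  exact h.not_subset_right ht h' ((openStar_mono hst).trans hv)

/-- The open star of `s` is open and meets `M`, so it contains a point of `u`. The carrier of that
point is the required face. -/
theorem IsSides.exists_superset (h : IsSides M u v) (hL : IsFacesOf L M) (hK : K.faces.Finite)
    {s : Finset E} (hs : s ∈ L) : ∃ t ∈ K.faces, t ∉ L ∧ s ⊆ t ∧ openStar K t ⊆ u := by
  obtain ⟨x, hx⟩ := exists_carrier_eq (hL.subset hs)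
  obtain ⟨y, hy, hyu⟩ := (h.meets (openStar K s) (isOpen_star hK s)
    ⟨x, hx.ge, (hL.mem_iff x).2 (hx.symm ▸ hs)⟩).1
  have hyM : y ∉ M := by
    have : y ∈ Mᶜ := h.union ▸ Or.inl hyu
    exact this
  have hyL : carrier y ∉ L := fun hc => hyM ((hL.mem_iff y).2 hc)
  refine ⟨carrier y, carrier_mem_faces y, hyL, hy, ?_⟩
  refine (h.openStar_subset hL (carrier_mem_faces y) hyL).resolve_right fun hv => ?_
  exact Set.disjoint_left.1 h.disjoint hyu (hv (subset_rfl : carrier y ⊆ carrier y))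

end Subcomplex

/-! ### Parity of the number of edges of `M` at a vertex -/

section Link

variable {E : Type*} [NormedAddCommGroup E] [NormedSpace ℝ E]
  {K : Geometry.SimplicialComplex ℝ E} {M u v : Set K.space} {L : Set (Finset E)} {p : E}

open scoped Classical in
theorem finite_link (hK : K.faces.Finite) (p : E) :
    Finite {w : E // w ≠ p ∧ ({p, w} : Finset E) ∈ K.faces} := by
  have : (⋃ s ∈ K.faces, (s : Set E)).Finite := hK.biUnion fun s _ => s.finite_toSet
  refine (this.subset fun w hw => ?_).to_subtype
  exact Set.mem_biUnion hw.2 (by simp)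

open scoped Classical in
/-- The part of the link of `p` on one side of `M`. -/
def sideGraph (K : Geometry.SimplicialComplex ℝ E) (u : Set K.space) (p : E) :
    SimpleGraph {w : E // w ≠ p ∧ ({p, w} : Finset E) ∈ K.faces} where
  Adj a b := (linkGraph K p).Adj a b ∧ openStar K {p, a.1, b.1} ⊆ u
  symm := ⟨fun a b h => ⟨h.1.symm, by rw [Finset.pair_comm]; exact h.2⟩⟩
  loopless := ⟨fun _ h => h.1.ne rfl⟩

open scoped Classical in
-- Two triangles contain the edge `{p, w}`. If it is not in `L`, they are on the same side and the
-- degree is 0 or 2. If it is in `L`, both sides come up to it, so each contains exactly one of the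
-- triangles.
theorem odd_ncard_sideGraph (hK : IsClosedSurface K) (hL : IsFacesOf L M) (h : IsSides M u v)
    (hp : p ∈ K.vertices) (w : {w : E // w ≠ p ∧ ({p, w} : Finset E) ∈ K.faces}) :
    Odd ((sideGraph K u p).neighborSet w).ncard ↔ ({p, w.1} : Finset E) ∈ L := by
  have htwo := hK.link_two_regular p hp w
  constructor
  · intro hodd
    by_contra hw
    have hsub : ∀ a, (linkGraph K p).Adj w a → ({p, w.1} : Finset E) ⊆ {p, w.1, a.1} :=
      fun a _ => by intro z; simp only [Finset.mem_insert, Finset.mem_singleton]; tauto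
    rcases h.openStar_subset hL w.2.2 hw with hu | hv
    · have : (sideGraph K u p).neighborSet w = (linkGraph K p).neighborSet w := by
        ext a
        exact ⟨fun ha => ha.1, fun ha => ⟨ha, (openStar_mono (hsub a ha)).trans hu⟩⟩
      rw [this, htwo] at hodd
      exact absurd hodd (by decide)
    · have : (sideGraph K u p).neighborSet w = ∅ := by
        ext a
        refine ⟨fun ha => ?_, fun ha => ha.elim⟩
        exact h.not_subset_right ha.1.2 ha.2 ((openStar_mono (hsub a ha.1)).trans hv)
      rw [this, Set.ncard_empty] at hodd
      exact absurd hodd (by decide)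
  · intro hw
    have key : ∀ {u v : Set K.space}, IsSides M u v →
        ∃ a, (linkGraph K p).Adj w a ∧ openStar K {p, w.1, a.1} ⊆ u := by
      intro u v h
      obtain ⟨t, ht, htL, hst, htu⟩ := h.exists_superset hL hK.finite hw
      obtain ⟨a, hat, ha⟩ := Finset.exists_of_ssubset
        (hst.ssubset_of_ne fun h => htL (h ▸ hw))
      simp only [Finset.mem_insert, Finset.mem_singleton, not_or] at ha
      have hcard : ({p, w.1, a} : Finset E).card = 3 :=
        Finset.card_eq_three.2 ⟨p, w.1, a, w.2.1.symm, Ne.symm ha.1, Ne.symm ha.2, rfl⟩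
      have hsub : ({p, w.1, a} : Finset E) ⊆ t := by
        intro z hz
        simp only [Finset.mem_insert, Finset.mem_singleton] at hz
        rcases hz with rfl | rfl | rfl
        · exact hst (by simp)
        · exact hst (by simp)
        · exact hat
      have hteq : ({p, w.1, a} : Finset E) = t :=
        Finset.eq_of_subset_of_card_le hsub (hcard ▸ hK.card_le_three t ht)
      have hpa : ({p, a} : Finset E) ∈ K.faces :=
        K.down_closed ht (by
          rw [← hteq]; intro z; simp only [Finset.mem_insert, Finset.mem_singleton]; tauto)
          (by simp)
      exact ⟨⟨a, ha.1, hpa⟩, ⟨fun h' => ha.2 (congrArg Subtype.val h').symm, hteq.symm ▸ ht⟩,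
        hteq.symm ▸ htu⟩
    obtain ⟨a, ha, hau⟩ := key h
    obtain ⟨b, hb, hbv⟩ := key h.symm
    have hab : a ≠ b := by
      rintro rfl
      exact h.not_subset_right ha.2 hau hbv
    have hfin : ((linkGraph K p).neighborSet w).Finite := Set.finite_of_ncard_ne_zero (by omega)
    have hpair : ({a, b} : Set _) = (linkGraph K p).neighborSet w :=
      Set.eq_of_subset_of_ncard_le (by rintro _ (rfl | rfl); exacts [ha, hb])
        (by rw [htwo, Set.ncard_pair hab]) hfin
    have : (sideGraph K u p).neighborSet w = {a} := by
      ext c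
      constructor
      · intro hc
        have : c ∈ ({a, b} : Set _) := hpair ▸ hc.1
        rcases this with rfl | rfl
        · rfl
        · exact (h.not_subset_right hc.1.2 hc.2 hbv).elim
      · rintro rfl
        exact ⟨ha, hau⟩
    rw [this, Set.ncard_singleton]
    exact odd_one

open scoped Classical in
-- Handshaking lemma for `sideGraph`, whose vertices of odd degree correspond to the edges of `L` at
-- `p`.
theorem even_card_edges (hK : IsClosedSurface K) (hL : IsFacesOf L M) (h : IsSides M u v)
    (hp : p ∈ K.vertices) : Even (Nat.card {w : E | w ≠ p ∧ ({p, w} : Finset E) ∈ L}) := by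
  have := finite_link hK.finite p
  have := Fintype.ofFinite {w : E // w ≠ p ∧ ({p, w} : Finset E) ∈ K.faces}
  have heven := (sideGraph K u p).even_card_odd_degree_vertices
  have hd : ∀ w, Odd ((sideGraph K u p).degree w) ↔ ({p, w.1} : Finset E) ∈ L := by
    intro w
    rw [← odd_ncard_sideGraph hK hL h hp w, ← SimpleGraph.card_neighborSet_eq_degree,
      ← Nat.card_eq_fintype_card, Nat.card_coe_set_eq]
  simp only [hd] at heven
  rw [← Fintype.card_subtype, ← Nat.card_eq_fintype_card] at heven
  convert heven using 1
  exact Nat.card_congr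
    { toFun := fun w => ⟨⟨w.1, w.2.1, hL.subset w.2.2⟩, w.2.2⟩
      invFun := fun w => ⟨w.1.1, w.1.2.1, w.2⟩
      left_inv := fun _ => rfl
      right_inv := fun _ => rfl }

open scoped Classical in
-- Without such an edge, edges at `p` that span a triangle are on the same side, and connectedness
-- of the link puts all of them on one side. But both sides occur near `p`.
theorem exists_edge (hK : IsClosedSurface K) (hL : IsFacesOf L M) (h : IsSides M u v)
    (hp : {p} ∈ L) : ∃ w, w ≠ p ∧ ({p, w} : Finset E) ∈ L := by
  by_contra! hno
  have hno' : ∀ w : {w : E // w ≠ p ∧ ({p, w} : Finset E) ∈ K.faces},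
      ({p, w.1} : Finset E) ∉ L := fun w => hno w.1 w.2.1
  have key : ∀ {u v : Set K.space}, IsSides M u v →
      ∃ w : {w : E // w ≠ p ∧ ({p, w} : Finset E) ∈ K.faces}, openStar K {p, w.1} ⊆ u := by
    intro u v h
    obtain ⟨t, ht, htL, hst, htu⟩ := h.exists_superset hL hK.finite hp
    obtain ⟨w, hwt, hw⟩ := Finset.exists_of_ssubset (hst.ssubset_of_ne fun h => htL (h ▸ hp))
    rw [Finset.mem_singleton] at hw
    have hsub : ({p, w} : Finset E) ⊆ t := by
      intro z hz
      simp only [Finset.mem_insert, Finset.mem_singleton] at hz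
      rcases hz with rfl | rfl
      · exact hst (by simp)
      · exact hwt
    have hf : ({p, w} : Finset E) ∈ K.faces := K.down_closed ht hsub (by simp)
    exact ⟨⟨w, hw, hf⟩, (h.openStar_subset_of_le hL hf (hno w hw) ht hsub).1 htu⟩
  obtain ⟨a, ha⟩ := key h
  obtain ⟨b, hb⟩ := key h.symm
  have hstep : ∀ w w', (linkGraph K p).Adj w w' → openStar K {p, w.1} ⊆ u →
      openStar K {p, w'.1} ⊆ u := by
    intro w w' hadj hu
    rw [← h.openStar_subset_of_le hL w'.2.2 (hno' w') hadj.2 (by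
      intro z; simp only [Finset.mem_insert, Finset.mem_singleton]; tauto)]
    refine (openStar_mono ?_).trans hu
    intro z; simp only [Finset.mem_insert, Finset.mem_singleton]; tauto
  obtain ⟨q⟩ := (hK.link_connected p (hL.subset hp)).preconnected a b
  have : openStar K {p, b.1} ⊆ u := by
    clear hb
    induction q with
    | nil => exact ha
    | cons hadj _ ih => exact ih (hstep _ _ hadj ha)
  exact h.not_subset_right b.2.2 this hb

end Link

/-! ### The star of a subcomplex at a point -/

section Legs

variable {E : Type*} [NormedAddCommGroup E] [NormedSpace ℝ E]
  {K : Geometry.SimplicialComplex ℝ E} {M : Set K.space} {L : Set (Finset E)}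

open scoped Classical in
-- The legs are segments from `x` to the vertices `q ∈ Q`. The coordinate at `q` exceeds its value
-- at `x` only along the leg towards `q`, which keeps the legs apart.
theorem IsFacesOf.exists_isStar (hL : IsFacesOf L M) (hK : K.faces.Finite) {x : K.space}
    {Q : Set E} (hQ : ∀ q ∈ Q, insert q (carrier x) ∈ L)
    (hQ1 : ∀ q ∈ Q, coord x q < 1)
    (hcov : ∀ y ∈ M, carrier x ⊆ carrier y → y = x ∨ ∃ q ∈ Q, ∃ t : unitInterval,
      ∀ w, coord y w = (1 - t : ℝ) * coord x w + t * if w = q then 1 else 0) :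
    ∃ γ : Q → unitInterval → K.space, IsStar M x γ := by
  have hface : ∀ q : Q, insert q.1 (carrier x) ∈ K.faces := fun q => hL.subset (hQ q q.2)
  have hv : ∀ q : Q, {q.1} ∈ K.faces := fun q =>
    K.down_closed (hface q) (by simp) (by simp)
  have hvc : ∀ q : Q, carrier (vertexPoint (hv q)) ⊆ insert q.1 (carrier x) := fun q => by
    rw [carrier_vertexPoint]; simp
  let γ : Q → unitInterval → K.space := fun q =>
    segmentMap (hface q) (Finset.subset_insert _ _) (hvc q)
  have hγ : ∀ q t w, coord (γ q t) w =
      (1 - t : ℝ) * coord x w + t * if w = q.1 then 1 else 0 := by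
    intro q t w
    rw [coord_segmentMap, coord_vertexPoint]
  have hgt : ∀ q : Q, ∀ t : unitInterval, t ≠ 0 → coord x q < coord (γ q t) q := by
    intro q t ht
    have h0 : 0 < (t : ℝ) := unitInterval.pos_iff_ne_zero.2 ht
    rw [hγ, if_pos rfl]
    nlinarith [hQ1 q q.2]
  refine ⟨γ, fun q => segmentMap_continuous _ _ _, fun q => segmentMap_zero _ _ _, ?_, ?_, ?_, ?_⟩
  · intro q t ht h
    have := hgt q t ht
    rw [h] at this
    exact lt_irrefl _ this
  · intro q r s t hs h
    by_contra hqr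
    have h1 := hgt q s hs
    have hne : q.1 ≠ r.1 := fun h' => hqr (Subtype.ext h')
    rw [h, hγ, if_neg hne] at h1
    nlinarith [coord_nonneg x q, t.2.1]
  · intro q t
    rw [hL.mem_iff]
    refine hL.down _ (hQ q q.2) _ ?_ (carrier_nonempty _)
    intro w hw
    by_contra hwn
    rw [Finset.mem_insert, not_or] at hwn
    rw [mem_carrier, hγ, coord_eq_zero hwn.2, if_neg hwn.1] at hw
    simp at hw
  · refine ⟨openStar K (carrier x), isOpen_star hK _, (subset_rfl : carrier x ⊆ carrier x), ?_⟩
    rintro y ⟨hy, hyM⟩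
    rcases hcov y hyM hy with h | ⟨q, hq, t, ht⟩
    · exact Or.inl h
    · refine Or.inr ⟨⟨q, hq⟩, t, coord_injective (funext fun w => ?_)⟩
      rw [hγ, ht]

open scoped Classical in
-- At a vertex of `K` the legs are the edges of `M` there; inside an edge of `M` there are two legs.
-- The second case matters because the image of a graph vertex need not be a vertex of `K`.
theorem exists_isStar_even (hK : IsClosedSurface K) (hL : IsFacesOf L M) {u v : Set K.space}
    (h : IsSides M u v) {x : K.space} (hx : x ∈ M) :
    ∃ (Q : Set E) (γ : Q → unitInterval → K.space), IsStar M x γ ∧ Finite Q ∧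
      Even (Nat.card Q) ∧ 0 < Nat.card Q := by
  have hxL := (hL.mem_iff x).1 hx
  have hcard := hL.card_le_two _ hxL
  have hpos := (carrier_nonempty x).card_pos
  obtain hc | hc : (carrier x).card = 1 ∨ (carrier x).card = 2 := by omega
  · obtain ⟨p, hp⟩ := Finset.card_eq_one.1 hc
    have hpv : {p} ∈ K.faces := hp ▸ carrier_mem_faces x
    have hcx : coord x p = 1 := by
      have := sum_coord (x := x) subset_rfl
      rwa [hp, Finset.sum_singleton] at this
    obtain ⟨γ, hγ⟩ := hL.exists_isStar (x := x) hK.finite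
      (Q := {w : E | w ≠ p ∧ ({p, w} : Finset E) ∈ L})
      (fun q hq => by rw [hp, Finset.pair_comm]; exact hq.2)
      (fun q hq => by
        rw [coord_eq_zero (by rw [hp]; simpa using hq.1)]; exact zero_lt_one)
      (fun y hy hxy => by
        have hyL := (hL.mem_iff y).1 hy
        by_cases hyx : carrier y = {p}
        · left
          have hcy : coord y p = 1 := by
            have := sum_coord (x := y) subset_rfl
            rwa [hyx, Finset.sum_singleton] at this
          refine coord_injective (funext fun w => ?_)
          by_cases hw : w = p
          · rw [hw, hcx, hcy]
          · rw [coord_eq_zero (by rw [hyx]; simpa using hw),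
              coord_eq_zero (by rw [hp]; simpa using hw)]
        · right
          rw [hp] at hxy
          obtain ⟨w, hwy, hwp⟩ := Finset.exists_of_ssubset (hxy.ssubset_of_ne (Ne.symm hyx))
          rw [Finset.mem_singleton] at hwp
          have hsub : ({p, w} : Finset E) ⊆ carrier y := by
            intro z hz
            simp only [Finset.mem_insert, Finset.mem_singleton] at hz
            rcases hz with rfl | rfl
            · exact hxy (by simp)
            · exact hwy
          have heq : ({p, w} : Finset E) = carrier y := Finset.eq_of_subset_of_card_le hsub (by
            rw [Finset.card_pair (Ne.symm hwp)]; exact hL.card_le_two _ hyL)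
          have hsum := sum_coord (x := y) subset_rfl
          rw [← heq, Finset.sum_pair (Ne.symm hwp)] at hsum
          refine ⟨w, ⟨hwp, heq ▸ hyL⟩, ⟨coord y w, coord_nonneg _ _, coord_le_one _ _⟩, ?_⟩
          intro z
          change coord y z = (1 - coord y w) * coord x z + coord y w * _
          by_cases hz : z = p
          · subst hz
            rw [hcx, if_neg (Ne.symm hwp)]; linarith
          · rw [coord_eq_zero (x := x) (by rw [hp]; simpa using hz)]
            split_ifs with hzw
            · rw [hzw]; ring
            · rw [coord_eq_zero (by rw [← heq]; simp [hz, hzw])]; ring)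
    refine ⟨_, γ, hγ, ?_, even_card_edges hK hL h hpv, ?_⟩
    · refine (hK.finite.biUnion fun s _ => s.finite_toSet).subset (s := ⋃ s ∈ K.faces, (s : Set E))
        (fun w hw => Set.mem_biUnion (hL.subset hw.2) (by simp)) |>.to_subtype
    · obtain ⟨w, hw⟩ := exists_edge hK hL h (hp ▸ hxL)
      have hf : Finite {w : E | w ≠ p ∧ ({p, w} : Finset E) ∈ L} := by
        refine (hK.finite.biUnion fun s _ => s.finite_toSet).subset
          (s := ⋃ s ∈ K.faces, (s : Set E))
          (fun w hw => Set.mem_biUnion (hL.subset hw.2) (by simp)) |>.to_subtype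
      exact Nat.card_pos_iff.2 ⟨⟨⟨w, hw⟩⟩, hf⟩
  · obtain ⟨a, b, hab, hcar⟩ := Finset.card_eq_two.1 hc
    have hsum := sum_coord (x := x) subset_rfl
    rw [hcar, Finset.sum_pair hab] at hsum
    have ha : 0 < coord x a := mem_carrier.1 (by rw [hcar]; simp)
    have hb : 0 < coord x b := mem_carrier.1 (by rw [hcar]; simp)
    obtain ⟨γ, hγ⟩ := hL.exists_isStar (x := x) hK.finite (Q := {a, b})
      (fun q hq => by
        rw [Finset.insert_eq_self.2 (by rw [hcar]; simpa using hq)]; exact hxL)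
      (by rintro q (rfl | rfl) <;> linarith)
      (fun y hy hxy => by
        right
        have hyL := (hL.mem_iff y).1 hy
        have heq : carrier x = carrier y :=
          Finset.eq_of_subset_of_card_le hxy (hc ▸ hL.card_le_two _ hyL)
        have hsumy := sum_coord (x := y) subset_rfl
        rw [← heq, hcar, Finset.sum_pair hab] at hsumy
        have hya := coord_nonneg y a
        have hyb := coord_nonneg y b
        have hout : ∀ z, z ≠ a → z ≠ b → coord y z = 0 ∧ coord x z = 0 := fun z hza hzb =>
          ⟨coord_eq_zero (by rw [← heq, hcar]; simp [hza, hzb]),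
            coord_eq_zero (by rw [hcar]; simp [hza, hzb])⟩
        rcases le_total (coord x a) (coord y a) with hle | hle
        -- Here `y` lies between `x` and `a`, and the parameter solves `coord y b = (1 - t) * coord
        -- x b`.
        · refine ⟨a, by simp, ⟨1 - coord y b / coord x b, ?_, ?_⟩, fun z => ?_⟩
          · rw [sub_nonneg, div_le_one hb]; linarith
          · linarith [div_nonneg hyb hb.le]
          · change coord y z = (1 - (1 - coord y b / coord x b)) * coord x z +
              (1 - coord y b / coord x b) * _
            by_cases hza : z = a
            · subst hza
              rw [if_pos rfl]; field_simp
              rw [show coord y z = 1 - coord y b by linarith,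
                show coord x z = 1 - coord x b by linarith]; ring
            · rw [if_neg hza]
              by_cases hzb : z = b
              · subst hzb; field_simp; ring
              · rw [(hout z hza hzb).1, (hout z hza hzb).2]; ring
        · refine ⟨b, by simp, ⟨1 - coord y a / coord x a, ?_, ?_⟩, fun z => ?_⟩
          · rw [sub_nonneg, div_le_one ha]; linarith
          · linarith [div_nonneg hya ha.le]
          · change coord y z = (1 - (1 - coord y a / coord x a)) * coord x z +
              (1 - coord y a / coord x a) * _
            by_cases hzb : z = b
            · subst hzb
              rw [if_pos rfl]; field_simp
              rw [show coord y z = 1 - coord y a by linarith,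
                show coord x z = 1 - coord x a by linarith]; ring
            · rw [if_neg hzb]
              by_cases hza : z = a
              · subst hza; field_simp; ring
              · rw [(hout z hza hzb).1, (hout z hza hzb).2]; ring)
    have h2 : Nat.card ({a, b} : Set E) = 2 := by rw [Nat.card_coe_set_eq, Set.ncard_pair hab]
    exact ⟨_, γ, hγ, (Set.toFinite _).to_subtype, by rw [h2]; exact even_two, by omega⟩

end Legs

/-- The embedding and the triangulation give two stars of the same set at the same point, so their
numbers of legs agree. -/
theorem degree_pos_even {α β : Type*} {G : Graph α β} (hV : G.vertexSet.Finite)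
    (hE : G.edgeSet.Finite) (h : IsMinimalSeparatingGraph G) {v : α} (hv : v ∈ G.vertexSet) :
    0 < degree G v ∧ Even (degree G v) := by
  obtain ⟨n, K, hK, -, φ, hsub, hmin⟩ := h
  obtain ⟨L, hL⟩ := hsub.exists_isFacesOf
  obtain ⟨u, w, hu, hw, huw, hd, hmeet⟩ := hmin.exists_open (hL.isClosed hK.finite)
  obtain ⟨Q, γ, hγ, hQ, heven, hpos⟩ := exists_isStar_even hK hL
    (⟨huw, hd, hu, hw, hmeet⟩ : IsSides φ.image u w) (x := φ.vert v) (Or.inl ⟨v, hv, rfl⟩)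
  have hfin : Finite (EndsAt φ v) := ((hE.prod (Set.finite_univ (α := Bool))).subset
    (fun d hd => ⟨hd.1, Set.mem_univ _⟩)).to_subtype
  have := (isStar_endsAt φ hV hE hv).card_eq hγ
  rw [card_endsAt φ hE hv] at this
  rw [this]
  exact ⟨hpos, heven⟩

end MinSep

namespace MinSep

/-! ### Connectedness and closure through carriers -/

section FullSubcomplex

variable {E : Type*} [NormedAddCommGroup E] [NormedSpace ℝ E]
  {K : Geometry.SimplicialComplex ℝ E}

/-- The points whose carrier meets `A`. -/
def neighborhood (K : Geometry.SimplicialComplex ℝ E) (A : Set E) : Set K.space :=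
  {x | ∃ a ∈ A, a ∈ carrier x}

theorem isOpen_neighborhood (hK : K.faces.Finite) (A : Set E) : IsOpen (neighborhood K A) := by
  have : neighborhood K A = ⋃ a ∈ A, openStar K {a} := by
    ext x
    simp [neighborhood, openStar]
  rw [this]
  exact isOpen_biUnion fun a _ => isOpen_star hK _

open scoped Classical in
-- A point is joined by a segment to a vertex of its carrier in `A`, and vertices in `A` are joined
-- along edges of `K`.
theorem isPathConnected_neighborhood {A : Set E} (hA : ∀ a ∈ A, {a} ∈ K.faces)
    (hne : A.Nonempty) (hconn : ∀ a ∈ A, ∀ b ∈ A,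
      Relation.ReflTransGen (fun a b => b ∈ A ∧ ({a, b} : Finset E) ∈ K.faces) a b) :
    IsPathConnected (neighborhood K A) := by
  have hmem : ∀ a (ha : a ∈ A), vertexPoint (hA a ha) ∈ neighborhood K A := fun a ha =>
    ⟨a, ha, by rw [carrier_vertexPoint]; simp⟩
  have hjoin : ∀ a (ha : a ∈ A), ∀ x : K.space, a ∈ carrier x →
      JoinedIn (neighborhood K A) (vertexPoint (hA a ha)) x := by
    intro a ha x hx
    refine joinedIn_of_carrier (carrier_mem_faces x) ?_ subset_rfl (hmem a ha) ⟨a, ha, hx⟩ ?_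
    · rw [carrier_vertexPoint]; simpa using hx
    · intro z hz
      exact ⟨a, ha, by rw [hz]; exact Finset.mem_union_right _ hx⟩
  have hverts : ∀ a (ha : a ∈ A) b (hb : b ∈ A),
      JoinedIn (neighborhood K A) (vertexPoint (hA a ha)) (vertexPoint (hA b hb)) := by
    intro a ha b hb
    induction hconn a ha b hb with
    | refl => exact JoinedIn.refl (hmem a ha)
    | @tail c d hac hcd ih =>
      have hc : c ∈ A := by
        rcases Relation.ReflTransGen.cases_tail hac with h | ⟨_, _, h⟩
        exacts [h ▸ ha, h.1]
      refine (ih hc).trans (joinedIn_of_carrier hcd.2 ?_ ?_ (hmem c hc) (hmem d hb) ?_)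
      · rw [carrier_vertexPoint]; simp
      · rw [carrier_vertexPoint]; simp
      · intro z hz
        exact ⟨c, hc, by rw [hz, carrier_vertexPoint]; simp⟩
  obtain ⟨a, ha⟩ := hne
  refine ⟨vertexPoint (hA a ha), hmem a ha, ?_⟩
  rintro x ⟨b, hb, hx⟩
  exact (hverts a ha b hb).trans (hjoin b hb x hx)

open scoped Classical in
theorem mem_closure_openStar {x : K.space} {r : Finset E} (hr : r ∈ K.faces)
    (hx : carrier x ⊆ r) : x ∈ closure (openStar K r) := by
  obtain ⟨z, hz⟩ := exists_carrier_eq hr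
  have hc := segmentMap_continuous hr hx hz.le
  have h0 : (0 : unitInterval) ∈ closure (Set.Ioo (0 : unitInterval) 1) := by
    rw [closure_Ioo zero_ne_one]
    exact ⟨le_rfl, zero_le_one⟩
  have := image_closure_subset_closure_image hc ⟨0, h0, rfl⟩
  rw [segmentMap_zero] at this
  refine closure_mono ?_ this
  rintro _ ⟨t, ht, rfl⟩
  change r ⊆ carrier _
  rw [carrier_segmentMap hr hx hz.le ht.1.ne' ht.2.ne, hz]
  exact Finset.subset_union_right

end FullSubcomplex

/-! ### Geometric realization of finite abstract complexes -/

section Realization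

variable {W E : Type*} [NormedAddCommGroup E] [NormedSpace ℝ E]
  {A : PreAbstractSimplicialComplex W} {K : Geometry.SimplicialComplex ℝ E} {p : W ↪ E}

/-- `K` is a geometric realization of `A` with vertices given by `p`. -/
def IsRealization (A : PreAbstractSimplicialComplex W) (K : Geometry.SimplicialComplex ℝ E)
    (p : W ↪ E) : Prop :=
  ∀ t, t ∈ K.faces ↔ ∃ s ∈ A.faces, s.map p = t

/-- The vertices are placed at basis vectors, which are affinely independent. -/
theorem exists_isRealization [Finite W] (A : PreAbstractSimplicialComplex W) :
    ∃ (n : ℕ) (K : Geometry.SimplicialComplex ℝ (EuclideanSpace ℝ (Fin n)))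
      (p : W ↪ EuclideanSpace ℝ (Fin n)), IsRealization A K p := by
  classical
  let b := (EuclideanSpace.basisFun (Fin (Nat.card W)) ℝ).toBasis
  have hb := b.linearIndependent.comp (Finite.equivFin W) (Finite.equivFin W).injective
  refine ⟨Nat.card W, Geometry.SimplicialComplex.ofAffineIndependent
    (A.map (b ∘ Finite.equivFin W)) ?_, ⟨b ∘ Finite.equivFin W, hb.injective⟩, fun t => ?_⟩
  · refine hb.affineIndependent.range.mono fun x hx => ?_
    simp only [Set.mem_iUnion, Finset.mem_coe] at hx
    obtain ⟨_, ⟨s, _, rfl⟩, hx⟩ := hx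
    obtain ⟨w, -, rfl⟩ := Finset.mem_image.1 hx
    exact ⟨w, rfl⟩
  · simp only [Finset.map_eq_image]
    exact Iff.rfl

theorem IsRealization.map_mem_faces (h : IsRealization A K p) {s : Finset W} :
    s.map p ∈ K.faces ↔ s ∈ A.faces := by
  rw [h]
  constructor
  · rintro ⟨t, ht, h⟩
    rwa [← Finset.map_injective p h]
  · exact fun h => ⟨s, h, rfl⟩

theorem IsRealization.singleton_mem_faces (h : IsRealization A K p) {a : W} :
    {p a} ∈ K.faces ↔ {a} ∈ A.faces := by
  rw [← h.map_mem_faces, Finset.map_singleton]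

open scoped Classical in
theorem IsRealization.pair_mem_faces (h : IsRealization A K p) {a b : W} :
    {p a, p b} ∈ K.faces ↔ {a, b} ∈ A.faces := by
  rw [← h.map_mem_faces, Finset.map_insert, Finset.map_singleton]

open scoped Classical in
theorem IsRealization.triple_mem_faces (h : IsRealization A K p) {a b c : W} :
    {p a, p b, p c} ∈ K.faces ↔ {a, b, c} ∈ A.faces := by
  rw [← h.map_mem_faces, Finset.map_insert, Finset.map_insert, Finset.map_singleton]

theorem IsRealization.finite_faces [Finite W] (h : IsRealization A K p) : K.faces.Finite := by
  refine ((Set.toFinite A.faces).image (Finset.map p)).subset fun t ht => ?_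
  exact (h t).1 ht

theorem IsRealization.exists_of_mem (h : IsRealization A K p) {t : Finset E}
    (ht : t ∈ K.faces) {x} (hx : x ∈ t) : ∃ a, {a} ∈ A.faces ∧ p a = x := by
  obtain ⟨s, hs, rfl⟩ := (h t).1 ht
  obtain ⟨a, ha, rfl⟩ := Finset.mem_map.1 hx
  exact ⟨a, (A.isRelLowerSet_faces hs).2 (by simpa using ha) (by simp), rfl⟩

open scoped Classical in
/-- `a`, `b`, `c` are the three vertices of a triangle of `A`. -/
def IsTri (A : PreAbstractSimplicialComplex W) (a b c : W) : Prop :=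
  a ≠ b ∧ b ≠ c ∧ a ≠ c ∧ ({a, b, c} : Finset W) ∈ A.faces

theorem IsRealization.isTriangle (h : IsRealization A K p) {a b c : W} :
    IsTriangle K (p a) (p b) (p c) ↔ IsTri A a b c := by
  rw [IsTriangle, IsTri, h.triple_mem_faces, p.injective.ne_iff, p.injective.ne_iff,
    p.injective.ne_iff]

open scoped Classical in
-- Reduces closedness of the surface to combinatorics. Only connectedness of the space is geometric:
-- the neighbourhood of the set of all vertices is everything.
theorem IsRealization.isClosedSurface [Finite W] (h : IsRealization A K p) (hne : ∃ a, {a} ∈ A.faces)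
    (hcard : ∀ s ∈ A.faces, s.card ≤ 3)
    (hconn : ∀ a b, {a} ∈ A.faces → {b} ∈ A.faces →
      Relation.ReflTransGen (fun a b => ({a, b} : Finset W) ∈ A.faces) a b)
    (hlink : ∀ a, {a} ∈ A.faces → ∃ b, b ≠ a ∧ ({a, b} : Finset W) ∈ A.faces)
    (hlink_conn : ∀ a b c, b ≠ a → ({a, b} : Finset W) ∈ A.faces → c ≠ a →
      ({a, c} : Finset W) ∈ A.faces → Relation.ReflTransGen (IsTri A a) b c)
    (htwo : ∀ a b, b ≠ a → ({a, b} : Finset W) ∈ A.faces → {c | IsTri A a b c}.ncard = 2) :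
    IsClosedSurface K where
  finite := h.finite_faces
  connected := by
    let V := p '' {a : W | {a} ∈ A.faces}
    have hV := isPathConnected_neighborhood (K := K) (A := V) ?_ ?_ ?_
    · have huniv : neighborhood K V = Set.univ := by
        refine Set.eq_univ_of_forall fun x => ?_
        obtain ⟨y, hy⟩ := carrier_nonempty x
        obtain ⟨a, ha, rfl⟩ := h.exists_of_mem (carrier_mem_faces x) hy
        exact ⟨_, ⟨a, ha, rfl⟩, hy⟩
      rw [huniv] at hV
      exact isConnected_iff_connectedSpace.2
        (connectedSpace_iff_univ.2 hV.isConnected)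
    · rintro _ ⟨a, ha, rfl⟩
      exact h.singleton_mem_faces.2 ha
    · obtain ⟨a, ha⟩ := hne
      exact ⟨_, a, ha, rfl⟩
    · rintro _ ⟨a, ha, rfl⟩ _ ⟨b, hb, rfl⟩
      refine (hconn a b ha hb).lift p (fun c d hcd => ?_)
      exact ⟨⟨d, (A.isRelLowerSet_faces hcd).2 (by simp) (by simp), rfl⟩, h.pair_mem_faces.2 hcd⟩
  card_le_three := by
    intro s hs
    obtain ⟨t, ht, rfl⟩ := (h _).1 hs
    exact (Finset.card_map _).trans_le (hcard t ht)
  link_connected := by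
    intro x hx
    obtain ⟨a, ha, rfl⟩ := h.exists_of_mem hx (Finset.mem_singleton_self x)
    have hpre : (linkGraph K (p a)).Preconnected := by
      rintro ⟨y, hya, hy⟩ ⟨z, hza, hz⟩
      obtain ⟨b, -, rfl⟩ := h.exists_of_mem hy
        (Finset.mem_insert_of_mem (Finset.mem_singleton_self y))
      obtain ⟨c, -, rfl⟩ := h.exists_of_mem hz
        (Finset.mem_insert_of_mem (Finset.mem_singleton_self z))
      have := hlink_conn a b c (fun h => hya (congrArg _ h)) (h.pair_mem_faces.1 hy)
        (fun h => hza (congrArg _ h)) (h.pair_mem_faces.1 hz)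
      clear hlink_conn
      induction this with
      | refl => exact SimpleGraph.Reachable.refl _
      | @tail d e hbd hde ih =>
        have hda : ({a, d} : Finset W) ∈ A.faces := (A.isRelLowerSet_faces hde.2.2.2).2
          (by intro w; simp only [Finset.mem_insert, Finset.mem_singleton]; tauto) (by simp)
        refine (ih (fun h => hde.1 (p.injective h).symm) (h.pair_mem_faces.2 hda)).trans ?_
        refine SimpleGraph.Adj.reachable ⟨?_, h.triple_mem_faces.2 hde.2.2.2⟩
        exact fun h => hde.2.1 (p.injective (congrArg Subtype.val h))
    obtain ⟨b, hba, hb⟩ := hlink a ha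
    exact (SimpleGraph.connected_iff _).2
      ⟨hpre, ⟨p b, p.injective.ne hba, h.pair_mem_faces.2 hb⟩⟩
  link_two_regular := by
    intro x hx
    obtain ⟨a, ha, rfl⟩ := h.exists_of_mem hx (Finset.mem_singleton_self x)
    rintro ⟨y, hya, hy⟩
    obtain ⟨b, -, rfl⟩ := h.exists_of_mem hy
      (Finset.mem_insert_of_mem (Finset.mem_singleton_self y))
    have hba : b ≠ a := fun h => hya (congrArg _ h)
    rw [← htwo a b hba (h.pair_mem_faces.1 hy), ← Set.ncard_image_of_injective _ p.injective,
      ← Set.ncard_image_of_injective _ Subtype.val_injective]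
    congr 1
    ext z
    constructor
    · rintro ⟨⟨z, hza, hz⟩, ⟨hne, hadj⟩, rfl⟩
      obtain ⟨c, -, rfl⟩ := h.exists_of_mem hz
        (Finset.mem_insert_of_mem (Finset.mem_singleton_self z))
      refine ⟨c, ⟨hba.symm, ?_, ?_, h.triple_mem_faces.1 hadj⟩, rfl⟩
      · rintro rfl
        exact hne rfl
      · rintro rfl
        exact hza rfl
    · rintro ⟨c, hc, rfl⟩
      refine ⟨⟨p c, p.injective.ne hc.2.2.1.symm, h.pair_mem_faces.2 ?_⟩,
        ⟨fun h => hc.2.1 (p.injective (congrArg Subtype.val h)),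
          h.triple_mem_faces.2 hc.2.2.2⟩, rfl⟩
      exact (A.isRelLowerSet_faces hc.2.2.2).2
        (by intro w; simp only [Finset.mem_insert, Finset.mem_singleton]; tauto) (by simp)

open scoped Classical in
theorem IsRealization.isOrientable (h : IsRealization A K p) (pos : W → W → W → Prop)
    (hp : ∀ a b c, IsTri A a b c → (pos a b c ↔ pos b c a) ∧ (pos a b c ↔ ¬ pos b a c) ∧
      ∀ d, d ≠ c → IsTri A a b d → (pos a b c ↔ pos b a d)) : IsOrientable K := by
  have hpos : ∀ a b c, (∃ a' b' c', p a' = p a ∧ p b' = p b ∧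
      p c' = p c ∧ pos a' b' c') ↔ pos a b c := by
    intro a b c
    constructor
    · rintro ⟨a', b', c', ha, hb, hc, h⟩
      rwa [← p.injective ha, ← p.injective hb, ← p.injective hc]
    · exact fun h => ⟨a, b, c, rfl, rfl, rfl, h⟩
  refine ⟨fun x y z => ∃ a b c, p a = x ∧ p b = y ∧ p c = z ∧ pos a b c,
    ?_⟩
  intro x y z hxyz
  obtain ⟨a, -, rfl⟩ := h.exists_of_mem hxyz.2.2.2 (x := x) (by simp)
  obtain ⟨b, -, rfl⟩ := h.exists_of_mem hxyz.2.2.2 (x := y) (by simp)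
  obtain ⟨c, -, rfl⟩ := h.exists_of_mem hxyz.2.2.2 (x := z) (by simp)
  simp only [hpos]
  have habc := hp a b c (h.isTriangle.1 hxyz)
  refine ⟨habc.1, habc.2.1, fun w hw hxyw => ?_⟩
  obtain ⟨d, -, rfl⟩ := h.exists_of_mem hxyw.2.2.2 (x := w) (by simp)
  rw [hpos]
  exact habc.2.2 d (fun h => hw (congrArg _ h)) (h.isTriangle.1 hxyw)

end Realization

end MinSep

namespace MinSep

/-! ### Surfaces glued from coloured triangles -/

section Gem

variable {X : Type*}

/-- The cells of the surface obtained from the triangles `x : X` by gluing `x` to `σ j x` along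
their sides of colour `j`. A vertex of colour `i` is opposite to the sides of colour `i`. -/
inductive Cell (σ : Fin 3 → X → X)
  | tri (x : X)
  | edge (j : Fin 3) (q : Quot fun x y => y = σ j x)
  | vert (i : Fin 3) (q : Quot fun x y => ∃ j, j ≠ i ∧ y = σ j x)

variable {σ : Fin 3 → X → X}

/-- The triangle `x` as a cell. -/
abbrev cellTri (σ : Fin 3 → X → X) (x : X) : Cell σ := Cell.tri x

/-- The side of colour `j` of the triangle `x`. -/
def cellEdge (σ : Fin 3 → X → X) (j : Fin 3) (x : X) : Cell σ := Cell.edge j (Quot.mk _ x)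

/-- The vertex of colour `i` of the triangle `x`. -/
def cellVert (σ : Fin 3 → X → X) (i : Fin 3) (x : X) : Cell σ := Cell.vert i (Quot.mk _ x)

theorem cellEdge_apply (j : Fin 3) (x : X) : cellEdge σ j (σ j x) = cellEdge σ j x :=
  congrArg (Cell.edge j) (Quot.sound (r := fun x y => y = σ j x) rfl).symm

theorem cellVert_apply {i j : Fin 3} (h : j ≠ i) (x : X) :
    cellVert σ i (σ j x) = cellVert σ i x :=
  congrArg (Cell.vert i) (Quot.sound ⟨j, h, rfl⟩).symm

/-- The unordered pair `s(x, σ j x)` is an invariant of the glued side, since `σ j` is an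
involution. -/
theorem cellEdge_eq_iff (hσ : ∀ i x, σ i (σ i x) = x) {j j' : Fin 3} {x y : X} :
    cellEdge σ j x = cellEdge σ j' y ↔ j = j' ∧ (y = x ∨ y = σ j x) := by
  constructor
  · intro h
    obtain ⟨rfl, h⟩ := Cell.edge.inj h
    refine ⟨rfl, ?_⟩
    have := congrArg (Quot.lift (fun x => s(x, σ j x)) (by
      rintro x _ rfl
      rw [hσ, Sym2.eq_swap])) (eq_of_heq h)
    have : s(x, σ j x) = s(y, σ j y) := this
    rw [Sym2.eq_iff] at this
    rcases this with h | h
    · exact Or.inl h.1.symm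
    · exact Or.inr h.2.symm
  · rintro ⟨rfl, rfl | rfl⟩
    · rfl
    · exact (cellEdge_apply j x).symm

theorem cellVert_color {i i' : Fin 3} {x y : X} (h : cellVert σ i x = cellVert σ i' y) :
    i = i' := (Cell.vert.inj h).1

theorem cellVert_eqvGen {i : Fin 3} {x y : X} (h : cellVert σ i x = cellVert σ i y) :
    Relation.EqvGen (fun x y => ∃ j, j ≠ i ∧ y = σ j x) x y :=
  Quot.eqvGen_exact (eq_of_heq (Cell.vert.inj h).2)

theorem cell_cases {p : Cell σ → Prop} (htri : ∀ x, p (cellTri σ x))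
    (hedge : ∀ j x, p (cellEdge σ j x)) (hvert : ∀ i x, p (cellVert σ i x)) (c : Cell σ) : p c := by
  rcases c with x | ⟨j, ⟨x⟩⟩ | ⟨i, ⟨x⟩⟩
  exacts [htri x, hedge j x, hvert i x]

instance [Finite X] : Finite (Cell σ) :=
  Finite.of_surjective (fun z : X ⊕ (Fin 3 × X) ⊕ (Fin 3 × X) => match z with
    | Sum.inl x => cellTri σ x
    | Sum.inr (Sum.inl (j, x)) => cellEdge σ j x
    | Sum.inr (Sum.inr (i, x)) => cellVert σ i x) fun c => by
  induction c using cell_cases with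
  | htri x => exact ⟨Sum.inl x, rfl⟩
  | hedge j x => exact ⟨Sum.inr (Sum.inl (j, x)), rfl⟩
  | hvert i x => exact ⟨Sum.inr (Sum.inr (i, x)), rfl⟩

/-- The cell `c` is a vertex of the small triangle of `x` with colours `i` and `j`. -/
def OnFlag (x : X) (i j : Fin 3) (c : Cell σ) : Prop :=
  c = cellVert σ i x ∨ c = cellEdge σ j x ∨ c = cellTri σ x

/-- The barycentric subdivision of the surface glued from coloured triangles. -/
def gemComplex (σ : Fin 3 → X → X) : PreAbstractSimplicialComplex (Cell σ) where
  faces := {s | s.Nonempty ∧ ∃ x i j, i ≠ j ∧ ∀ c ∈ s, OnFlag x i j c}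
  isRelLowerSet_faces := by
    rintro s ⟨hs, x, i, j, hij, h⟩
    exact ⟨hs, fun t hts ht => ⟨ht, x, i, j, hij, fun c hc => h c (hts hc)⟩⟩

theorem tri_ne_edge {x y : X} {j : Fin 3} : cellTri σ x ≠ cellEdge σ j y := nofun
theorem tri_ne_vert {x y : X} {i : Fin 3} : cellTri σ x ≠ cellVert σ i y := nofun
theorem edge_ne_vert {x y : X} {i j : Fin 3} : cellEdge σ j x ≠ cellVert σ i y := nofun

theorem onFlag_tri {x y : X} {i j : Fin 3} : OnFlag x i j (cellTri σ y) ↔ y = x := by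
  simp only [OnFlag, tri_ne_edge, tri_ne_vert, false_or]
  exact ⟨fun h => Cell.tri.inj h, fun h => h ▸ rfl⟩

theorem onFlag_edge {x y : X} {i j k : Fin 3} :
    OnFlag x i j (cellEdge σ k y) ↔ cellEdge σ k y = cellEdge σ j x := by
  simp only [OnFlag, tri_ne_edge.symm, edge_ne_vert, false_or, or_false]

theorem onFlag_vert {x y : X} {i j k : Fin 3} :
    OnFlag x i j (cellVert σ k y) ↔ cellVert σ k y = cellVert σ i x := by
  simp only [OnFlag, tri_ne_vert.symm, edge_ne_vert.symm, or_false]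

open scoped Classical in
theorem singleton_mem_gemComplex (c : Cell σ) : {c} ∈ (gemComplex σ).faces := by
  refine ⟨by simp, ?_⟩
  induction c using cell_cases with
  | htri x => exact ⟨x, 0, 1, by decide, by simp [OnFlag]⟩
  | hedge j x => exact ⟨x, j + 1, j, by revert j; decide, by simp [OnFlag]⟩
  | hvert i x => exact ⟨x, i, i + 1, by revert i; decide, by simp [OnFlag]⟩

open scoped Classical in
theorem pair_mem_gemComplex {a b : Cell σ} :
    {a, b} ∈ (gemComplex σ).faces ↔ ∃ x i j, i ≠ j ∧ OnFlag x i j a ∧ OnFlag x i j b := by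
  simp [gemComplex]

theorem isTri_gemComplex {a b c : Cell σ} :
    IsTri (gemComplex σ) a b c ↔ a ≠ b ∧ b ≠ c ∧ a ≠ c ∧
      ∃ x i j, i ≠ j ∧ OnFlag x i j a ∧ OnFlag x i j b ∧ OnFlag x i j c := by
  simp [IsTri, gemComplex]

theorem IsTri.swap {a b c : Cell σ} (h : IsTri (gemComplex σ) a b c) :
    IsTri (gemComplex σ) b a c := by
  rw [isTri_gemComplex] at h ⊢
  obtain ⟨h1, h2, h3, x, i, j, hij, ha, hb, hc⟩ := h
  exact ⟨h1.symm, h3, h2, x, i, j, hij, hb, ha, hc⟩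

theorem IsTri.swap_right {a b c : Cell σ} (h : IsTri (gemComplex σ) a b c) :
    IsTri (gemComplex σ) a c b := by
  rw [isTri_gemComplex] at h ⊢
  obtain ⟨h1, h2, h3, x, i, j, hij, ha, hb, hc⟩ := h
  exact ⟨h3, h2.symm, h1, x, i, j, hij, ha, hc, hb⟩

instance (a : Cell σ) : Std.Symm (IsTri (gemComplex σ) a) where
  symm _ _ h := h.swap_right

theorem isTri_flag {i j : Fin 3} (hij : i ≠ j) (x : X) :
    IsTri (gemComplex σ) (cellVert σ i x) (cellEdge σ j x) (cellTri σ x) :=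
  isTri_gemComplex.2 ⟨edge_ne_vert.symm, tri_ne_edge.symm, tri_ne_vert.symm, x, i, j, hij,
    by simp [OnFlag], by simp [OnFlag], by simp [OnFlag]⟩

theorem isTri_vert_edge (hσ : ∀ i x, σ i (σ i x) = x) {i j : Fin 3} (hij : i ≠ j) {x : X}
    {c : Cell σ} : IsTri (gemComplex σ) (cellVert σ i x) (cellEdge σ j x) c ↔
      c = cellTri σ x ∨ c = cellTri σ (σ j x) := by
  constructor
  · intro h
    obtain ⟨-, h2, h3, y, i', j', hij', ha, hb, hc⟩ := isTri_gemComplex.1 h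
    rw [onFlag_vert] at ha
    rw [onFlag_edge] at hb
    rcases hc with rfl | rfl | rfl
    · exact absurd ha h3
    · exact absurd hb h2
    · obtain ⟨-, rfl | rfl⟩ := (cellEdge_eq_iff hσ).1 hb
      exacts [Or.inl rfl, Or.inr rfl]
  · rintro (rfl | rfl)
    · exact isTri_flag hij x
    · have := isTri_flag (σ := σ) hij (σ j x)
      rwa [cellVert_apply hij.symm, cellEdge_apply] at this

theorem isTri_vert_tri {i : Fin 3} {x : X} {c : Cell σ} :
    IsTri (gemComplex σ) (cellVert σ i x) (cellTri σ x) c ↔ ∃ j, j ≠ i ∧ c = cellEdge σ j x := by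
  constructor
  · intro h
    obtain ⟨-, h2, h3, y, i', j', hij', ha, hb, hc⟩ := isTri_gemComplex.1 h
    rw [onFlag_vert] at ha
    rw [onFlag_tri] at hb
    subst hb
    rcases hc with rfl | rfl | rfl
    · exact absurd ha h3
    · exact ⟨j', by rw [cellVert_color ha]; exact hij'.symm, rfl⟩
    · exact absurd rfl h2
  · rintro ⟨j, hj, rfl⟩
    exact (isTri_flag hj.symm x).swap_right

theorem isTri_edge_tri (hσ : ∀ i x, σ i (σ i x) = x) {j : Fin 3} {x : X} {c : Cell σ} :
    IsTri (gemComplex σ) (cellEdge σ j x) (cellTri σ x) c ↔ ∃ i, i ≠ j ∧ c = cellVert σ i x := by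
  constructor
  · intro h
    obtain ⟨-, h2, h3, y, i', j', hij', ha, hb, hc⟩ := isTri_gemComplex.1 h
    rw [onFlag_edge] at ha
    rw [onFlag_tri] at hb
    subst hb
    rcases hc with rfl | rfl | rfl
    · exact ⟨i', by rw [((cellEdge_eq_iff hσ).1 ha).1]; exact hij', rfl⟩
    · exact absurd ha h3
    · exact absurd rfl h2
  · rintro ⟨i, hi, rfl⟩
    exact (isTri_flag hi x).swap.swap_right

theorem exists_other {i j : Fin 3} (h : i ≠ j) : ∃ k, k ≠ i ∧ k ≠ j ∧
    ∀ l, l ≠ i ↔ l = j ∨ l = k := by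
  revert i j; decide

/-- A vertex and a side are completed by `x` or `σ j x`, distinct by `hfix`. A triangle with one of
its vertices or sides is completed by a cell of one of the two remaining colours. -/
theorem ncard_isTri (hσ : ∀ i x, σ i (σ i x) = x) (hfix : ∀ i x, σ i x ≠ x) {a b : Cell σ}
    (hne : b ≠ a) (hab : ∃ x i j, i ≠ j ∧ OnFlag x i j a ∧ OnFlag x i j b) :
    {c | IsTri (gemComplex σ) a b c}.ncard = 2 := by
  have hswap : ∀ a b : Cell σ, {c | IsTri (gemComplex σ) a b c} =
      {c | IsTri (gemComplex σ) b a c} := fun a b => Set.ext fun c => ⟨IsTri.swap, IsTri.swap⟩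
  obtain ⟨x, i, j, hij, ha, hb⟩ := hab
  have h1 : {c | IsTri (gemComplex σ) (cellVert σ i x) (cellEdge σ j x) c}.ncard = 2 := by
    have : {c | IsTri (gemComplex σ) (cellVert σ i x) (cellEdge σ j x) c} =
        {cellTri σ x, cellTri σ (σ j x)} := Set.ext fun c => isTri_vert_edge hσ hij
    rw [this, Set.ncard_pair]
    exact fun h => hfix j x (Cell.tri.inj h).symm
  have h2 : {c | IsTri (gemComplex σ) (cellVert σ i x) (cellTri σ x) c}.ncard = 2 := by
    obtain ⟨k, -, hkj, hk⟩ := exists_other hij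
    have : {c | IsTri (gemComplex σ) (cellVert σ i x) (cellTri σ x) c} =
        {cellEdge σ j x, cellEdge σ k x} := by
      ext c
      change IsTri _ _ _ _ ↔ _
      rw [isTri_vert_tri]
      simp only [hk, or_and_right, exists_or, exists_eq_left]
      rfl
    rw [this, Set.ncard_pair]
    exact fun h => hkj ((cellEdge_eq_iff hσ).1 h).1.symm
  have h3 : {c | IsTri (gemComplex σ) (cellEdge σ j x) (cellTri σ x) c}.ncard = 2 := by
    obtain ⟨k, -, hki, hk⟩ := exists_other hij.symm
    have : {c | IsTri (gemComplex σ) (cellEdge σ j x) (cellTri σ x) c} =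
        {cellVert σ i x, cellVert σ k x} := by
      ext c
      change IsTri _ _ _ _ ↔ _
      rw [isTri_edge_tri hσ]
      simp only [hk, or_and_right, exists_or, exists_eq_left]
      rfl
    rw [this, Set.ncard_pair]
    exact fun h => hki (cellVert_color h).symm
  rcases ha with rfl | rfl | rfl <;> rcases hb with rfl | rfl | rfl <;>
    first | exact absurd rfl hne | assumption | (rw [hswap]; assumption)

/-- By symmetry it is enough to connect every neighbour of `a` to one hub. For a vertex cell, the
chain of gluings that identifies two corners is itself a path in the link, alternating between
triangles and sides. -/
theorem link_connected_gemComplex (hσ : ∀ i x, σ i (σ i x) = x) {a b c : Cell σ}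
    (hba : b ≠ a) (hb : ∃ x i j, i ≠ j ∧ OnFlag x i j a ∧ OnFlag x i j b)
    (hca : c ≠ a) (hc : ∃ x i j, i ≠ j ∧ OnFlag x i j a ∧ OnFlag x i j c) :
    Relation.ReflTransGen (IsTri (gemComplex σ) a) b c := by
  suffices hub : ∃ h, ∀ b, b ≠ a → (∃ x i j, i ≠ j ∧ OnFlag x i j a ∧ OnFlag x i j b) →
      Relation.ReflTransGen (IsTri (gemComplex σ) a) b h by
    obtain ⟨h, hh⟩ := hub
    exact (hh b hba hb).trans (symm_of (Relation.ReflTransGen (IsTri (gemComplex σ) a))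
      (hh c hca hc))
  clear hba hb hca hc b c
  induction a using cell_cases with
  | htri x =>
    have hve : ∀ i j : Fin 3, i ≠ j →
        IsTri (gemComplex σ) (cellTri σ x) (cellVert σ i x) (cellEdge σ j x) :=
      fun i j h => (isTri_flag h x).swap_right.swap
    have hev : ∀ i j : Fin 3, i ≠ j →
        IsTri (gemComplex σ) (cellTri σ x) (cellEdge σ j x) (cellVert σ i x) :=
      fun i j h => (hve i j h).swap_right
    have hedge : ∀ j, Relation.ReflTransGen (IsTri (gemComplex σ) (cellTri σ x))
        (cellEdge σ j x) (cellEdge σ 0 x) := by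
      intro j
      by_cases hj : j = 0
      · rw [hj]
      · obtain ⟨k, hk0, hkj, -⟩ := exists_other (Ne.symm hj)
        exact .head (hev k j hkj) (.single (hve k 0 hk0))
    refine ⟨cellEdge σ 0 x, fun b hb => ?_⟩
    rintro ⟨y, i, j, hij, ha, hb'⟩
    obtain rfl := onFlag_tri.1 ha
    rcases hb' with rfl | rfl | rfl
    · exact .head (hve i j hij) (hedge j)
    · exact hedge j
    · exact absurd rfl hb
  | hedge j x =>
    refine ⟨cellTri σ x, fun b hb => ?_⟩
    have hvert : ∀ i, i ≠ j → IsTri (gemComplex σ) (cellEdge σ j x) (cellVert σ i x)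
        (cellTri σ x) := fun i h => (isTri_flag h x).swap
    rintro ⟨y, i, k, hik, ha, hb'⟩
    obtain ⟨rfl, hy⟩ := (cellEdge_eq_iff hσ).1 (onFlag_edge.1 ha)
    have hv : cellVert σ i y = cellVert σ i x := by
      rcases hy with rfl | rfl
      exacts [rfl, cellVert_apply hik.symm x]
    rcases hb' with rfl | rfl | rfl
    · rw [hv]
      exact .single (hvert i hik)
    · exact absurd (onFlag_edge.1 ha).symm hb
    · refine .head ?_ (.single (hvert i hik))
      rw [onFlag_edge.1 ha, ← hv]
      exact (isTri_flag hik y).swap.swap_right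
  | hvert i x =>
    refine ⟨cellTri σ x, fun b hb => ?_⟩
    have htri : ∀ y z, Relation.EqvGen (fun x y => ∃ j, j ≠ i ∧ y = σ j x) y z →
        cellVert σ i y = cellVert σ i x → cellVert σ i z = cellVert σ i x →
        Relation.ReflTransGen (IsTri (gemComplex σ) (cellVert σ i x)) (cellTri σ y)
          (cellTri σ z) := by
      intro y z h
      induction h with
      | rel y z h =>
        obtain ⟨j, hj, rfl⟩ := h
        intro hy hz
        refine .head (b := cellEdge σ j y) ?_ (.single ?_)
        · rw [← hy]
          exact (isTri_flag hj.symm y).swap_right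
        · rw [← hz, ← cellEdge_apply]
          exact isTri_flag hj.symm _
      | refl => exact fun _ _ => .refl
      | symm y z _ ih =>
        exact fun hy hz => symm_of (Relation.ReflTransGen (IsTri (gemComplex σ) _)) (ih hz hy)
      | trans y z w hyz _ ih1 ih2 =>
        intro hy hw
        have hz : cellVert σ i z = cellVert σ i x := by
          rw [← hy]
          exact congrArg (Cell.vert i) (Quot.eqvGen_sound hyz).symm
        exact (ih1 hy hz).trans (ih2 hz hw)
    rintro ⟨y, i', j, hij, ha, hb'⟩
    have hy := onFlag_vert.1 ha
    obtain rfl := cellVert_color hy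
    have htri' := htri y x (cellVert_eqvGen hy.symm) hy.symm rfl
    rcases hb' with rfl | rfl | rfl
    · exact absurd hy.symm hb
    · refine .head ?_ htri'
      rw [hy]
      exact isTri_flag hij y
    · exact htri'

open scoped Classical in
-- A walk from triangle to triangle becomes an edge path through the sides crossed. It is applied
-- with `B` everything for the whole surface, and with `B` a colour class for one side of the graph.
theorem connected_cells {B : Cell σ → Prop}
    (hB : ∀ c, B c → ∃ x, B (cellTri σ x) ∧ ∃ i j, i ≠ j ∧ OnFlag x i j c)
    (hconn : ∀ x y, B (cellTri σ x) → B (cellTri σ y) → Relation.ReflTransGen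
      (fun x y => B (cellTri σ y) ∧ ∃ j, B (cellEdge σ j x) ∧ y = σ j x) x y) {a b : Cell σ}
    (ha : B a) (hb : B b) :
    Relation.ReflTransGen (fun a b => B b ∧ {a, b} ∈ (gemComplex σ).faces) a b := by
  obtain ⟨x, hx, i, j, hij, hax⟩ := hB a ha
  obtain ⟨y, hy, k, l, hkl, hby⟩ := hB b hb
  refine .head (b := cellTri σ x) ⟨hx, pair_mem_gemComplex.2 ⟨x, i, j, hij, hax, by simp [OnFlag]⟩⟩
    (.tail (b := cellTri σ y) ?_
      ⟨hb, pair_mem_gemComplex.2 ⟨y, k, l, hkl, by simp [OnFlag], hby⟩⟩)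
  have hstep : ∀ x y, (B (cellTri σ y) ∧ ∃ j, B (cellEdge σ j x) ∧ y = σ j x) →
      Relation.ReflTransGen (fun a b => B b ∧ {a, b} ∈ (gemComplex σ).faces)
        (cellTri σ x) (cellTri σ y) := by
    rintro x _ ⟨hy, j, hj, rfl⟩
    have hj1 : j + 1 ≠ j := by clear hj hy; revert j; decide
    refine .head (b := cellEdge σ j x)
      ⟨hj, pair_mem_gemComplex.2 ⟨x, j + 1, j, hj1, by simp [OnFlag], by simp [OnFlag]⟩⟩
      (.single ⟨hy, pair_mem_gemComplex.2 ⟨σ j x, j + 1, j, hj1, ?_, by simp [OnFlag]⟩⟩)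
    rw [← cellEdge_apply]
    simp [OnFlag]
  exact (hconn x y hx hy).lift' (cellTri σ) hstep

/-- The orientation sign of a small triangle. -/
def flagSign (ε : X → Bool) (x : X) (i j : Fin 3) : Prop := (ε x = true ↔ j = i + 1)

/-- The cyclic order of the dimensions of cells. -/
def cellRank : Cell σ → Fin 3
  | .tri _ => 2
  | .edge _ _ => 1
  | .vert _ _ => 0

/-- The three cells span a positively oriented small triangle when ordered by dimension. -/
def triSign (ε : X → Bool) (a b c : Cell σ) : Prop :=
  ∃ x i j, i ≠ j ∧ OnFlag x i j a ∧ OnFlag x i j b ∧ OnFlag x i j c ∧ flagSign ε x i j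

/-- Positivity of an ordered triangle of cells. -/
def cellPos (ε : X → Bool) (a b c : Cell σ) : Prop :=
  cellRank b = cellRank a + 1 ↔ triSign ε a b c

theorem eq_of_onFlag {x : X} {i j : Fin 3} {a b c d : Cell σ} (hab : a ≠ b) (hbc : b ≠ c)
    (hac : a ≠ c) (ha : OnFlag x i j a) (hb : OnFlag x i j b) (hc : OnFlag x i j c)
    (hd : OnFlag x i j d) : d = a ∨ d = b ∨ d = c := by
  unfold OnFlag at *
  grind

/-- Three distinct corners determine `x`, `i` and `j`, so the existential in `triSign` has only one
witness. -/
theorem triSign_iff (hσ : ∀ i x, σ i (σ i x) = x) (ε : X → Bool) {x : X} {i j : Fin 3}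
    {a b c : Cell σ} (hij : i ≠ j) (hab : a ≠ b) (hbc : b ≠ c) (hac : a ≠ c)
    (ha : OnFlag x i j a) (hb : OnFlag x i j b) (hc : OnFlag x i j c) :
    triSign ε a b c ↔ flagSign ε x i j := by
  refine ⟨?_, fun h => ⟨x, i, j, hij, ha, hb, hc, h⟩⟩
  rintro ⟨y, k, l, -, ha', hb', hc', h⟩
  have key : ∀ d : Cell σ, OnFlag x i j d → OnFlag y k l d := by
    intro d hd
    rcases eq_of_onFlag hab hbc hac ha hb hc hd with rfl | rfl | rfl <;> assumption
  have h1 := onFlag_tri.1 (key (cellTri σ x) (by simp [OnFlag]))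
  have h2 := onFlag_edge.1 (key (cellEdge σ j x) (by simp [OnFlag]))
  have h3 := onFlag_vert.1 (key (cellVert σ i x) (by simp [OnFlag]))
  rwa [h1, ((cellEdge_eq_iff hσ).1 h2).1, cellVert_color h3]

/-- Neighbouring small triangles differ in one corner. Either `x` becomes `σ j x`, which flips `ε`,
or one of `i`, `j` changes to the third colour, and exactly one of the two choices satisfies `j = i
+ 1`. -/
theorem triSign_iff_not (hσ : ∀ i x, σ i (σ i x) = x) {ε : X → Bool}
    (hε : ∀ i x, ε (σ i x) = !ε x) {a b c d : Cell σ} (hcd : c ≠ d)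
    (hc : IsTri (gemComplex σ) a b c) (hd : IsTri (gemComplex σ) a b d) :
    triSign ε a b c ↔ ¬ triSign ε a b d := by
  have hsymm : ∀ a b c : Cell σ, triSign ε a b c ↔ triSign ε b a c := fun a b c =>
    ⟨fun ⟨x, i, j, h, h1, h2, h3⟩ => ⟨x, i, j, h, h2, h1, h3⟩,
      fun ⟨x, i, j, h, h1, h2, h3⟩ => ⟨x, i, j, h, h2, h1, h3⟩⟩
  have hval : ∀ {a b c : Cell σ} {x i j}, IsTri (gemComplex σ) a b c → i ≠ j → OnFlag x i j a →
      OnFlag x i j b → OnFlag x i j c → (triSign ε a b c ↔ flagSign ε x i j) :=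
    fun h hij => triSign_iff hσ ε hij h.1 h.2.1 h.2.2.1
  have hve : ∀ {x i j} {c d : Cell σ}, i ≠ j → c ≠ d →
      IsTri (gemComplex σ) (cellVert σ i x) (cellEdge σ j x) c →
      IsTri (gemComplex σ) (cellVert σ i x) (cellEdge σ j x) d →
      (triSign ε (cellVert σ i x) (cellEdge σ j x) c ↔
        ¬ triSign ε (cellVert σ i x) (cellEdge σ j x) d) := by
    intro x i j c d hij hcd hc hd
    have h1 : triSign ε (cellVert σ i x) (cellEdge σ j x) (cellTri σ x) ↔ flagSign ε x i j :=
      hval (isTri_flag hij x) hij (by simp [OnFlag]) (by simp [OnFlag]) (by simp [OnFlag])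
    have h2 : triSign ε (cellVert σ i x) (cellEdge σ j x) (cellTri σ (σ j x)) ↔
        flagSign ε (σ j x) i j := by
      refine hval ((isTri_vert_edge hσ hij).2 (Or.inr rfl)) hij ?_ ?_ (by simp [OnFlag])
      · rw [← cellVert_apply hij.symm]; simp [OnFlag]
      · rw [← cellEdge_apply]; simp [OnFlag]
    have h3 : flagSign ε x i j ↔ ¬ flagSign ε (σ j x) i j := by
      simp only [flagSign, hε]
      cases ε x <;> simp
    rcases (isTri_vert_edge hσ hij).1 hc with rfl | rfl <;>
      rcases (isTri_vert_edge hσ hij).1 hd with rfl | rfl <;>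
      first | exact absurd rfl hcd | rw [h1, h2]
    · exact h3
    · rw [h3, not_not]
  have hvt : ∀ {x i} {c d : Cell σ}, c ≠ d →
      IsTri (gemComplex σ) (cellVert σ i x) (cellTri σ x) c →
      IsTri (gemComplex σ) (cellVert σ i x) (cellTri σ x) d →
      (triSign ε (cellVert σ i x) (cellTri σ x) c ↔
        ¬ triSign ε (cellVert σ i x) (cellTri σ x) d) := by
    intro x i c d hcd hc hd
    obtain ⟨j, hj, rfl⟩ := isTri_vert_tri.1 hc
    obtain ⟨k, hk, rfl⟩ := isTri_vert_tri.1 hd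
    have hjk : j ≠ k := by
      rintro rfl
      exact hcd rfl
    rw [hval (x := x) hc hj.symm (by simp [OnFlag]) (by simp [OnFlag]) (by simp [OnFlag]),
      hval (x := x) hd hk.symm (by simp [OnFlag]) (by simp [OnFlag]) (by simp [OnFlag])]
    have : j = i + 1 ↔ ¬ k = i + 1 := by
      clear hc hd hcd
      revert i j k
      decide
    simp only [flagSign, this]
    tauto
  have het : ∀ {x j} {c d : Cell σ}, c ≠ d →
      IsTri (gemComplex σ) (cellEdge σ j x) (cellTri σ x) c →
      IsTri (gemComplex σ) (cellEdge σ j x) (cellTri σ x) d →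
      (triSign ε (cellEdge σ j x) (cellTri σ x) c ↔
        ¬ triSign ε (cellEdge σ j x) (cellTri σ x) d) := by
    intro x j c d hcd hc hd
    obtain ⟨i, hi, rfl⟩ := (isTri_edge_tri hσ).1 hc
    obtain ⟨k, hk, rfl⟩ := (isTri_edge_tri hσ).1 hd
    have hik : i ≠ k := by
      rintro rfl
      exact hcd rfl
    rw [hval (x := x) hc hi (by simp [OnFlag]) (by simp [OnFlag]) (by simp [OnFlag]),
      hval (x := x) hd hk (by simp [OnFlag]) (by simp [OnFlag]) (by simp [OnFlag])]
    have : j = i + 1 ↔ ¬ j = k + 1 := by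
      clear hc hd hcd
      revert i j k
      decide
    simp only [flagSign, this]
    tauto
  have hab := hc.1
  obtain ⟨-, -, -, x, i, j, hij, ha, hb, -⟩ := isTri_gemComplex.1 hc
  rcases ha with rfl | rfl | rfl <;> rcases hb with rfl | rfl | rfl <;>
    first
    | exact absurd rfl hab
    | exact hve hij hcd hc hd
    | exact hvt hcd hc hd
    | exact het hcd hc hd
    | rw [hsymm, hsymm _ _ d]
  · exact hve hij hcd hc.swap hd.swap
  · exact hvt hcd hc.swap hd.swap
  · exact het hcd hc.swap hd.swap

theorem cellRank_ne {x : X} {i j : Fin 3} {a b : Cell σ} (ha : OnFlag x i j a)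
    (hb : OnFlag x i j b) (hab : a ≠ b) : cellRank a ≠ cellRank b := by
  rcases ha with rfl | rfl | rfl <;> rcases hb with rfl | rfl | rfl <;>
    first | exact absurd rfl hab | (simp only [cellRank, cellVert, cellEdge]; decide)

/-- The ranks of the corners are the three elements of `Fin 3`, so the rank condition is kept by
rotations and negated by transpositions, while `triSign` ignores the order. Coherence across an edge
is `triSign_iff_not`. -/
theorem cellPos_properties (hσ : ∀ i x, σ i (σ i x) = x) {ε : X → Bool}
    (hε : ∀ i x, ε (σ i x) = !ε x) {a b c : Cell σ} (h : IsTri (gemComplex σ) a b c) :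
    (cellPos ε a b c ↔ cellPos ε b c a) ∧ (cellPos ε a b c ↔ ¬ cellPos ε b a c) ∧
      ∀ d, d ≠ c → IsTri (gemComplex σ) a b d → (cellPos ε a b c ↔ cellPos ε b a d) := by
  obtain ⟨hab, hbc, hac, x, i, j, hij, ha, hb, hc⟩ := isTri_gemComplex.1 h
  have hr : ∀ p q r : Fin 3, p ≠ q → q ≠ r → p ≠ r →
      ((q = p + 1 ↔ r = q + 1) ∧ (q = p + 1 ↔ ¬ p = q + 1)) := by
    intro p q r
    fin_cases p <;> fin_cases q <;> fin_cases r <;> simp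
  obtain ⟨h1, h2⟩ := hr _ _ _ (cellRank_ne ha hb hab) (cellRank_ne hb hc hbc)
    (cellRank_ne ha hc hac)
  have hrot : triSign ε b c a ↔ triSign ε a b c :=
    ⟨fun ⟨x, i, j, h, h1, h2, h3, h4⟩ => ⟨x, i, j, h, h3, h1, h2, h4⟩,
      fun ⟨x, i, j, h, h1, h2, h3, h4⟩ => ⟨x, i, j, h, h2, h3, h1, h4⟩⟩
  have hsymm : ∀ c, triSign ε b a c ↔ triSign ε a b c := fun c =>
    ⟨fun ⟨x, i, j, h, h1, h2, h3⟩ => ⟨x, i, j, h, h2, h1, h3⟩,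
      fun ⟨x, i, j, h, h1, h2, h3⟩ => ⟨x, i, j, h, h2, h1, h3⟩⟩
  refine ⟨?_, ?_, fun d hd htri => ?_⟩
  · rw [cellPos, cellPos, hrot, h1]
  · rw [cellPos, cellPos, hsymm, h2]
    tauto
  · rw [cellPos, cellPos, hsymm, h2, triSign_iff_not hσ hε hd.symm h htri]
    tauto

variable {E : Type*} [NormedAddCommGroup E] [NormedSpace ℝ E]
  {K : Geometry.SimplicialComplex ℝ E} {p : Cell σ ↪ E}

theorem IsRealization.isOrientable_gem (h : IsRealization (gemComplex σ) K p)
    (hσ : ∀ i x, σ i (σ i x) = x) {ε : X → Bool} (hε : ∀ i x, ε (σ i x) = !ε x) :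
    IsOrientable K :=
  h.isOrientable (cellPos ε) fun _ _ _ => cellPos_properties hσ hε

theorem IsRealization.isClosedSurface_gem [Finite X] [Nonempty X]
    (h : IsRealization (gemComplex σ) K p)
    (hσ : ∀ i x, σ i (σ i x) = x) (hfix : ∀ i x, σ i x ≠ x)
    (hconn : ∀ x y, Relation.ReflTransGen (fun x y => ∃ j, y = σ j x) x y) :
    IsClosedSurface K := by
  classical
  refine h.isClosedSurface ?_ ?_ ?_ ?_ ?_ ?_
  · exact ⟨cellTri σ (Classical.arbitrary X), singleton_mem_gemComplex _⟩
  · rintro s ⟨-, x, i, j, -, hs⟩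
    refine (Finset.card_le_card (t := {cellVert σ i x, cellEdge σ j x, cellTri σ x}) ?_).trans
      Finset.card_le_three
    intro c hc
    simpa [OnFlag] using hs c hc
  · intro a b _ _
    refine Relation.ReflTransGen.mono (fun _ _ h => ?_) _ _
      (connected_cells (B := fun _ => True) ?_ ?_ trivial trivial)
    · convert h.2
    · intro c _
      obtain ⟨-, x, i, j, hij, hc⟩ := singleton_mem_gemComplex c
      exact ⟨x, trivial, i, j, hij, hc c (by simp)⟩
    · intro x y _ _
      exact Relation.ReflTransGen.mono (fun _ _ ⟨j, hj⟩ => ⟨trivial, j, trivial, hj⟩) _ _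
        (hconn x y)
  · intro a _
    obtain ⟨-, x, i, j, hij, ha⟩ := singleton_mem_gemComplex a
    have hax := ha a (by simp)
    by_cases hne : cellTri σ x = a
    · exact ⟨cellVert σ i x, hne ▸ tri_ne_vert.symm, pair_mem_gemComplex.2
        ⟨x, i, j, hij, hax, by simp [OnFlag]⟩⟩
    · exact ⟨cellTri σ x, hne, pair_mem_gemComplex.2 ⟨x, i, j, hij, hax, by simp [OnFlag]⟩⟩
  · intro a b c hba hb hca hc
    exact link_connected_gemComplex hσ hba (pair_mem_gemComplex.1 hb) hca
      (pair_mem_gemComplex.1 hc)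
  · intro a b hba hb
    exact ncard_isTri hσ hfix hba (pair_mem_gemComplex.1 hb)

end Gem

end MinSep

namespace MinSep

/-! ### Polygonal arcs with four sides -/

section Polygon

/-- The piecewise linear function with value `1` at `k` and `0` at all other integers. -/
noncomputable def hat (k : ℕ) (u : ℝ) : ℝ := max 0 (1 - |u - k|)

theorem hat_nonneg (k : ℕ) (u : ℝ) : 0 ≤ hat k u := le_max_left _ _

theorem hat_continuous (k : ℕ) : Continuous (hat k) := by
  unfold hat
  fun_prop

theorem hat_eq {m : ℕ} {u : ℝ} (h0 : (m : ℝ) ≤ u) (h1 : u ≤ m + 1) (k : ℕ) :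
    hat k u = (if k = m then m + 1 - u else 0) + if k = m + 1 then u - m else 0 := by
  unfold hat
  by_cases hk : k = m
  · subst hk
    rw [abs_of_nonneg (by linarith), max_eq_right (by linarith)]
    simp
    ring
  by_cases hk' : k = m + 1
  · subst hk'
    push_cast
    rw [abs_of_nonpos (by linarith), max_eq_right (by linarith)]
    simp
    ring
  rw [if_neg hk, if_neg hk', add_zero]
  refine max_eq_left ?_
  rcases lt_or_gt_of_ne hk with h | h
  · have : (k : ℝ) + 1 ≤ m := by exact_mod_cast h
    rw [abs_of_nonneg (by linarith)]
    linarith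
  · have : (m : ℝ) + 2 ≤ k := by
      have : m + 2 ≤ k := by omega
      exact_mod_cast this
    rw [abs_of_nonpos (by linarith)]
    linarith

theorem sum_hat_smul {F : Type*} [AddCommGroup F] [Module ℝ F] (f : ℕ → F) {N m : ℕ}
    (hm : m < N) {u : ℝ} (h0 : (m : ℝ) ≤ u) (h1 : u ≤ m + 1) :
    ∑ k ∈ Finset.range (N + 1), hat k u • f k = (m + 1 - u) • f m + (u - m) • f (m + 1) := by
  simp only [hat_eq h0 h1, add_smul, ite_smul, zero_smul, Finset.sum_add_distrib,
    Finset.sum_ite_eq', Finset.mem_range]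
  rw [if_pos (by omega), if_pos (by omega)]

theorem exists_interval {N : ℕ} (hN : 0 < N) {u : ℝ} (h0 : 0 ≤ u) (h1 : u ≤ N) :
    ∃ m < N, (m : ℝ) ≤ u ∧ u ≤ m + 1 := by
  by_cases hu : u = N
  · refine ⟨N - 1, by omega, ?_⟩
    rw [Nat.cast_sub (by omega), hu]
    constructor <;> simp
  · refine ⟨⌊u⌋₊, (Nat.floor_lt h0).2 (lt_of_le_of_ne h1 hu), Nat.floor_le h0,
      (Nat.lt_floor_add_one u).le⟩

/-- The parameters of a polygonal arc with four sides are determined by the coordinates at the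
inner corners, except at the ends. -/
theorem eq_of_hat_eq {s t : ℝ} (hs0 : 0 ≤ s) (hs1 : s ≤ 4) (ht0 : 0 ≤ t) (ht1 : t ≤ 4)
    (h : ∀ k, 1 ≤ k → k ≤ 3 → hat k s = hat k t) :
    s = t ∨ (s = 0 ∧ t = 4) ∨ (s = 4 ∧ t = 0) := by
  obtain ⟨m, hm, hm0, hm1⟩ := exists_interval (N := 4) (by norm_num) hs0 (by exact_mod_cast hs1)
  obtain ⟨l, hl, hl0, hl1⟩ := exists_interval (N := 4) (by norm_num) ht0 (by exact_mod_cast ht1)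
  have h1 := h 1 le_rfl (by norm_num)
  have h2 := h 2 (by norm_num) (by norm_num)
  have h3 := h 3 (by norm_num) le_rfl
  simp only [hat_eq hm0 hm1, hat_eq hl0 hl1] at h1 h2 h3
  clear h
  interval_cases m <;> interval_cases l <;> norm_num at * <;>
    first
    | (left; linarith)
    | (right; left; constructor <;> linarith)
    | (right; right; constructor <;> linarith)

theorem exists_hat_pos {u : ℝ} (h0 : 0 < u) (h1 : u < 4) : ∃ k, 1 ≤ k ∧ k ≤ 3 ∧ 0 < hat k u := by
  by_contra! h
  have hz : ∀ k, 1 ≤ k → k ≤ 3 → hat k u = hat k 0 := by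
    intro k hk hk'
    rw [le_antisymm (h k hk hk') (hat_nonneg k u), hat_eq (m := 0) (by simp) (by simp)]
    have : k ≠ 0 := by omega
    simp [this]
  rcases eq_of_hat_eq h0.le h1.le le_rfl (by norm_num) hz with h | h | h <;> linarith

variable {E : Type*} [NormedAddCommGroup E] [NormedSpace ℝ E]
  {K : Geometry.SimplicialComplex ℝ E} {q : ℕ → E}

open scoped Classical in
/-- Consecutive corners span edges of `K`. -/
def IsPolygon (K : Geometry.SimplicialComplex ℝ E) (q : ℕ → E) : Prop :=
  ∀ m < 4, q m ≠ q (m + 1) ∧ {q m, q (m + 1)} ∈ K.faces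

theorem exists_side (t : unitInterval) :
    ∃ m : ℕ, m < 4 ∧ (m : ℝ) ≤ 4 * (t : ℝ) ∧ 4 * (t : ℝ) ≤ m + 1 :=
  exists_interval (by norm_num) (by linarith [t.2.1]) (by push_cast; linarith [t.2.2])

theorem polygon_mem_space (hq : IsPolygon K q) (t : unitInterval) :
    ∑ k ∈ Finset.range 5, hat k (4 * t) • q k ∈ K.space := by
  classical
  obtain ⟨m, hm, h0, h1⟩ := exists_side t
  rw [sum_hat_smul q hm h0 h1]
  refine Geometry.SimplicialComplex.convexHull_subset_space (hq m hm).2 ?_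
  refine convex_convexHull ℝ _ (subset_convexHull ℝ _ (by simp)) (subset_convexHull ℝ _ (by simp))
    (by linarith) (by linarith) (by ring)

/-- The polygonal arc with corners `q 0`, ..., `q 4`. -/
noncomputable def polygon (hq : IsPolygon K q) (t : unitInterval) : K.space :=
  ⟨∑ k ∈ Finset.range 5, hat k (4 * t) • q k, polygon_mem_space hq t⟩

theorem polygon_continuous (hq : IsPolygon K q) : Continuous (polygon hq) := by
  refine Continuous.subtype_mk (continuous_finsetSum _ fun k _ => ?_) _
  exact ((hat_continuous k).comp (by fun_prop)).smul continuous_const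

open scoped Classical in
theorem coord_polygon (hq : IsPolygon K q) (t : unitInterval) (v : E) :
    coord (polygon hq t) v = ∑ k ∈ Finset.range 5, hat k (4 * t) * if v = q k then 1 else 0 := by
  obtain ⟨m, hm, h0, h1⟩ := exists_side t
  have hs := fun v => sum_hat_smul (fun k => if v = q k then (1 : ℝ) else 0) hm h0 h1
  simp only [smul_eq_mul] at hs
  rw [hs]
  have hne := (hq m hm).1
  refine congrFun (coord_eq (x := polygon hq t) (hq m hm).2 (w := fun v =>
    (m + 1 - 4 * (t : ℝ)) * (if v = q m then 1 else 0) +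
      (4 * (t : ℝ) - m) * if v = q (m + 1) then 1 else 0) ?_ ?_ ?_ ?_) v
  · intro v _
    refine add_nonneg (mul_nonneg (by linarith) ?_) (mul_nonneg (by linarith) ?_) <;>
      split_ifs <;> norm_num
  · intro v hv
    simp only [Finset.mem_insert, Finset.mem_singleton, not_or] at hv
    simp [hv.1, hv.2]
  · rw [Finset.sum_pair hne]
    simp [hne, hne.symm]
  · rw [Finset.sum_pair hne]
    simp only [polygon, sum_hat_smul q hm h0 h1, if_pos, if_neg hne, if_neg hne.symm, mul_one,
      mul_zero, add_zero, zero_add]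

open scoped Classical in
theorem carrier_polygon (hq : IsPolygon K q) (t : unitInterval) :
    ∃ m < 4, carrier (polygon hq t) ⊆ {q m, q (m + 1)} := by
  obtain ⟨m, hm, h0, h1⟩ := exists_side t
  refine ⟨m, hm, fun v hv => ?_⟩
  by_contra hvn
  simp only [Finset.mem_insert, Finset.mem_singleton, not_or] at hvn
  have hs := sum_hat_smul (fun k => if v = q k then (1 : ℝ) else 0) hm h0 h1
  simp only [smul_eq_mul] at hs
  rw [mem_carrier, coord_polygon, hs, if_neg hvn.1, if_neg hvn.2] at hv
  simp at hv

open scoped Classical in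
theorem coord_polygon_corner (hq : IsPolygon K q) (t : unitInterval) {k : ℕ} (hk : k < 5)
    (hne : ∀ l < 5, q k = q l → k = l) : coord (polygon hq t) (q k) = hat k (4 * t) := by
  rw [coord_polygon, Finset.sum_eq_single k]
  · simp
  · intro l hl hlk
    rw [if_neg fun h => hlk (hne l (Finset.mem_range.1 hl) h).symm, mul_zero]
  · intro h
    exact absurd (Finset.mem_range.2 hk) h

open scoped Classical in
theorem exists_polygon_eq (hq : IsPolygon K q) {y : K.space} {m : ℕ} (hm : m < 4)
    (hy : carrier y ⊆ {q m, q (m + 1)}) : ∃ t, polygon hq t = y := by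
  have hc0 := coord_nonneg y (q (m + 1))
  have hc1 := coord_le_one y (q (m + 1))
  have hm' : (m : ℝ) + 1 ≤ 4 := by exact_mod_cast hm
  have hm0 : (0 : ℝ) ≤ m := m.cast_nonneg
  refine ⟨⟨(m + coord y (q (m + 1))) / 4, by positivity, by linarith⟩, Subtype.ext ?_⟩
  have hu : 4 * ((m + coord y (q (m + 1))) / 4) = m + coord y (q (m + 1)) := by ring
  have hs := sum_coord hy
  have hp := sum_coord_smul hy
  rw [Finset.sum_pair (hq m hm).1] at hs hp
  simp only [polygon, hu]
  rw [sum_hat_smul q hm (by linarith) (by linarith), ← hp]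
  congr 2 <;> linarith

theorem polygon_zero (hq : IsPolygon K q) : (polygon hq 0).1 = q 0 := by
  have := sum_hat_smul q (N := 4) (m := 0) (u := 0) (by norm_num) (by simp) (by simp)
  simpa [polygon] using this

theorem polygon_one (hq : IsPolygon K q) : (polygon hq 1).1 = q 4 := by
  have := sum_hat_smul q (N := 4) (m := 3) (u := 4) (by norm_num) (by norm_num) (by norm_num)
  simp only [polygon]
  norm_num at this ⊢
  exact this

/-- Only the inner corners have to be distinct from all others: `q 0 = q 4` is allowed, as happens
for loops. -/
theorem polygon_simple (hq : IsPolygon K q)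
    (hne : ∀ k l, 1 ≤ k → k ≤ 3 → l < 5 → q k = q l → k = l) {s t : unitInterval}
    (h : polygon hq s = polygon hq t) : s = t ∨ (s = 0 ∧ t = 1) ∨ (s = 1 ∧ t = 0) := by
  have hs0 := s.2.1
  have hs1 := s.2.2
  have ht0 := t.2.1
  have ht1 := t.2.2
  have := eq_of_hat_eq (s := 4 * s) (t := 4 * t) (by linarith) (by linarith) (by linarith)
    (by linarith) fun k hk hk' => by
      rw [← coord_polygon_corner hq s (by omega) fun l hl => hne k l hk hk' hl,
        ← coord_polygon_corner hq t (by omega) fun l hl => hne k l hk hk' hl, h]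
  simp only [Subtype.ext_iff, Set.Icc.coe_zero, Set.Icc.coe_one]
  rcases this with h | h | h
  · left; linarith
  · right; left; constructor <;> linarith
  · right; right; constructor <;> linarith

end Polygon

end MinSep

namespace MinSep

/-! ### The ribbon surface and the colours of its cells -/

section Ribbon

variable {ι α : Type*}

/-- The gluing of the triangles of a ribbon surface. The triangle `(e, b, o, s)` lies on the side
`s` of the edge `e`, in the half of `e` at its head (`b = true`) or tail; it has a side in common
with `e` if `o = true`, and otherwise is next to a slit ending at the midpoint of `e`. -/
def ribbonGlue (R : Bool → Bool → Equiv.Perm ι) :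
    Fin 3 → ι × Bool × Bool × Bool → ι × Bool × Bool × Bool
  | 0, (e, b, true, s) => (e, b, true, !s)
  | 0, (e, b, false, s) => (e, !b, false, s)
  | 1, (e, b, o, s) => (e, b, !o, s)
  | 2, (e, true, o, s) => (R o s e, false, o, s)
  | 2, (e, false, o, s) => ((R o s).symm e, true, o, s)

variable {R : Bool → Bool → Equiv.Perm ι}

theorem ribbonGlue_involutive (i : Fin 3) (x : ι × Bool × Bool × Bool) :
    ribbonGlue R i (ribbonGlue R i x) = x := by
  obtain ⟨e, b, o, s⟩ := x
  fin_cases i <;> cases b <;> cases o <;> cases s <;> simp [ribbonGlue]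

/-- The orientation of the triangles of a ribbon surface. -/
def ribbonSign (x : ι × Bool × Bool × Bool) : Bool := xor x.2.1 (xor x.2.2.1 x.2.2.2)

theorem ribbonSign_glue (i : Fin 3) (x : ι × Bool × Bool × Bool) :
    ribbonSign (ribbonGlue R i x) = !ribbonSign x := by
  obtain ⟨e, b, o, s⟩ := x
  fin_cases i <;> cases b <;> cases o <;> cases s <;> rfl

theorem ribbonGlue_ne (i : Fin 3) (x : ι × Bool × Bool × Bool) : ribbonGlue R i x ≠ x := by
  intro h
  have := ribbonSign_glue (R := R) i x
  rw [h] at this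
  exact Bool.not_ne_self _ this.symm

/-- The colour of the side `j` of a triangle: its side of the graph, or `none` on the graph. -/
def edgeColor (j : Fin 3) (x : ι × Bool × Bool × Bool) : Option Bool :=
  if j = 0 ∧ x.2.2.1 = true then none else some x.2.2.2

/-- The colour of the vertex `i` of a triangle: its side of the graph, or `none` on the graph. -/
def vertColor (i : Fin 3) (x : ι × Bool × Bool × Bool) : Option Bool :=
  if i = 2 ∨ (i = 1 ∧ x.2.2.1 = true) then none else some x.2.2.2

/-- The colour of a cell: its side of the graph, or `none` for the cells on the graph. -/
def cellColor : Cell (ribbonGlue R) → Option Bool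
  | .tri x => some x.2.2.2
  | .edge j q => Quot.lift (edgeColor j) (by
      rintro ⟨e, b, o, s⟩ _ rfl
      fin_cases j <;> cases b <;> cases o <;> rfl) q
  | .vert i q => Quot.lift (vertColor i) (by
      rintro ⟨e, b, o, s⟩ _ ⟨j, hj, rfl⟩
      fin_cases i <;> fin_cases j <;> cases b <;> cases o <;>
        first | exact absurd rfl hj | rfl) q

theorem cellColor_tri (x : ι × Bool × Bool × Bool) :
    cellColor (cellTri (ribbonGlue R) x) = some x.2.2.2 := rfl

theorem cellColor_edge (j : Fin 3) (x : ι × Bool × Bool × Bool) :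
    cellColor (cellEdge (ribbonGlue R) j x) = edgeColor j x := rfl

theorem cellColor_vert (i : Fin 3) (x : ι × Bool × Bool × Bool) :
    cellColor (cellVert (ribbonGlue R) i x) = vertColor i x := rfl

theorem color_of_onFlag {x : ι × Bool × Bool × Bool} {i j : Fin 3} {c : Cell (ribbonGlue R)}
    {s : Bool} (hc : OnFlag x i j c) (hs : cellColor c = some s) : x.2.2.2 = s := by
  rcases hc with rfl | rfl | rfl
  · rw [cellColor_vert, vertColor] at hs
    split_ifs at hs
    exact Option.some.inj hs
  · rw [cellColor_edge, edgeColor] at hs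
    split_ifs at hs
    exact Option.some.inj hs
  · exact Option.some.inj hs

/-- This vertex is the midpoint of `e`. The gluings of colours 0 and 1 connect all eight triangles
of `e` around it. -/
theorem cellVert_two_eq (e : ι) (b b' o o' s s' : Bool) :
    cellVert (ribbonGlue R) 2 (e, b, o, s) = cellVert (ribbonGlue R) 2 (e, b', o', s') := by
  have h1 : ∀ b s, cellVert (ribbonGlue R) 2 (e, b, true, s) =
      cellVert (ribbonGlue R) 2 (e, b, true, !s) := fun b s =>
    (cellVert_apply (σ := ribbonGlue R) (i := 2) (j := 0) (by decide) (e, b, true, s)).symm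
  have h2 : ∀ b o s, cellVert (ribbonGlue R) 2 (e, b, o, s) =
      cellVert (ribbonGlue R) 2 (e, b, !o, s) := fun b o s =>
    (cellVert_apply (σ := ribbonGlue R) (i := 2) (j := 1) (by decide) (e, b, o, s)).symm
  have h3 : ∀ b s, cellVert (ribbonGlue R) 2 (e, b, false, s) =
      cellVert (ribbonGlue R) 2 (e, !b, false, s) := fun b s =>
    (cellVert_apply (σ := ribbonGlue R) (i := 2) (j := 0) (by decide) (e, b, false, s)).symm
  have key : ∀ b o s, cellVert (ribbonGlue R) 2 (e, b, o, s) =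
      cellVert (ribbonGlue R) 2 (e, true, true, true) := by
    have ho : ∀ b o s, cellVert (ribbonGlue R) 2 (e, b, o, s) =
        cellVert (ribbonGlue R) 2 (e, b, true, s) := by
      intro b o s
      cases o
      exacts [h2 b false s, rfl]
    have hs : ∀ b s, cellVert (ribbonGlue R) 2 (e, b, true, s) =
        cellVert (ribbonGlue R) 2 (e, b, true, true) := by
      intro b s
      cases s
      exacts [h1 b false, rfl]
    intro b o s
    rw [ho, hs]
    cases b
    · rw [h2, Bool.not_true, h3, Bool.not_false, ho]
    · rfl
  rw [key, key b' o' s']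

theorem quot_vert_eq {Z : Type*} {i : Fin 3} (f : ι × Bool × Bool × Bool → Z)
    (hf : ∀ x j, j ≠ i → f (ribbonGlue R j x) = f x) {x y : ι × Bool × Bool × Bool}
    (h : cellVert (ribbonGlue R) i x = cellVert (ribbonGlue R) i y) : f x = f y := by
  have := eq_of_heq (Cell.vert.inj h).2
  exact congrArg (Quot.lift f (by rintro x _ ⟨j, hj, rfl⟩; exact (hf x j hj).symm)) this

theorem cellVert_two_inj {x y : ι × Bool × Bool × Bool}
    (h : cellVert (ribbonGlue R) 2 x = cellVert (ribbonGlue R) 2 y) : x.1 = y.1 := by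
  refine quot_vert_eq Prod.fst (fun x j hj => ?_) h
  obtain ⟨e, b, o, s⟩ := x
  fin_cases j
  · cases o <;> rfl
  · rfl
  · exact absurd rfl hj

theorem cellEdge_zero_eq_iff {e e' : ι} {b b' s s' : Bool} :
    cellEdge (ribbonGlue R) 0 (e, b, true, s) = cellEdge (ribbonGlue R) 0 (e', b', true, s') ↔
      e = e' ∧ b = b' := by
  rw [cellEdge_eq_iff ribbonGlue_involutive]
  cases s <;> cases s' <;> simp [ribbonGlue, eq_comm]

/-- The head or the tail of an edge. -/
def edgeEnd (hd tl : ι → α) (e : ι) (b : Bool) : α := if b then hd e else tl e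

/-- `R o s` prescribes how the strip along an edge continues on the side `s`: at the vertices of
the graph (`o = true`) or across the slits (`o = false`). -/
structure IsRibbon (hd tl : ι → α) (R : Bool → Bool → Equiv.Perm ι) : Prop where
  tail_eq : ∀ s e, tl (R true s e) = hd e
  sameCycle_head : ∀ e e', hd e = hd e' →
    (((R true false)⁻¹ * R true true : Equiv.Perm ι)).SameCycle e e'
  sameCycle_slit : ∀ s e e', (R false s).SameCycle e e'

variable {hd tl : ι → α}

theorem cellVert_one_inj (hR : IsRibbon hd tl R) {e e' : ι} {b b' s s' : Bool}
    (h : cellVert (ribbonGlue R) 1 (e, b, true, s) = cellVert (ribbonGlue R) 1 (e', b', true, s')) :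
    edgeEnd hd tl e b = edgeEnd hd tl e' b' := by
  -- For `o = false` the gluing of colour 0 exchanges the two halves of `e`, so the end is no
  -- invariant there; the value `none` is harmless because the gluings of colours 0 and 2 preserve
  -- `o`.
  have := quot_vert_eq (fun x => if x.2.2.1 then some (edgeEnd hd tl x.1 x.2.1) else none)
    (fun x j hj => ?_) h
  · simpa using this
  · obtain ⟨e, b, o, s⟩ := x
    fin_cases j
    · cases o <;> rfl
    · exact absurd rfl hj
    · cases o <;> cases b <;> simp [ribbonGlue, edgeEnd, hR.tail_eq, ← hR.tail_eq s ((R true s).symm e)]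

theorem cellVert_one_side (e : ι) (b s s' : Bool) :
    cellVert (ribbonGlue R) 1 (e, b, true, s) = cellVert (ribbonGlue R) 1 (e, b, true, s') := by
  have h : ∀ s, cellVert (ribbonGlue R) 1 (e, b, true, s) =
      cellVert (ribbonGlue R) 1 (e, b, true, !s) := fun s =>
    (cellVert_apply (σ := ribbonGlue R) (i := 1) (j := 0) (by decide) (e, b, true, s)).symm
  cases s <;> cases s'
  exacts [rfl, h false, h true, rfl]

theorem cellVert_one_next (e : ι) (s : Bool) :
    cellVert (ribbonGlue R) 1 (R true s e, false, true, s) =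
      cellVert (ribbonGlue R) 1 (e, true, true, s) :=
  cellVert_apply (σ := ribbonGlue R) (i := 1) (j := 2) (by decide) (e, true, true, s)

theorem sameCycle_induction [Finite ι] {κ : Equiv.Perm ι} {r : ι → ι → Prop}
    (hrefl : ∀ e, r e e) (htrans : ∀ e e', r e e' → r e (κ e')) {e e' : ι}
    (h : κ.SameCycle e e') : r e e' := by
  obtain ⟨n, rfl⟩ := h.exists_nat_pow_eq
  induction n with
  | zero => exact hrefl e
  | succ n ih =>
    rw [pow_succ', Equiv.Perm.mul_apply]
    exact htrans _ _ (ih ⟨n, by simp⟩)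

/-- Turning around a vertex leads from the head of `e` to the tail of `R true true e` on one side,
then across that edge and back on the other side to the head of `(R true false)⁻¹ (R true true e)`.
By `sameCycle_head` this reaches all heads at the vertex, and each tail is next to a head. -/
theorem cellVert_one_eq [Finite ι] (hR : IsRibbon hd tl R) {e e' : ι} {b b' : Bool} (s s' : Bool)
    (h : edgeEnd hd tl e b = edgeEnd hd tl e' b') :
    cellVert (ribbonGlue R) 1 (e, b, true, s) = cellVert (ribbonGlue R) 1 (e', b', true, s') := by
  have hhead : ∀ e e', hd e = hd e' → cellVert (ribbonGlue R) 1 (e, true, true, true) =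
      cellVert (ribbonGlue R) 1 (e', true, true, true) := by
    intro e e' h
    refine sameCycle_induction (r := fun e e' => cellVert (ribbonGlue R) 1 (e, true, true, true) =
      cellVert (ribbonGlue R) 1 (e', true, true, true)) (fun _ => rfl)
      (fun e e' h => h.trans ?_) (hR.sameCycle_head e e' h)
    rw [← cellVert_one_next, cellVert_one_side _ _ true false,
      cellVert_one_side (((R true false)⁻¹ * R true true : Equiv.Perm ι) e') true true false,
      ← cellVert_one_next (s := false)]
    simp
  have hto : ∀ e b s, ∃ f, hd f = edgeEnd hd tl e b ∧
      cellVert (ribbonGlue R) 1 (e, b, true, s) =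
        cellVert (ribbonGlue R) 1 (f, true, true, true) := by
    intro e b s
    cases b
    · refine ⟨(R true true).symm e, ?_, ?_⟩
      · rw [← hR.tail_eq true]; simp [edgeEnd]
      · rw [← cellVert_one_next, cellVert_one_side _ _ s true]; simp
    · exact ⟨e, by simp [edgeEnd], cellVert_one_side _ _ _ _⟩
  obtain ⟨f, hf, h1⟩ := hto e b s
  obtain ⟨f', hf', h2⟩ := hto e' b' s'
  rw [h1, h2]
  exact hhead f f' (by rw [hf, hf', h])

/-- A step between adjacent triangles on the same side of the graph. -/
def SideStep (R : Bool → Bool → Equiv.Perm ι) (s : Bool) (x y : ι × Bool × Bool × Bool) : Prop :=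
  y.2.2.2 = s ∧ ∃ j, edgeColor j x = some s ∧ y = ribbonGlue R j x

/-- Without crossing the graph, colour 1 changes `o`, colour 0 changes the half of the edge at a
slit, and colour 2 at the slits runs through all edges, because `R false s` is transitive. -/
theorem sideStep_connected [Finite ι] (hR : IsRibbon hd tl R) {s : Bool}
    {x y : ι × Bool × Bool × Bool} (hx : x.2.2.2 = s) (hy : y.2.2.2 = s) :
    Relation.ReflTransGen (SideStep R s) x y := by
  obtain ⟨e, b, o, _⟩ := x
  obtain ⟨e', b', o', _⟩ := y
  obtain rfl : _ = s := hx
  obtain rfl : _ = _ := hy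
  rename_i s
  have h0 : ∀ e b, SideStep R s (e, b, false, s) (e, !b, false, s) := fun e b =>
    ⟨rfl, 0, by simp [edgeColor], rfl⟩
  have h1 : ∀ e b o, SideStep R s (e, b, o, s) (e, b, !o, s) := fun e b o =>
    ⟨rfl, 1, by simp [edgeColor], rfl⟩
  have h2 : ∀ e, SideStep R s (e, true, false, s) (R false s e, false, false, s) := fun e =>
    ⟨rfl, 2, by simp [edgeColor], rfl⟩
  have hb : ∀ e b b', Relation.ReflTransGen (SideStep R s) (e, b, false, s) (e, b', false, s) := by
    intro e b b'
    cases b <;> cases b'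
    exacts [.refl, .single (h0 e false), .single (h0 e true), .refl]
  have ho : ∀ e b o o', Relation.ReflTransGen (SideStep R s) (e, b, o, s) (e, b, o', s) := by
    intro e b o o'
    cases o <;> cases o'
    exacts [.refl, .single (h1 e b false), .single (h1 e b true), .refl]
  have he : Relation.ReflTransGen (SideStep R s) (e, true, false, s) (e', true, false, s) := by
    refine sameCycle_induction
      (r := fun e e' => Relation.ReflTransGen (SideStep R s) (e, true, false, s) (e', true, false, s))
      (fun _ => .refl) (fun e e' h => h.trans (.head (h2 e') (hb _ _ _)))
      (hR.sameCycle_slit s e e')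
  exact (ho e b o false).trans ((hb e b true).trans (he.trans ((hb e' true b').trans
    (ho e' b' false o'))))

/-- Each side is connected, and the gluing of colour 0 along an edge of the graph crosses to the
other side. -/
theorem ribbonGlue_connected [Finite ι] (hR : IsRibbon hd tl R)
    (x y : ι × Bool × Bool × Bool) :
    Relation.ReflTransGen (fun x y => ∃ j, y = ribbonGlue R j x) x y := by
  have hside : ∀ x y : ι × Bool × Bool × Bool, x.2.2.2 = y.2.2.2 →
      Relation.ReflTransGen (fun x y => ∃ j, y = ribbonGlue R j x) x y := fun x y h =>
    Relation.ReflTransGen.mono (fun _ _ ⟨_, j, _, hj⟩ => ⟨j, hj⟩) _ _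
      (sideStep_connected hR h rfl)
  obtain ⟨e, b, o, s⟩ := x
  by_cases h : s = y.2.2.2
  · exact hside _ _ h
  · refine (hside (e, b, o, s) (e, true, true, s) rfl).trans (.head ⟨0, rfl⟩ (hside _ _ ?_))
    change (!s) = y.2.2.2
    revert h
    generalize y.2.2.2 = t
    cases s <;> cases t <;> simp

theorem connected_color [Finite ι] (hR : IsRibbon hd tl R) {s : Bool}
    {a b : Cell (ribbonGlue R)} (ha : cellColor a = some s) (hb : cellColor b = some s) :
    Relation.ReflTransGen (fun a b => cellColor b = some s ∧
      ∃ x i j, i ≠ j ∧ OnFlag x i j a ∧ OnFlag x i j b) a b := by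
  classical
  have := connected_cells (B := fun c : Cell (ribbonGlue R) => cellColor c = some s) ?_ ?_ ha hb
  · refine Relation.ReflTransGen.mono (fun _ _ h => ⟨h.1, pair_mem_gemComplex.1 ?_⟩) _ _ this
    convert h.2
  · intro c hc
    obtain ⟨-, x, i, j, hij, hx⟩ := singleton_mem_gemComplex c
    have hcx := hx c (by simp)
    exact ⟨x, by rw [cellColor_tri, color_of_onFlag hcx hc], i, j, hij, hcx⟩
  · intro x y hx hy
    refine Relation.ReflTransGen.mono (fun z w h => ?_) _ _
      (sideStep_connected hR (s := s) (Option.some.inj hx) (Option.some.inj hy))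
    exact ⟨congrArg some h.1, h.2⟩

/-- The faces on the graph. -/
theorem exists_of_color_none {f : Finset (Cell (ribbonGlue R))}
    (hf : f ∈ (gemComplex (ribbonGlue R)).faces) (hc : ∀ c ∈ f, cellColor c = none) :
    ∃ e b i, (i = 1 ∨ i = 2) ∧ ∀ s, ∀ c ∈ f, c = cellVert (ribbonGlue R) i (e, b, true, s) ∨
      c = cellEdge (ribbonGlue R) 0 (e, b, true, s) := by
  obtain ⟨⟨c₀, hc₀⟩, ⟨e, b, o, s₀⟩, i, j, hij, hx⟩ := hf
  have hcases : ∀ c ∈ f, (c = cellVert (ribbonGlue R) i (e, b, o, s₀) ∧ (i = 2 ∨ (i = 1 ∧ o = true))) ∨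
      (c = cellEdge (ribbonGlue R) j (e, b, o, s₀) ∧ j = 0 ∧ o = true) := by
    intro c hcf
    have hcol := hc c hcf
    rcases hx c hcf with rfl | rfl | rfl
    · left
      rw [cellColor_vert, vertColor] at hcol
      split_ifs at hcol with h
      exact ⟨rfl, h⟩
    · right
      rw [cellColor_edge, edgeColor] at hcol
      split_ifs at hcol with h
      exact ⟨rfl, h⟩
    · simp [cellColor_tri] at hcol
  have hvert : ∀ s, (i = 2 ∨ (i = 1 ∧ o = true)) → cellVert (ribbonGlue R) i (e, b, o, s₀) =
      cellVert (ribbonGlue R) i (e, b, true, s) := by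
    rintro s (rfl | ⟨rfl, rfl⟩)
    · exact cellVert_two_eq _ _ _ _ _ _ _
    · exact cellVert_one_side _ _ _ _
  by_cases hedge : ∃ c ∈ f, c = cellEdge (ribbonGlue R) j (e, b, o, s₀)
  · obtain ⟨c, hcf, rfl⟩ := hedge
    rcases hcases _ hcf with ⟨h, -⟩ | ⟨-, rfl, rfl⟩
    · exact absurd h edge_ne_vert
    · refine ⟨e, b, i, ?_, fun s c hcf => ?_⟩
      · clear hcases hvert hx hcf
        revert i
        decide
      · rcases hcases c hcf with ⟨rfl, h⟩ | ⟨rfl, -, -⟩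
        · exact Or.inl (hvert s h)
        · exact Or.inr (cellEdge_zero_eq_iff.2 ⟨rfl, rfl⟩)
  · have hv : ∀ c ∈ f, c = cellVert (ribbonGlue R) i (e, b, o, s₀) ∧
        (i = 2 ∨ (i = 1 ∧ o = true)) := fun c hcf =>
      (hcases c hcf).resolve_right fun h => hedge ⟨c, hcf, h.1⟩
    refine ⟨e, b, i, ?_, fun s c hcf => Or.inl ?_⟩
    · rcases (hv c₀ hc₀).2 with h | h
      exacts [Or.inr h, Or.inl h.1]
    · rw [(hv c hcf).1]
      exact hvert s (hv c hcf).2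

end Ribbon

end MinSep

namespace MinSep

/-! ### The graph as a minimal separating subcomplex -/

section Sides

variable {ι α E : Type*} [NormedAddCommGroup E] [NormedSpace ℝ E]
  {R : Bool → Bool → Equiv.Perm ι} {hd tl : ι → α}
  {K : Geometry.SimplicialComplex ℝ E} {p : Cell (ribbonGlue R) ↪ E}

/-- The graph on a ribbon surface. -/
def ribbonCore (K : Geometry.SimplicialComplex ℝ E) (p : Cell (ribbonGlue R) ↪ E) : Set K.space :=
  {y | ∀ c, p c ∈ carrier y → cellColor c = none}

/-- One side of the graph on a ribbon surface. -/
def ribbonSide (K : Geometry.SimplicialComplex ℝ E) (p : Cell (ribbonGlue R) ↪ E) (s : Bool) :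
    Set K.space :=
  neighborhood K (p '' {c | cellColor c = some s})

theorem mem_ribbonSide {s : Bool} {y : K.space} :
    y ∈ ribbonSide K p s ↔ ∃ c, p c ∈ carrier y ∧ cellColor c = some s := by
  constructor
  · rintro ⟨_, ⟨c, hc, rfl⟩, h⟩
    exact ⟨c, h, hc⟩
  · rintro ⟨c, h, hc⟩
    exact ⟨_, ⟨c, hc, rfl⟩, h⟩

theorem ribbonSide_union : ribbonSide K p true ∪ ribbonSide K p false = (ribbonCore K p)ᶜ := by
  ext y
  simp only [Set.mem_union, mem_ribbonSide, Set.mem_compl_iff, ribbonCore, Set.mem_ofPred_eq,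
    not_forall]
  constructor
  · rintro (⟨c, h, hc⟩ | ⟨c, h, hc⟩) <;> exact ⟨c, h, by simp [hc]⟩
  · rintro ⟨c, h, hc⟩
    obtain ⟨s, hs⟩ := Option.ne_none_iff_exists'.1 hc
    cases s
    exacts [Or.inr ⟨c, h, hs⟩, Or.inl ⟨c, h, hs⟩]

/-- Every coloured corner of a small triangle has the colour of the triangle itself, so no carrier
meets both colours. -/
theorem ribbonSide_disjoint (h : IsRealization (gemComplex (ribbonGlue R)) K p) :
    Disjoint (ribbonSide K p true) (ribbonSide K p false) := by
  rw [Set.disjoint_left]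
  intro y hy hy'
  obtain ⟨c, hc, hcol⟩ := mem_ribbonSide.1 hy
  obtain ⟨d, hd, hdol⟩ := mem_ribbonSide.1 hy'
  obtain ⟨f, ⟨-, x, i, j, -, hf⟩, hfy⟩ := (h _).1 (carrier_mem_faces y)
  rw [← hfy, Finset.mem_map' p] at hc hd
  have h1 := color_of_onFlag (hf c hc) hcol
  have h2 := color_of_onFlag (hf d hd) hdol
  rw [h1] at h2
  exact absurd h2 (by decide)

theorem ribbonSide_isPathConnected [Finite ι] [Nonempty ι]
    (h : IsRealization (gemComplex (ribbonGlue R)) K p) (hR : IsRibbon hd tl R) (s : Bool) :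
    IsPathConnected (ribbonSide K p s) := by
  classical
  refine isPathConnected_neighborhood ?_ ?_ ?_
  · rintro _ ⟨c, -, rfl⟩
    exact h.singleton_mem_faces.2 (singleton_mem_gemComplex c)
  · exact ⟨_, cellTri _ (Classical.arbitrary ι, true, true, s), rfl, rfl⟩
  · rintro _ ⟨a, ha, rfl⟩ _ ⟨b, hb, rfl⟩
    refine (connected_color hR ha hb).lift p fun c d hcd => ⟨⟨d, hcd.1, rfl⟩, ?_⟩
    have := h.pair_mem_faces.2 (pair_mem_gemComplex.2 hcd.2)
    convert this

theorem exists_of_mem_ribbonCore (h : IsRealization (gemComplex (ribbonGlue R)) K p)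
    {y : K.space} (hy : y ∈ ribbonCore K p) :
    ∃ e b i, (i = 1 ∨ i = 2) ∧ ∀ s, ∀ v ∈ carrier y,
      v = p (cellVert (ribbonGlue R) i (e, b, true, s)) ∨
      v = p (cellEdge (ribbonGlue R) 0 (e, b, true, s)) := by
  obtain ⟨f, hf, hfy⟩ := (h _).1 (carrier_mem_faces y)
  obtain ⟨e, b, i, hi, hc⟩ := exists_of_color_none hf fun c hc =>
    hy c (hfy ▸ (Finset.mem_map' p).2 hc)
  refine ⟨e, b, i, hi, fun s v hv => ?_⟩
  rw [← hfy] at hv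
  obtain ⟨c, hcf, rfl⟩ := Finset.mem_map.1 hv
  exact (hc s c hcf).imp (congrArg p) (congrArg p)

/-- A face on the graph borders a small triangle on each side, and the open star of that triangle
lies in the side. -/
theorem ribbonCore_subset_closure (h : IsRealization (gemComplex (ribbonGlue R)) K p) (s : Bool) :
    ribbonCore K p ⊆ closure (ribbonSide K p s) := by
  classical
  intro y hy
  obtain ⟨e, b, i, hi, hc⟩ := exists_of_mem_ribbonCore h hy
  have hi0 : i ≠ 0 := by rcases hi with rfl | rfl <;> decide
  have htri := (isTri_flag (σ := ribbonGlue R) hi0 (e, b, true, s)).2.2.2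
  have hface := h.triple_mem_faces.2 htri
  refine closure_mono ?_ (mem_closure_openStar hface (x := y) fun v hv => ?_)
  · intro z hz
    exact mem_ribbonSide.2 ⟨cellTri _ (e, b, true, s), hz (by simp), rfl⟩
  · rcases hc s v hv with rfl | rfl <;> simp

theorem ribbonCore_isMinimalSeparatingSet [Finite ι] [Nonempty ι]
    (h : IsRealization (gemComplex (ribbonGlue R)) K p) (hR : IsRibbon hd tl R) :
    IsMinimalSeparatingSet (ribbonCore K p) := by
  have hpc := ribbonSide_isPathConnected h hR
  exact isMinimalSeparatingSet_of_closure (isOpen_neighborhood h.finite_faces _)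
    (isOpen_neighborhood h.finite_faces _) ribbonSide_union (ribbonSide_disjoint h)
    (hpc true).nonempty (hpc false).nonempty (hpc true).isConnected.isPreconnected
    (hpc false).isConnected.isPreconnected (ribbonCore_subset_closure h true)
    (ribbonCore_subset_closure h false)

theorem ribbonCore_isOneSubcomplex (h : IsRealization (gemComplex (ribbonGlue R)) K p) :
    IsOneSubcomplex K (ribbonCore K p) := by
  classical
  refine ⟨{t | t ∈ K.faces ∧ ∀ c, p c ∈ t → cellColor c = none}, fun t ht => ht.1, ?_, ?_⟩
  · rintro t ⟨ht, hc⟩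
    obtain ⟨f, hf, rfl⟩ := (h t).1 ht
    obtain ⟨e, b, i, -, hsub⟩ := exists_of_color_none hf fun c hcf =>
      hc c ((Finset.mem_map' p).2 hcf)
    rw [Finset.card_map]
    refine (Finset.card_le_card (t := {cellVert (ribbonGlue R) i (e, b, true, true),
      cellEdge (ribbonGlue R) 0 (e, b, true, true)}) fun c hcf => ?_).trans Finset.card_le_two
    simpa using hsub true c hcf
  · ext x
    simp only [Set.mem_image, Set.mem_iUnion, exists_prop]
    constructor
    · rintro ⟨y, hy, rfl⟩
      exact ⟨carrier y, ⟨carrier_mem_faces y, hy⟩, (isCoord y).mem_convexHull subset_rfl⟩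
    · rintro ⟨t, ⟨ht, hc⟩, hx⟩
      refine ⟨⟨x, Geometry.SimplicialComplex.convexHull_subset_space ht hx⟩, ?_, rfl⟩
      intro c hcx
      exact hc c ((mem_convexHull_iff_carrier_subset ht).1 hx hcx)

/-- The corners of the polygonal arc along the edge `e`. -/
def corner (R : Bool → Bool → Equiv.Perm ι) (e : ι) : ℕ → Cell (ribbonGlue R)
  | 0 => cellVert _ 1 (e, false, true, false)
  | 1 => cellEdge _ 0 (e, false, true, false)
  | 2 => cellVert _ 2 (e, false, true, false)
  | 3 => cellEdge _ 0 (e, true, true, false)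
  | _ => cellVert _ 1 (e, true, true, false)

theorem corner_color (e : ι) (k : ℕ) : cellColor (corner R e k) = none := by
  match k with
  | 0 | 1 | 2 | 3 | _ + 4 => rfl

theorem corner_two (e : ι) : corner R e 2 = cellVert _ 2 (e, true, true, false) :=
  cellVert_two_eq _ _ _ _ _ _ _

theorem corner_inj {e f : ι} {k l : ℕ} (hk : 1 ≤ k) (hk' : k ≤ 3) (hl : l < 5)
    (h : corner R e k = corner R f l) : e = f ∧ k = l := by
  interval_cases k <;> interval_cases l <;> simp only [corner] at h <;>
    first
    | exact absurd h edge_ne_vert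
    | exact absurd h.symm edge_ne_vert
    | exact absurd (cellVert_color h) (by decide)
    | exact ⟨cellVert_two_inj h, rfl⟩
    | (obtain ⟨rfl, hb⟩ := cellEdge_zero_eq_iff.1 h
       first | exact ⟨rfl, rfl⟩ | exact absurd hb (by decide))

theorem corner_ne_vert {e : ι} {k : ℕ} (hk : 1 ≤ k) (hk' : k ≤ 3) (x : ι × Bool × Bool × Bool) :
    corner R e k ≠ cellVert _ 1 x := by
  intro h
  interval_cases k <;> simp only [corner] at h <;>
    first
    | exact absurd h edge_ne_vert
    | exact absurd (cellVert_color h) (by decide)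

theorem isPolygon_corner (h : IsRealization (gemComplex (ribbonGlue R)) K p) (e : ι) :
    IsPolygon K fun k => p (corner R e k) := by
  classical
  intro m hm
  have hedge : ∀ {a b : Cell (ribbonGlue R)}, a ≠ b →
      (∃ x i j, i ≠ j ∧ OnFlag x i j a ∧ OnFlag x i j b) → p a ≠ p b ∧ {p a, p b} ∈ K.faces :=
    fun hab hx => ⟨p.injective.ne hab, h.pair_mem_faces.2 (pair_mem_gemComplex.2 hx)⟩
  have key := hedge (a := corner R e m) (b := corner R e (m + 1)) ?_ ?_
  · exact ⟨key.1, by convert key.2⟩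
  · intro heq
    by_cases hm0 : 1 ≤ m
    · have := (corner_inj hm0 (by omega) (by omega) heq).2
      omega
    · have := (corner_inj (by omega) (by omega) (by omega) heq.symm).2
      omega
  · interval_cases m
    · exact ⟨(e, false, true, false), 1, 0, by decide, by simp [corner, OnFlag],
        by simp [corner, OnFlag]⟩
    · exact ⟨(e, false, true, false), 2, 0, by decide, by simp [corner, OnFlag],
        by simp [corner, OnFlag]⟩
    · exact ⟨(e, true, true, false), 2, 0, by decide, by simp [corner_two, OnFlag],
        by simp [corner, OnFlag]⟩
    · exact ⟨(e, true, true, false), 1, 0, by decide, by simp [corner, OnFlag],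
        by simp [corner, OnFlag]⟩

theorem polygon_mem_ribbonCore (h : IsRealization (gemComplex (ribbonGlue R)) K p) (e : ι)
    (t : unitInterval) : polygon (isPolygon_corner h e) t ∈ ribbonCore K p := by
  classical
  intro c hc
  obtain ⟨m, -, hm⟩ := carrier_polygon (isPolygon_corner h e) t
  have := hm hc
  simp only [Finset.mem_insert, Finset.mem_singleton, p.injective.eq_iff] at this
  rcases this with rfl | rfl <;> exact corner_color _ _

theorem exists_polygon_of_mem_ribbonCore (h : IsRealization (gemComplex (ribbonGlue R)) K p)
    {y : K.space} (hy : y ∈ ribbonCore K p) :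
    ∃ e t, polygon (isPolygon_corner h e) t = y := by
  classical
  obtain ⟨e, b, i, hi, hc⟩ := exists_of_mem_ribbonCore h hy
  have key : ∀ m < 4, (∀ v ∈ carrier y, v = p (corner R e m) ∨ v = p (corner R e (m + 1))) →
      ∃ e t, polygon (isPolygon_corner h e) t = y := fun m hm hv =>
    ⟨e, exists_polygon_eq (isPolygon_corner h e) hm fun v hvy => by
      simp only [Finset.mem_insert, Finset.mem_singleton]
      exact hv v hvy⟩
  rcases hi with rfl | rfl <;> cases b
  · exact key 0 (by norm_num) fun v hv => hc false v hv
  · exact key 3 (by norm_num) fun v hv => (hc false v hv).symm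
  · exact key 1 (by norm_num) fun v hv => (hc false v hv).symm
  · exact key 2 (by norm_num) fun v hv => by
      rw [corner_two]
      exact hc false v hv

/-- An inner corner belongs to one edge only and is no vertex of the graph, so it shows that
interior points of an arc avoid all vertices and other arcs. -/
theorem exists_corner_pos (h : IsRealization (gemComplex (ribbonGlue R)) K p) (e : ι)
    {t : unitInterval} (ht : t ∈ Set.Ioo (0 : unitInterval) 1) :
    ∃ k, 1 ≤ k ∧ k ≤ 3 ∧ p (corner R e k) ∈ carrier (polygon (isPolygon_corner h e) t) := by
  have h0 : 0 < (t : ℝ) := ht.1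
  have h1 : (t : ℝ) < 1 := ht.2
  obtain ⟨k, hk, hk', hpos⟩ := exists_hat_pos (u := 4 * (t : ℝ)) (by linarith) (by linarith)
  refine ⟨k, hk, hk', mem_carrier.2 ?_⟩
  rwa [coord_polygon_corner (q := fun k => p (corner R e k)) (isPolygon_corner h e) t
    (by omega) fun l hl hkl => (corner_inj hk hk' hl (p.injective hkl)).2]

theorem vertex_mem_faces (h : IsRealization (gemComplex (ribbonGlue R)) K p)
    (c : Cell (ribbonGlue R)) : {p c} ∈ K.faces :=
  h.singleton_mem_faces.2 (singleton_mem_gemComplex c)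

end Sides

/-! ### Embedding the graph in its ribbon surface -/

section Drawing

variable {α β E : Type*} [NormedAddCommGroup E] [NormedSpace ℝ E] {G : Graph α β}
  {R : Bool → Bool → Equiv.Perm G.edgeSet} {hd tl : G.edgeSet → α}
  {K : Geometry.SimplicialComplex ℝ E} {p : Cell (ribbonGlue R) ↪ E}

open scoped Classical in
/-- The point of a vertex of the graph on its ribbon surface. -/
noncomputable def ribbonVert [Nonempty K.space]
    (h : IsRealization (gemComplex (ribbonGlue R)) K p) (hd : G.edgeSet → α) (v : α) :
    K.space :=
  if hv : ∃ e, hd e = v then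
    vertexPoint (vertex_mem_faces h (cellVert _ 1 (hv.choose, true, true, false)))
  else Classical.arbitrary _

open scoped Classical in
/-- The arc of an edge of the graph on its ribbon surface. -/
noncomputable def ribbonArc [Nonempty K.space]
    (h : IsRealization (gemComplex (ribbonGlue R)) K p) (e : β) (t : unitInterval) : K.space :=
  if he : e ∈ G.edgeSet then polygon (isPolygon_corner h ⟨e, he⟩) t else Classical.arbitrary _

variable [Nonempty K.space] (h : IsRealization (gemComplex (ribbonGlue R)) K p)

theorem ribbonArc_eq (e : G.edgeSet) :
    ribbonArc h e.1 = polygon (isPolygon_corner h e) := by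
  ext1 t
  simp [ribbonArc]

theorem ribbonVert_eq [Finite G.edgeSet] (hR : IsRibbon hd tl R) (e : G.edgeSet) (b : Bool) :
    (ribbonVert h hd (edgeEnd hd tl e b)).1 = p (cellVert _ 1 (e, b, true, false)) := by
  have hv : ∃ f, hd f = edgeEnd hd tl e b := by
    cases b
    · exact ⟨(R true true).symm e, by rw [← hR.tail_eq true]; simp [edgeEnd]⟩
    · exact ⟨e, rfl⟩
  rw [ribbonVert, dif_pos hv]
  exact congrArg p (cellVert_one_eq hR false false hv.choose_spec)

/-- The graph drawn on its ribbon surface. -/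
noncomputable def ribbonEmbedding [Finite G.edgeSet] (hR : IsRibbon hd tl R)
    (hlink : ∀ e, G.IsLink e.1 (tl e) (hd e)) (hsurj : ∀ v ∈ G.vertexSet, ∃ e, hd e = v) :
    GraphEmbedding G K.space where
  vert := ribbonVert h hd
  arc := ribbonArc h
  vert_injOn := by
    intro v hv w hw hvw
    obtain ⟨e, rfl⟩ := hsurj v hv
    obtain ⟨f, rfl⟩ := hsurj w hw
    have := congrArg Subtype.val hvw
    rw [show hd e = edgeEnd hd tl e true from rfl, show hd f = edgeEnd hd tl f true from rfl,
      ribbonVert_eq h hR, ribbonVert_eq h hR] at this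
    exact cellVert_one_inj hR (p.injective this)
  arc_continuous e he := by
    rw [ribbonArc_eq h ⟨e, he⟩]
    exact polygon_continuous _
  arc_ends e x y hxy := by
    have he := hxy.edge_mem
    have h0 : ribbonArc h e 0 = ribbonVert h hd (tl ⟨e, he⟩) := by
      rw [ribbonArc_eq h ⟨e, he⟩, show tl ⟨e, he⟩ = edgeEnd hd tl ⟨e, he⟩ false from rfl]
      refine Subtype.ext ?_
      rw [ribbonVert_eq h hR, polygon_zero]
      rfl
    have h1 : ribbonArc h e 1 = ribbonVert h hd (hd ⟨e, he⟩) := by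
      rw [ribbonArc_eq h ⟨e, he⟩, show hd ⟨e, he⟩ = edgeEnd hd tl ⟨e, he⟩ true from rfl]
      refine Subtype.ext ?_
      rw [ribbonVert_eq h hR, polygon_one]
      rfl
    rcases (hlink ⟨e, he⟩).eq_and_eq_or_eq_and_eq hxy with ⟨rfl, rfl⟩ | ⟨rfl, rfl⟩
    exacts [Or.inl ⟨h0, h1⟩, Or.inr ⟨h0, h1⟩]
  arc_simple e he s t hst := by
    rw [ribbonArc_eq h ⟨e, he⟩] at hst
    exact polygon_simple _ (fun k l hk hk' hl hkl => (corner_inj hk hk' hl (p.injective hkl)).2) hst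
  vert_ne_arc e he v hv t ht heq := by
    obtain ⟨f, rfl⟩ := hsurj v hv
    rw [ribbonArc_eq h ⟨e, he⟩] at heq
    obtain ⟨k, hk, hk', hmem⟩ := exists_corner_pos h ⟨e, he⟩ ht
    have hvert : ribbonVert h hd (hd f) =
        vertexPoint (vertex_mem_faces h (cellVert _ 1 (f, true, true, false))) :=
      Subtype.ext (ribbonVert_eq h hR f true)
    rw [← heq, hvert, carrier_vertexPoint, Finset.mem_singleton] at hmem
    exact corner_ne_vert hk hk' _ (p.injective hmem)
  arc_ne_arc e he f hf hef s hs t heq := by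
    classical
    rw [ribbonArc_eq h ⟨e, he⟩, ribbonArc_eq h ⟨f, hf⟩] at heq
    obtain ⟨k, hk, hk', hmem⟩ := exists_corner_pos h ⟨e, he⟩ hs
    obtain ⟨m, hm, hsub⟩ := carrier_polygon (isPolygon_corner h ⟨f, hf⟩) t
    rw [heq] at hmem
    have := hsub hmem
    simp only [Finset.mem_insert, Finset.mem_singleton, p.injective.eq_iff] at this
    rcases this with h' | h' <;>
      exact hef (congrArg Subtype.val (corner_inj hk hk' (by omega) h').1)

theorem ribbonEmbedding_image [Finite G.edgeSet] (hR : IsRibbon hd tl R)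
    (hlink : ∀ e, G.IsLink e.1 (tl e) (hd e)) (hsurj : ∀ v ∈ G.vertexSet, ∃ e, hd e = v) :
    (ribbonEmbedding h hR hlink hsurj).image = ribbonCore K p := by
  apply Set.Subset.antisymm
  · rintro y (⟨v, hv, rfl⟩ | hy)
    · obtain ⟨e, rfl⟩ := hsurj v hv
      have hvert : ribbonVert h hd (hd e) =
          vertexPoint (vertex_mem_faces h (cellVert _ 1 (e, true, true, false))) :=
        Subtype.ext (ribbonVert_eq h hR e true)
      change ribbonVert h hd (hd e) ∈ _
      rw [hvert]
      intro c hc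
      rw [carrier_vertexPoint, Finset.mem_singleton, p.injective.eq_iff] at hc
      rw [hc]
      rfl
    · simp only [Set.mem_iUnion] at hy
      obtain ⟨e, he, t, rfl⟩ := hy
      change ribbonArc h e t ∈ _
      rw [ribbonArc_eq h ⟨e, he⟩]
      exact polygon_mem_ribbonCore h _ t
  · intro y hy
    obtain ⟨e, t, rfl⟩ := exists_polygon_of_mem_ribbonCore h hy
    refine Or.inr (Set.mem_biUnion e.2 ⟨t, ?_⟩)
    change ribbonArc h e.1 t = _
    rw [ribbonArc_eq]

end Drawing

theorem isMinimalSeparatingGraph_of_isRibbon {α β : Type*} {G : Graph α β}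
    {R : Bool → Bool → Equiv.Perm G.edgeSet} {hd tl : G.edgeSet → α} [Finite G.edgeSet] [Nonempty G.edgeSet]
    (hR : IsRibbon hd tl R) (hlink : ∀ e, G.IsLink e.1 (tl e) (hd e))
    (hsurj : ∀ v ∈ G.vertexSet, ∃ e, hd e = v) : IsMinimalSeparatingGraph G := by
  obtain ⟨n, K, p, h⟩ := exists_isRealization (gemComplex (ribbonGlue R))
  have hK := h.isClosedSurface_gem ribbonGlue_involutive ribbonGlue_ne (ribbonGlue_connected hR)
  have : Nonempty K.space := hK.connected.nonempty.to_subtype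
  refine ⟨n, K, hK, h.isOrientable_gem ribbonGlue_involutive ribbonSign_glue,
    ribbonEmbedding h hR hlink hsurj, ?_, ?_⟩
  · rw [ribbonEmbedding_image]
    exact ribbonCore_isOneSubcomplex h
  · rw [ribbonEmbedding_image]
    exact ribbonCore_isMinimalSeparatingSet h hR

end MinSep

namespace MinSep

/-! ### Permutations and balanced orientations -/

section Permutations

theorem exists_fixedPointFree_involution {F : Type*} [Finite F] (h : Even (Nat.card F)) :
    ∃ τ : F → F, (∀ x, τ (τ x) = x) ∧ ∀ x, τ x ≠ x := by
  obtain ⟨k, hk⟩ := h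
  obtain ⟨e⟩ : Nonempty (F ≃ Fin k × Bool) := (Finite.card_eq).1 (by simp [hk]; ring)
  refine ⟨fun x => e.symm ((e x).1, !(e x).2), fun x => by simp, fun x hx => ?_⟩
  have := congrArg (fun z => (e z).2) hx
  simp at this

theorem exists_involution_of_even_fibers {D A : Type*} [Finite D] (f : D → A)
    (h : ∀ a, Even (Nat.card {d // f d = a})) :
    ∃ τ : D → D, (∀ x, τ (τ x) = x) ∧ (∀ x, τ x ≠ x) ∧ ∀ x, f (τ x) = f x := by
  choose g hg hfix using fun a => exists_fixedPointFree_involution (h a)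
  have key : ∀ a (x : {d // f d = a}), (g (f x.1) ⟨x.1, rfl⟩).1 = (g a x).1 := by
    rintro _ ⟨x, rfl⟩
    rfl
  refine ⟨fun x => (g (f x) ⟨x, rfl⟩).1, fun x => ?_, fun x hx => ?_, fun x => (g (f x) _).2⟩
  · change (g (f (g (f x) ⟨x, rfl⟩).1) ⟨(g (f x) ⟨x, rfl⟩).1, rfl⟩).1 = x
    rw [key, hg]
  · exact hfix _ _ (Subtype.ext hx)

theorem exists_perm_transitive (F : Type*) [Finite F] : ∃ κ : Equiv.Perm F, ∀ x y, κ.SameCycle x y := by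
  rcases isEmpty_or_nonempty F with hF | hF
  · exact ⟨1, fun x => hF.elim x⟩
  have : NeZero (Nat.card F) := ⟨Nat.card_pos.ne'⟩
  obtain ⟨e⟩ : Nonempty (F ≃ ZMod (Nat.card F)) := (Finite.card_eq).1 (by simp)
  let κ : Equiv.Perm F := (e.trans (Equiv.addRight 1)).trans e.symm
  have hpow : ∀ (n : ℕ) x, (κ ^ n) x = e.symm (e x + n) := by
    intro n x
    induction n with
    | zero => simp
    | succ n ih =>
      rw [pow_succ', Equiv.Perm.mul_apply, ih]
      simp [κ, add_assoc]
  refine ⟨κ, fun x y => ⟨((e y - e x).val : ℕ), ?_⟩⟩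
  rw [zpow_natCast, hpow]
  simp

theorem exists_perm_of_fibers {ι A : Type*} [Finite ι] (f : ι → A) :
    ∃ κ : Equiv.Perm ι, (∀ x, f (κ x) = f x) ∧ ∀ x y, f x = f y → κ.SameCycle x y := by
  choose g hg using fun a => exists_perm_transitive {x // f x = a}
  have key : ∀ a (x : {x // f x = a}), (g (f x.1) ⟨x.1, rfl⟩).1 = (g a x).1 := by
    rintro _ ⟨x, rfl⟩
    rfl
  have hf : ∀ x, f (g (f x) ⟨x, rfl⟩).1 = f x := fun x => (g (f x) _).2
  have hinj : Function.Injective fun x => (g (f x) ⟨x, rfl⟩).1 := by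
    intro x y hxy
    have hfxy : f y = f x := by
      rw [← hf x, ← hf y]
      exact congrArg f hxy.symm
    have hxy' : (g (f x) ⟨x, rfl⟩).1 = (g (f x) ⟨y, hfxy⟩).1 := by
      rw [← key _ ⟨y, hfxy⟩]
      exact hxy
    exact congrArg Subtype.val ((g (f x)).injective (Subtype.ext hxy'))
  let κ : Equiv.Perm ι := Equiv.ofBijective _ (Finite.injective_iff_bijective.1 hinj)
  have hκ : ∀ a (x : {x // f x = a}), κ x.1 = (g a x).1 := key
  refine ⟨κ, hf, fun x y hxy => ?_⟩
  obtain ⟨n, hn⟩ := (hg (f y) ⟨x, hxy⟩ ⟨y, rfl⟩).exists_nat_pow_eq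
  have hpow : ∀ n : ℕ, (κ ^ n) x = ((g (f y) ^ n) ⟨x, hxy⟩).1 := by
    intro n
    induction n with
    | zero => rfl
    | succ n ih => rw [pow_succ', pow_succ', Equiv.Perm.mul_apply, Equiv.Perm.mul_apply, ih, hκ]
  exact ⟨n, by rw [zpow_natCast, hpow, hn]⟩

/-- Two fixed-point-free involutions have a common proper two-colouring. -/
theorem exists_two_coloring {D : Type*} [Finite D] {τ θ : D → D} (hτ : ∀ x, τ (τ x) = x)
    (hθ : ∀ x, θ (θ x) = x) (hτ' : ∀ x, τ x ≠ x) (hθ' : ∀ x, θ x ≠ x) :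
    ∃ ε : D → Bool, (∀ x, ε (τ x) = !ε x) ∧ ∀ x, ε (θ x) = !ε x := by
  let t : Equiv.Perm D := ⟨τ, τ, hτ, hτ⟩
  let r : Equiv.Perm D := ⟨θ, θ, hθ, hθ⟩
  let g : Equiv.Perm D := t * r
  have hg : ∀ x, g x = τ (θ x) := fun _ => rfl
  have hr : r * r = 1 := Equiv.ext hθ
  have ht : t * t = 1 := Equiv.ext hτ
  -- The two involutions generate a dihedral action: `r` inverts the rotation `g`.
  have hconj : r * g * r⁻¹ = g⁻¹ := by
    rw [inv_eq_of_mul_eq_one_left hr, eq_inv_iff_mul_eq_one]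
    calc r * (t * r) * r * (t * r) = r * t * (r * r) * t * r := by group
      _ = r * (t * t) * r := by rw [hr]; group
      _ = 1 := by rw [ht, mul_one, hr]
  have hflip : ∀ (k : ℤ) x, (g ^ (-k)) (θ x) = θ ((g ^ k) x) := by
    intro k x
    have : r * g ^ k * r⁻¹ = g ^ (-k) := by rw [← conj_zpow, hconj, inv_zpow, zpow_neg]
    have h2 := Equiv.ext_iff.1 (mul_inv_eq_iff_eq_mul.1 this) x
    exact h2.symm
  -- If `θ x = g ^ k x`, then `θ` fixes `g ^ j x` when `k = 2 * j`, and `τ` fixes `θ (g ^ j x)` when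
  -- `k = 2 * j + 1`. So `θ` exchanges the cycles of `g` in pairs.
  have hnot : ∀ x, ¬ g.SameCycle x (θ x) := by
    rintro x ⟨k, hk⟩
    obtain ⟨j, rfl | rfl⟩ := Int.even_or_odd' k
    · refine hθ' ((g ^ j) x) ?_
      rw [← hflip, ← hk, ← Equiv.Perm.mul_apply, ← zpow_add]
      congr 2
      ring
    · refine hτ' (θ ((g ^ j) x)) ?_
      rw [← hg, ← hflip, ← hk, ← Equiv.Perm.mul_apply, ← Equiv.Perm.mul_apply, ← zpow_one_add,
        ← zpow_add]
      congr 2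
      ring
  have hmap : ∀ x y, g.SameCycle x y → g.SameCycle (θ x) (θ y) := by
    rintro x _ ⟨k, rfl⟩
    exact ⟨-k, hflip k x⟩
  let Q := Quotient (Equiv.Perm.SameCycle.setoid g)
  let θQ : Q → Q := Quotient.map θ hmap
  have hQ : ∀ q, θQ (θQ q) = q := by
    rintro ⟨x⟩
    exact congrArg (Quotient.mk _) (hθ x)
  have hQ' : ∀ q, θQ q ≠ q := by
    rintro ⟨x⟩ h
    exact hnot x (Quotient.exact h).symm
  let n : Q → ℕ := fun q => (Finite.equivFin Q q : ℕ)
  have hn : Function.Injective n := Fin.val_injective.comp (Finite.equivFin Q).injective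
  -- The numbering selects one cycle of each pair. The colour is constant on cycles, and `τ x` is in
  -- the cycle of `θ x`.
  let ε : D → Bool := fun x => decide (n (Quotient.mk _ x) < n (θQ (Quotient.mk _ x)))
  have hε : ∀ x, ε (θ x) = !ε x := by
    intro x
    have h1 : (Quotient.mk (Equiv.Perm.SameCycle.setoid g) (θ x) : Q) = θQ (Quotient.mk _ x) := rfl
    have h2 := hn.ne (hQ' (Quotient.mk _ x))
    simp only [ε, h1, hQ]
    rw [← decide_not]
    refine decide_eq_decide.2 ?_
    omega
  refine ⟨ε, fun x => ?_, hε⟩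
  rw [← hε]
  have h1 : (Quotient.mk (Equiv.Perm.SameCycle.setoid g) (τ x) : Q) = Quotient.mk _ (θ x) := by
    refine Quotient.sound (show g.SameCycle _ _ from ⟨-1, ?_⟩)
    rw [zpow_neg_one, Equiv.Perm.inv_eq_iff_eq, hg, hθ]
  simp only [ε, h1]

end Permutations

/-- The involution `τ` pairs the edge ends at each vertex. Two-colouring it together with the
exchange of ends orients every edge so that `τ` pairs heads with tails. -/
theorem isMinimalSeparatingGraph_of_degree {α β : Type*} {G : Graph α β}
    (hVne : G.vertexSet.Nonempty) (hEfin : G.edgeSet.Finite)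
    (hdeg : ∀ v ∈ G.vertexSet, 0 < degree G v ∧ Even (degree G v)) :
    IsMinimalSeparatingGraph G := by
  have : Finite G.edgeSet := hEfin.to_subtype
  choose x y hxy using fun e : G.edgeSet => G.exists_isLink_of_mem_edgeSet e.2
  let vtx : G.edgeSet × Bool → α := fun d => if d.2 then y d.1 else x d.1
  have hmem : ∀ d, vtx d ∈ G.vertexSet := by
    rintro ⟨e, b⟩
    cases b
    exacts [(hxy e).left_mem, (hxy e).right_mem]
  have hcard : ∀ v, Nat.card {d // vtx d = v} = degree G v := by
    intro v
    rw [← card_ends_eq_degree hEfin (v := v) (P := fun e b => ∃ h : e ∈ G.edgeSet,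
      vtx (⟨e, h⟩, b) = v)]
    · refine Nat.card_congr ⟨fun d => ⟨(d.1.1.1, d.1.2), d.1.1.2, d.1.1.2, d.2⟩,
        fun d => ⟨(⟨d.1.1, d.2.1⟩, d.1.2), d.2.2.2⟩, fun _ => rfl, fun _ => rfl⟩
    · intro e a b hab
      have he := hab.edge_mem
      have h0 : (∃ h : e ∈ G.edgeSet, vtx (⟨e, h⟩, false) = v) ↔ v = x ⟨e, he⟩ :=
        ⟨fun ⟨_, h⟩ => h.symm, fun h => ⟨he, h.symm⟩⟩
      have h1 : (∃ h : e ∈ G.edgeSet, vtx (⟨e, h⟩, true) = v) ↔ v = y ⟨e, he⟩ :=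
        ⟨fun ⟨_, h⟩ => h.symm, fun h => ⟨he, h.symm⟩⟩
      rw [h0, h1]
      rcases (hxy ⟨e, he⟩).eq_and_eq_or_eq_and_eq hab with ⟨h, h'⟩ | ⟨h, h'⟩ <;> simp [h, h']
  have heven : ∀ v, Even (Nat.card {d // vtx d = v}) := by
    intro v
    by_cases hv : v ∈ G.vertexSet
    · rw [hcard]
      exact (hdeg v hv).2
    · have : IsEmpty {d // vtx d = v} := ⟨fun d => hv (d.2 ▸ hmem d.1)⟩
      simp
  obtain ⟨τ, hτ, hτ', hτv⟩ := exists_involution_of_even_fibers vtx heven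
  obtain ⟨ε, hετ, hεθ⟩ := exists_two_coloring (θ := fun d => (d.1, !d.2)) hτ (by simp) hτ' (by
    rintro ⟨e, b⟩ h
    simp at h)
  -- The head of an edge is its end of colour `true`.
  let hdart : G.edgeSet → G.edgeSet × Bool := fun e => (e, ε (e, true))
  let tdart : G.edgeSet → G.edgeSet × Bool := fun e => (e, !ε (e, true))
  have hε0 : ∀ e, ε (e, false) = !ε (e, true) := fun e => hεθ (e, true)
  have hdart_color : ∀ e, ε (hdart e) = true := by
    intro e
    change ε (e, ε (e, true)) = true
    cases h : ε (e, true)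
    · rw [hε0, h]
      rfl
    · exact h
  have eq_hdart : ∀ d, ε d = true → d = hdart d.1 := by
    rintro ⟨e, b⟩ h
    change (e, b) = (e, ε (e, true))
    cases b
    · rw [hε0, Bool.not_eq_true'] at h
      rw [h]
    · rw [h]
  have eq_tdart : ∀ d, ε d = false → d = tdart d.1 := by
    rintro ⟨e, b⟩ h
    change (e, b) = (e, !ε (e, true))
    cases b
    · rw [← hε0, h]
    · rw [h]
      rfl
  have hτdart : ∀ e, τ (hdart e) = tdart (τ (hdart e)).1 := fun e =>
    eq_tdart _ (by rw [hετ, hdart_color]; rfl)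
  have hinj : Function.Injective fun e => (τ (hdart e)).1 := by
    intro e e' h
    have : τ (hdart e) = τ (hdart e') := by
      rw [hτdart e, hτdart e']
      exact congrArg tdart h
    have := congrArg τ this
    rw [hτ, hτ] at this
    exact congrArg Prod.fst this
  -- `ρ e` is the edge whose tail is paired with the head of `e`.
  let ρ : Equiv.Perm G.edgeSet := Equiv.ofBijective _ (Finite.injective_iff_bijective.1 hinj)
  have hρ : ∀ e, vtx (tdart (ρ e)) = vtx (hdart e) := by
    intro e
    rw [← hτv (hdart e), hτdart e]
    rfl
  obtain ⟨κ, hκ, hκ'⟩ := exists_perm_of_fibers fun e => vtx (hdart e)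
  obtain ⟨π, hπ⟩ := exists_perm_transitive G.edgeSet
  -- The choice of `ρ * κ` and `ρ` on the two sides makes the turn around a vertex equal to `κ`, a
  -- single cycle on the edges with that head. The transitive `π` at the slits makes both sides
  -- connected.
  have hR : IsRibbon (fun e => vtx (hdart e)) (fun e => vtx (tdart e))
      fun o s => if o then (if s then ρ * κ else ρ) else π := by
    refine ⟨fun s e => ?_, fun e e' h => ?_, fun s e e' => hπ e e'⟩
    · cases s
      · exact hρ e
      · exact (hρ (κ e)).trans (hκ e)
    · simpa using hκ' e e' h
  have hsurj : ∀ v ∈ G.vertexSet, ∃ e, vtx (hdart e) = v := by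
    intro v hv
    have hpos := (hdeg v hv).1
    rw [← hcard] at hpos
    obtain ⟨⟨d, hd⟩⟩ := (Nat.card_pos_iff.1 hpos).1
    cases h : ε d
    · exact ⟨(τ d).1, by rw [← eq_hdart (τ d) (by rw [hετ, h]; rfl), hτv, hd]⟩
    · exact ⟨d.1, by rw [← eq_hdart d h, hd]⟩
  have : Nonempty G.edgeSet := by
    obtain ⟨v, hv⟩ := hVne
    obtain ⟨e, -⟩ := hsurj v hv
    exact ⟨e⟩
  refine isMinimalSeparatingGraph_of_isRibbon hR (fun e => ?_) hsurj
  cases h : ε (e, true)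
  · simpa [vtx, tdart, hdart, h] using (hxy e).symm
  · simpa [vtx, tdart, hdart, h] using hxy e

end MinSep

theorem theorem7 {α β : Type*} (G : Graph α β)
    (hVfin : G.vertexSet.Finite) (hVne : G.vertexSet.Nonempty) (hEfin : G.edgeSet.Finite) :
    MinSep.IsMinimalSeparatingGraph G ↔
      ∀ v ∈ G.vertexSet, 0 < MinSep.degree G v ∧ Even (MinSep.degree G v) :=
  ⟨fun h _ hv => MinSep.degree_pos_even hVfin hEfin h hv,
    MinSep.isMinimalSeparatingGraph_of_degree hVne hEfin⟩
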